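/- Work over $\mathbb{C}$. For a vector space $V$ of dimension $n$ let $\mathcal{N}_V\subset\mathrm{End}(V)$ be the variety of nilpotent endomorphisms. For a bipartition $(\mu;\nu)$ of $n$, i.e. a pair of partitions with $|\mu|+|\nu|=n$, let $\mathcal{O}_{\mu;\nu}\subset V\times\mathcal{N}_V$ be the $GL(V)$-orbit of the pairs $(v,x)$ for which $V$ has a basis $(v_{ij})_{i\ge 1,\,1\le j\le \mu_i+\nu_i}$ with $x v_{ij}=v_{i,j-1}$ for $j>1$, $x v_{i1}=0$, and $v=\sum_{i:\,\mu_i>0} v_{i,\mu_i}$; let $\overline{\mathcal{O}_{\mu;\nu}}$ be its Zariski closure, with its reduced structure. Let $n\ge 1$, let $(\mu;\nu)$ be a bipartition of $n$, and put $\lambda=\mu+\nu$ (termwise sum), $t=\lambda_1$ and $r_i=\lambda^{\mathbf t}_{t-i}$ for $0\le i\le t-1$, where $\lambda^{\mathbf t}$ is the transpose of $\lambda$, so that $0<r_0\le r_1\le\cdots\le r_{t-1}$ are the column lengths of $\lambda$. Let $I\subset\{0,\dots,t-1\}$ be the unique subset such that the $r_i$ with $i\in I$ are, with multiplicities, the column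 lengths of $\mu$, and such that $r_i=r_{i+1}$ and $i+1\in I$ together imply $i\in I$. Let $U_i=\mathbb{C}^{r_0+\cdots+r_{i-1}}$ for $0\le i\le t$ (so $U_0=0$ and $U_t=\mathbb{C}^n$). Let $\Lambda_{(r_i),I}$ be the (reduced) affine variety of tuples $(u_i,A_i,B_i)$ with $u_i\in U_i$ for $0\le i\le t$, and $A_i\in\mathrm{Hom}(U_i,U_{i+1})$ and $B_i\in\mathrm{Hom}(U_{i+1},U_i)$ for $0\le i\le t-1$, such that $$B_iA_i=A_{i-1}B_{i-1}\ (1\le i\le t-1),\qquad B_iu_{i+1}=u_i\ (i\in I),\qquad A_iu_i=u_{i+1}\ (i\in\{0,\dots,t-1\}\setminus I).$$ The group $\prod_{i=0}^{t}GL(U_i)$ acts on $\Lambda_{(r_i),I}$ by $(g_i)\cdot(u_i,A_i,B_i)=(g_iu_i,\,g_{i+1}A_ig_i^{-1},\,g_iB_ig_{i+1}^{-1})$; let $H=GL(U_0)\times\cdots\times GL(U_{t-1})$ act through the inclusion with $g_t=1$. **Theorem.** The map $$\Phi:\Lambda_{(r_i),I}\to U_t\times\mathcal{N}_{U_t},\qquad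 (u_i,A_i,B_i)\mapsto(u_t,\,A_{t-1}B_{t-1}),$$ is well defined (that is, $A_{t-1}B_{t-1}$ is nilpotent), has image $\overline{\mathcal{O}_{\mu;\nu}}$ (for $V=U_t$), and induces an isomorphism $$\operatorname{Spec}\mathbb{C}[\Lambda_{(r_i),I}]^H\ \overset{\sim}{\longrightarrow}\ \overline{\mathcal{O}_{\mu;\nu}}$$ from the invariant-theoretic quotient of $\Lambda_{(r_i),I}$ by $H$. -/

import Mathlib

noncomputable section

namespace EnhancedQuiver

/- Affine varieties over `ℂ`, as Zariski closed sets of points of a finite-dimensional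
vector space, with their coordinate rings (rings of regular functions). -/

/-- The algebra of polynomial functions on a complex vector space `E`: the functions `E → ℂ`
generated by the linear functionals. -/
def polyFun (E : Type) [AddCommGroup E] [Module ℂ E] : Subalgebra ℂ (E → ℂ) :=
  Algebra.adjoin ℂ (Set.range fun φ : Module.Dual ℂ E => (φ : E → ℂ))

/-- Restriction of functions from `E` to a subset `X`. -/
def restrictFun {E : Type} (X : Set E) : (E → ℂ) →ₐ[ℂ] (X → ℂ) :=
  AlgHom.pi fun x => Pi.evalAlgHom ℂ (fun _ : E => ℂ) (x : E)

/-- The coordinate ring `ℂ[X]` of a (reduced) affine variety `X ⊆ E`: the restrictions to `X` of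
the polynomial functions on `E`. -/
def coordRing {E : Type} [AddCommGroup E] [Module ℂ E] (X : Set E) : Subalgebra ℂ (X → ℂ) :=
  (polyFun E).map (restrictFun X)

/-- The Zariski closure of a set of points of `E`. -/
def zariskiClosure {E : Type} [AddCommGroup E] [Module ℂ E] (S : Set E) : Set E :=
  {x | ∀ f ∈ polyFun E, (∀ s ∈ S, f s = 0) → f x = 0}

/-- The ring of invariants `ℂ[X]^G` of a variety `X ⊆ E` that is stable under a linear action `ρ`
of `G` on `E`: the regular functions `f` on `X` with `f (g x) = f x`. -/
def invariantRing {E : Type} [AddCommGroup E] [Module ℂ E] {G : Type} [Group G]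
    (ρ : Representation ℂ G E) (X : Set E) : Subalgebra ℂ (X → ℂ) where
  carrier := {f | f ∈ coordRing X ∧ ∀ (g : G) (x y : X), ρ g (x : E) = y → f y = f x}
  mul_mem' := by
    rintro f₁ f₂ ⟨h₁, k₁⟩ ⟨h₂, k₂⟩
    exact ⟨mul_mem h₁ h₂, fun g x y h => by simp [k₁ g x y h, k₂ g x y h]⟩
  add_mem' := by
    rintro f₁ f₂ ⟨h₁, k₁⟩ ⟨h₂, k₂⟩
    exact ⟨add_mem h₁ h₂, fun g x y h => by simp [k₁ g x y h, k₂ g x y h]⟩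
  algebraMap_mem' := fun c => ⟨algebraMap_mem _ c, fun _ _ _ _ => rfl⟩

/-- The affine scheme `Spec ℂ[X]` of a variety `X`. -/
def varietyScheme {E : Type} [AddCommGroup E] [Module ℂ E] (X : Set E) :
    AlgebraicGeometry.Scheme :=
  AlgebraicGeometry.Spec (CommRingCat.of (coordRing X))

/-- The invariant-theoretic quotient of `X` by `G`, that is `Spec (ℂ[X]^G)`. -/
def gitQuotient {E : Type} [AddCommGroup E] [Module ℂ E] {G : Type} [Group G]
    (ρ : Representation ℂ G E) (X : Set E) : AlgebraicGeometry.Scheme :=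
  AlgebraicGeometry.Spec (CommRingCat.of (invariantRing ρ X))

/-- The morphism `Spec (ℂ[X]^G) → Spec ℂ[Y]` defined by an algebra homomorphism
`ℂ[Y] → ℂ[X]^G`. -/
def quotientMap {E F : Type} [AddCommGroup E] [Module ℂ E] [AddCommGroup F] [Module ℂ F]
    {G : Type} [Group G] {ρ : Representation ℂ G E} {X : Set E} {Y : Set F}
    (ψ : coordRing Y →ₐ[ℂ] invariantRing ρ X) : gitQuotient ρ X ⟶ varietyScheme Y :=
  AlgebraicGeometry.Spec.map (CommRingCat.ofHom (ψ : coordRing Y →+* invariantRing ρ X))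

/- Partitions are represented by Young diagrams; `μ.rowLen i` is the part `μ_{i+1}`, and
`μ.colLen j` is the length of column `j+1`, i.e. the `(j+1)`-st part of the transpose. -/

/-- The sum `μ + ν` of two partitions (termwise addition of parts). -/
def partSum (μ ν : YoungDiagram) : YoungDiagram where
  cells := (Finset.range (μ.colLen 0 + ν.colLen 0) ×ˢ
    Finset.range (μ.rowLen 0 + ν.rowLen 0)).filter
      fun c => c.2 < μ.rowLen c.1 + ν.rowLen c.1
  isLowerSet := by
    rintro ⟨i, j⟩ ⟨i', j'⟩ ⟨hi, hj⟩ h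
    simp only [Finset.coe_filter, Finset.mem_product, Finset.mem_range, Set.mem_ofPred_eq]
      at h hi hj ⊢
    have h₁ := μ.rowLen_anti i' i hi
    have h₂ := ν.rowLen_anti i' i hi
    omega

theorem mem_partSum (μ ν : YoungDiagram) (i j : ℕ) :
    (i, j) ∈ partSum μ ν ↔ j < μ.rowLen i + ν.rowLen i := by
  have h₁ := μ.rowLen_anti 0 i (Nat.zero_le i)
  have h₂ := ν.rowLen_anti 0 i (Nat.zero_le i)
  rw [← YoungDiagram.mem_cells]
  simp only [partSum, Finset.mem_filter, Finset.mem_product, Finset.mem_range]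
  constructor
  · exact fun h => h.2
  · intro h
    refine ⟨⟨?_, by omega⟩, h⟩
    rcases Nat.eq_zero_or_pos (μ.rowLen i) with h0 | h0
    · have : 0 < ν.rowLen i := by omega
      have := YoungDiagram.mem_iff_lt_colLen.1 (YoungDiagram.mem_iff_lt_rowLen.2 this)
      omega
    · have := YoungDiagram.mem_iff_lt_colLen.1 (YoungDiagram.mem_iff_lt_rowLen.2 h0)
      omega

theorem rowLen_partSum (μ ν : YoungDiagram) (i : ℕ) :
    (partSum μ ν).rowLen i = μ.rowLen i + ν.rowLen i := by
  apply eq_of_forall_lt_iff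
  intro j
  rw [← YoungDiagram.mem_iff_lt_rowLen, mem_partSum]

/- Enhanced nilpotent orbits. -/

/-- The enhanced nilpotent cone `V × 𝒩_V`, as a set of points of `V × End V`. -/
def enhancedNilpotentCone (V : Type) [AddCommGroup V] [Module ℂ V] :
    Set (V × (V →ₗ[ℂ] V)) :=
  {p | IsNilpotent p.2}

/-- The orbit `𝒪_{μ;ν}`: the pairs `(v, x)` having a normal basis, that is, a basis of `V` indexed
by the boxes of the diagram of `(μ;ν)` such that `x` sends a box to the box on its left, or to zero
if there is none, and `v` is the sum of the boxes immediately left of the wall. The boxes of row `i`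
are numbered `0, …, μ_i + ν_i - 1` from left to right, the first `μ_i` of them being left of the
wall. -/
def enhancedOrbit (μ ν : YoungDiagram) (V : Type) [AddCommGroup V] [Module ℂ V] :
    Set (V × (V →ₗ[ℂ] V)) :=
  {p | ∃ b : Module.Basis (partSum μ ν).cells ℂ V,
    (∀ (i : ℕ) (h : (i, 0) ∈ (partSum μ ν).cells), p.2 (b ⟨(i, 0), h⟩) = 0) ∧
    (∀ (i j : ℕ) (h : (i, j + 1) ∈ (partSum μ ν).cells) (h' : (i, j) ∈ (partSum μ ν).cells),
      p.2 (b ⟨(i, j + 1), h⟩) = b ⟨(i, j), h'⟩) ∧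
    p.1 = ∑ c : (partSum μ ν).cells, if c.1.2 + 1 = μ.rowLen c.1.1 then b c else 0}

/-- The closure of the orbit `𝒪_{μ;ν}`. -/
def enhancedOrbitClosure (μ ν : YoungDiagram) (V : Type) [AddCommGroup V] [Module ℂ V] :
    Set (V × (V →ₗ[ℂ] V)) :=
  zariskiClosure (enhancedOrbit μ ν V)

/- Enhanced quiver varieties. The number of columns is written `t = m + 1`. -/

/-- The column lengths of `μ + ν` in increasing order, `r_i = (μ + ν)ᵗ_{t-i}` for
`0 ≤ i ≤ m = t - 1`. -/
def colSeq (μ ν : YoungDiagram) (m i : ℕ) : ℕ := (partSum μ ν).colLen (m - i)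

/-- `I ⊆ {0, …, t-1}` is the subset attached to `(μ;ν)`: the `r_i` with `i ∈ I` are the column
lengths of `μ`, and `r_i = r_{i+1}` and `i + 1 ∈ I` imply `i ∈ I`. -/
structure IsColumnSet (μ ν : YoungDiagram) (m : ℕ) (I : Finset (Fin (m + 1))) : Prop where
  colLens : I.val.map (fun i : Fin (m + 1) => colSeq μ ν m i) = (μ.transpose.rowLens : Multiset ℕ)
  ties : ∀ i : Fin m, colSeq μ ν m i = colSeq μ ν m (i + 1) → i.succ ∈ I → i.castSucc ∈ I

/-- The vector space `U_i = ℂ^{r_0 + ⋯ + r_{i-1}}`. -/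
abbrev U (r : ℕ → ℕ) (i : ℕ) : Type := Fin (∑ j ∈ Finset.range i, r j) → ℂ

/-- The space of all tuples `(u_i, A_i, B_i)` with `u_i ∈ U_i` for `0 ≤ i ≤ t`, and
`A_i : U_i → U_{i+1}` and `B_i : U_{i+1} → U_i` for `0 ≤ i ≤ t - 1`. -/
abbrev RepSpace (r : ℕ → ℕ) (m : ℕ) : Type :=
  (∀ i : Fin (m + 2), U r i) ×
    (∀ i : Fin (m + 1), U r i →ₗ[ℂ] U r (i + 1)) ×
    (∀ i : Fin (m + 1), U r (i + 1) →ₗ[ℂ] U r i)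

/-- The enhanced quiver variety `Λ_{(r_i), I}`: the tuples `(u_i, A_i, B_i)` with
`B_i A_i = A_{i-1} B_{i-1}` for `1 ≤ i ≤ t - 1`, with `B_i u_{i+1} = u_i` for `i ∈ I`, and with
`A_i u_i = u_{i+1}` for `i ∉ I`. -/
def quiverVariety (r : ℕ → ℕ) (m : ℕ) (I : Finset (Fin (m + 1))) : Set (RepSpace r m) :=
  {p | (∀ i : Fin m, p.2.2 i.succ ∘ₗ p.2.1 i.succ = p.2.1 i.castSucc ∘ₗ p.2.2 i.castSucc) ∧
    (∀ i ∈ I, p.2.2 i (p.1 i.succ) = p.1 i.castSucc) ∧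
    (∀ i ∉ I, p.2.1 i (p.1 i.castSucc) = p.1 i.succ)}

/-- The linear action of `GL(U_0) × ⋯ × GL(U_t)` on tuples,
`(g_i) · (u_i, A_i, B_i) = (g_i u_i, g_{i+1} A_i g_i⁻¹, g_i B_i g_{i+1}⁻¹)`. -/
def gaugeRep (r : ℕ → ℕ) (m : ℕ) :
    Representation ℂ (∀ i : Fin (m + 2), LinearMap.GeneralLinearGroup ℂ (U r i))
      (RepSpace r m) where
  toFun g :=
    { toFun := fun p =>
        (fun i => (g i : U r i →ₗ[ℂ] U r i) (p.1 i),
         fun i => (g i.succ : U r i.succ →ₗ[ℂ] U r i.succ) ∘ₗ p.2.1 i ∘ₗ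
           ((g i.castSucc)⁻¹ : LinearMap.GeneralLinearGroup ℂ (U r i.castSucc)).1,
         fun i => (g i.castSucc : U r i.castSucc →ₗ[ℂ] U r i.castSucc) ∘ₗ p.2.2 i ∘ₗ
           ((g i.succ)⁻¹ : LinearMap.GeneralLinearGroup ℂ (U r i.succ)).1)
      map_add' := by
        intro p q
        refine Prod.ext ?_ (Prod.ext ?_ ?_)
        · funext i; exact map_add (g i).1 _ _
        · funext i; exact LinearMap.ext fun w => map_add (g i.succ).1 _ _
        · funext i; exact LinearMap.ext fun w => map_add (g i.castSucc).1 _ _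
      map_smul' := by
        intro c p
        refine Prod.ext ?_ (Prod.ext ?_ ?_)
        · funext i; exact map_smul (g i).1 c _
        · funext i; exact LinearMap.ext fun w => map_smul (g i.succ).1 c _
        · funext i; exact LinearMap.ext fun w => map_smul (g i.castSucc).1 c _ }
  map_one' := by
    ext1 <;> rfl
  map_mul' := by
    intro g h
    refine LinearMap.ext fun p => Prod.ext rfl (Prod.ext ?_ ?_)
    · funext i
      simp only [Pi.mul_apply, mul_inv_rev]
      rfl
    · funext i
      simp only [Pi.mul_apply, mul_inv_rev]
      rfl

/-- The inclusion of `H = GL(U_0) × ⋯ × GL(U_{t-1})` in `GL(U_0) × ⋯ × GL(U_t)`. -/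
def inclH (r : ℕ → ℕ) (m : ℕ) :
    (∀ i : Fin (m + 1), LinearMap.GeneralLinearGroup ℂ (U r i)) →*
      (∀ i : Fin (m + 2), LinearMap.GeneralLinearGroup ℂ (U r i)) where
  toFun g i := if h : (i : ℕ) < m + 1 then g ⟨i, h⟩ else 1
  map_one' := by
    funext i
    by_cases h : (i : ℕ) < m + 1 <;> simp [h]
  map_mul' g g' := by
    funext i
    rw [Pi.mul_apply]
    split_ifs
    · rfl
    · exact (one_mul 1).symm

/-- The action of `H = GL(U_0) × ⋯ × GL(U_{t-1})` on tuples. -/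
def repH (r : ℕ → ℕ) (m : ℕ) :
    Representation ℂ (∀ i : Fin (m + 1), LinearMap.GeneralLinearGroup ℂ (U r i))
      (RepSpace r m) :=
  (gaugeRep r m).comp (inclH r m)

/-- The enhanced quiver variety is stable under the group action. -/
theorem gaugeRep_mem (r : ℕ → ℕ) (m : ℕ) (I : Finset (Fin (m + 1)))
    (g : ∀ i : Fin (m + 2), LinearMap.GeneralLinearGroup ℂ (U r i)) (p : RepSpace r m)
    (hp : p ∈ quiverVariety r m I) : gaugeRep r m g p ∈ quiverVariety r m I := by
  have key : ∀ (i : Fin (m + 2)) (w : U r i),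
      ((g i)⁻¹ : LinearMap.GeneralLinearGroup ℂ (U r i)).1 ((g i).1 w) = w := by
    intro i w
    rw [← Module.End.mul_apply, ← Units.val_mul, inv_mul_cancel]
    rfl
  obtain ⟨h₁, h₂, h₃⟩ := hp
  refine ⟨fun i => ?_, fun i hi => ?_, fun i hi => ?_⟩
  · refine LinearMap.ext fun w => ?_
    have e := LinearMap.congr_fun (h₁ i)
      (((g i.succ.castSucc)⁻¹ : LinearMap.GeneralLinearGroup ℂ (U r i.succ.castSucc)).1 w)
    refine ((congrArg (fun z => (g i.succ.castSucc).1 (p.2.2 i.succ z))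
      (key i.succ.succ _)).trans (congrArg (g i.succ.castSucc).1 e)).trans ?_
    exact congrArg (fun z => (g i.castSucc.succ).1 (p.2.1 i.castSucc z))
      (key i.castSucc.castSucc _).symm
  · exact (congrArg (fun z => (g i.castSucc).1 (p.2.2 i z)) (key i.succ _)).trans
      (congrArg (g i.castSucc).1 (h₂ i hi))
  · exact (congrArg (fun z => (g i.succ).1 (p.2.1 i z)) (key i.castSucc _)).trans
      (congrArg (g i.succ).1 (h₃ i hi))

/-- The map `(u_i, A_i, B_i) ↦ (u_t, A_{t-1} B_{t-1})`. -/
def quiverMap (r : ℕ → ℕ) (m : ℕ) (p : RepSpace r m) :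
    U r (m + 1) × (U r (m + 1) →ₗ[ℂ] U r (m + 1)) :=
  (p.1 (Fin.last (m + 1)), p.2.1 (Fin.last m) ∘ₗ p.2.2 (Fin.last m))

end EnhancedQuiver

end

/-!
Write `Λ` for the quiver variety, `Φ` for the map `(u_i, A_i, B_i) ↦ (u_t, A_{t-1} B_{t-1})`, and
`t = m + 1`. The theorem follows from three facts.

*Invariants of `Λ` are polynomials in `Φ`.* The vertices `U_0, …, U_{t-1}` are eliminated one after
the other. Averaging over the unitary subgroup of `GL(U_i)` turns a polynomial in the maps into and
out of `U_i` into a polynomial in their composites through `U_i` (`average_mem`). This is the first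
fundamental theorem for the general linear group, which is proved in its tensor form
(`exists_perm_coeff`) by means of the Zariski density of the unitary group (`eq_zero_of_unitary`).
The relations of the quiver express everything else by coordinates at later vertices
(`average_mem_tailAlg`). The composite of these averages is a Reynolds operator with values in the
polynomial functions of `Φ` (`exists_reynolds`). Hence invariants are polynomials in `Φ`
(`exists_polyFun_of_invariant`), and, by the Nullstellensatz, the image of `Φ` is Zariski closed
(`zariskiClosure_image_subset`).

*The image lies in the orbit closure.* Arrange the boxes of `(μ;ν)` in rows aligned at the wall, and
consider the flags whose members have the dimensions of the unions of the leftmost columns. Adding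
one vertex at a time, a point of `Λ` is seen to yield a flag of this kind in `U_t` which is shifted
down by `A_{t-1} B_{t-1}` and whose member at the wall contains `u_t` (`exists_flag_quiverMap`);
this is where the choice of `I` among columns of equal length matters. In particular
`A_{t-1} B_{t-1}` is nilpotent. For a fixed flag, the pairs with these properties form a vector
space, in which the normal form has a full tangent space under the automorphisms of the flag
(`exists_tangent`). So the orbit contains all points near the normal form on each line through it in
that space, and its closure contains the space (`mem_enhancedOrbitClosure_of_boxFlag`).

*The orbit lies in the image.* Over `(v, x)`, take for `U_i` the image of `x ^ (t - i)`, for `A_i`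
the inclusion, for `B_i` the restriction of `x`, and `u_i = x ^ k v` with `k` the number of `j ∈ I`
with `i ≤ j` (`enhancedOrbit_subset_image`).

As the image is closed, it equals the orbit closure. Pulling functions back along `Φ` is then
injective, and it is onto the invariants by the first fact (`pullback_bijective`).
-/

namespace EnhancedQuiver

/-! ### Averaging over the unitary group -/

section unitary

open MeasureTheory

theorem isCompact_unitaryGroup (n : ℕ) :
    IsCompact (Matrix.unitaryGroup (Fin n) ℂ : Set (Matrix (Fin n) (Fin n) ℂ)) := by
  have hK : IsCompact (Set.pi Set.univ fun _ : Fin n => Set.pi Set.univ fun _ : Fin n =>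
      Metric.closedBall (0 : ℂ) 1) :=
    isCompact_univ_pi fun _ => isCompact_univ_pi fun _ => isCompact_closedBall _ _
  refine IsCompact.of_isClosed_subset hK ?_ ?_
  · have : (Matrix.unitaryGroup (Fin n) ℂ : Set (Matrix (Fin n) (Fin n) ℂ)) =
        {A | A * star A = 1} := by
      ext A; exact Matrix.mem_unitaryGroup_iff
    rw [this]
    exact isClosed_eq (continuous_id.matrix_mul continuous_star) continuous_const
  · intro A hA i _ j _
    simpa using entry_norm_bound_of_unitary hA i j

/-- The Haar integral on the unitary group, as a left invariant normalized functional on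
continuous functions. -/
theorem exists_haarFunctional (n : ℕ) :
    ∃ E : C(Matrix.unitaryGroup (Fin n) ℂ, ℂ) →ₗ[ℂ] ℂ, E 1 = 1 ∧
      ∀ (h : Matrix.unitaryGroup (Fin n) ℂ) (f f' : C(Matrix.unitaryGroup (Fin n) ℂ, ℂ)),
        (∀ g, f' g = f (h * g)) → E f' = E f := by
  have : CompactSpace (Matrix.unitaryGroup (Fin n) ℂ) :=
    isCompact_iff_compactSpace.1 (isCompact_unitaryGroup n)
  let _ : MeasurableSpace (Matrix.unitaryGroup (Fin n) ℂ) := borel _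
  have : BorelSpace (Matrix.unitaryGroup (Fin n) ℂ) := ⟨rfl⟩
  let μ : Measure (Matrix.unitaryGroup (Fin n) ℂ) := Measure.haarMeasure ⊤
  have hμ : μ Set.univ = 1 := Measure.haarMeasure_self
  have : IsProbabilityMeasure μ := ⟨hμ⟩
  have hint (f : C(Matrix.unitaryGroup (Fin n) ℂ, ℂ)) : Integrable (fun g => f g) μ :=
    f.continuous.integrable_of_hasCompactSupport (HasCompactSupport.of_compactSpace _)
  refine ⟨{ toFun := fun f => ∫ g, f g ∂μ, map_add' := ?_, map_smul' := ?_ }, ?_, ?_⟩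
  · intro f f'
    exact integral_add (hint f) (hint f')
  · intro c f
    exact integral_const_mul c _
  · simp
  · intro h f f' hf
    simp only [LinearMap.coe_mk, AddHom.coe_mk, hf]
    exact integral_mul_left_eq_self (fun g => f g) h

theorem infinite_sphere : (Metric.sphere (0 : ℂ) 1).Infinite := by
  have h : (Metric.sphere (0 : ℂ) 1).Infinite :=
    (isPreconnected_sphere (by simp [Complex.rank_real_complex]) 0 1).infinite_of_nontrivial
      ⟨1, by simp, -1, by simp, by norm_num⟩
  exact h

/-- The unitary matrices are Zariski dense in the space of all matrices: diagonal matrices with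
entries on the unit circle are dense among the diagonal ones, so that all Hermitian matrices lie in
the closure, and these form a real structure on the space of matrices. -/
theorem eq_zero_of_unitary {n : ℕ} (p : MvPolynomial (Fin n × Fin n) ℂ)
    (hp : ∀ u ∈ Matrix.unitaryGroup (Fin n) ℂ,
      MvPolynomial.eval (fun ij => u ij.1 ij.2) p = 0) : p = 0 := by
  have hherm : ∀ H : Matrix (Fin n) (Fin n) ℂ, H.IsHermitian →
      MvPolynomial.eval (fun ij => H ij.1 ij.2) p = 0 := by
    intro H hH
    let u := hH.eigenvectorUnitary
    let q : MvPolynomial (Fin n) ℂ := MvPolynomial.bind₁ (fun ij : Fin n × Fin n =>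
      ∑ k, MvPolynomial.C (u.1 ij.1 k) * MvPolynomial.X k * MvPolynomial.C (star (u.1 ij.2 k))) p
    have hq (z : Fin n → ℂ) : MvPolynomial.eval z q = MvPolynomial.eval
        (fun ij => (u.1 * Matrix.diagonal z * star u.1) ij.1 ij.2) p := by
      rw [← MvPolynomial.coe_aeval_eq_eval, RingHom.coe_coe, MvPolynomial.aeval_bind₁,
        ← MvPolynomial.coe_aeval_eq_eval, RingHom.coe_coe]
      congr 2
      funext ij
      simp [Matrix.mul_apply, Matrix.diagonal_apply, Matrix.star_apply]
    have hq0 : q = 0 := by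
      refine MvPolynomial.funext_set (fun _ => Metric.sphere (0 : ℂ) 1)
        (fun _ => infinite_sphere) fun z hz => ?_
      rw [hq, map_zero]
      refine hp _ (mul_mem (mul_mem u.2 ?_) (Unitary.star_mem u.2))
      rw [Matrix.mem_unitaryGroup_iff, Matrix.star_eq_conjTranspose,
        Matrix.diagonal_conjTranspose, Matrix.diagonal_mul_diagonal, ← Matrix.diagonal_one]
      congr 1
      funext i
      have hzi : ‖z i‖ = 1 := by simpa using hz i (Set.mem_univ i)
      simp [Complex.mul_conj, Complex.normSq_eq_norm_sq, hzi]
    have := hq (fun i => (hH.eigenvalues i : ℂ))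
    rw [hq0, map_zero] at this
    rw [this]
    congr 2
    funext ij
    conv_lhs => rw [hH.spectral_theorem]
    rfl
  -- every matrix has the form `X + Xᵀ + i (Y - Yᵀ)`, which is Hermitian for real `X` and `Y`
  let r : MvPolynomial ((Fin n × Fin n) ⊕ (Fin n × Fin n)) ℂ :=
    MvPolynomial.bind₁ (fun ij : Fin n × Fin n =>
      MvPolynomial.X (Sum.inl ij) + MvPolynomial.X (Sum.inl ij.swap) +
        MvPolynomial.C Complex.I *
          (MvPolynomial.X (Sum.inr ij) - MvPolynomial.X (Sum.inr ij.swap))) p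
  have hr (z : (Fin n × Fin n) ⊕ (Fin n × Fin n) → ℂ) : MvPolynomial.eval z r =
      MvPolynomial.eval (fun ij => z (Sum.inl ij) + z (Sum.inl ij.swap) +
        Complex.I * (z (Sum.inr ij) - z (Sum.inr ij.swap))) p := by
    rw [← MvPolynomial.coe_aeval_eq_eval, RingHom.coe_coe, MvPolynomial.aeval_bind₁,
        ← MvPolynomial.coe_aeval_eq_eval, RingHom.coe_coe]
    congr 2
    funext ij
    simp
  have hr0 : r = 0 := by
    refine MvPolynomial.funext_set (fun _ => Set.range ((↑) : ℝ → ℂ))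
      (fun _ => Set.infinite_range_of_injective Complex.ofReal_injective) fun z hz => ?_
    rw [hr, map_zero]
    refine hherm (Matrix.of fun i j => z (Sum.inl (i, j)) + z (Sum.inl (j, i)) +
        Complex.I * (z (Sum.inr (i, j)) - z (Sum.inr (j, i)))) ?_
    have hz' : ∀ k, (starRingEnd ℂ) (z k) = z k := by
      intro k
      obtain ⟨x, hx⟩ := hz k (Set.mem_univ k)
      rw [← hx, Complex.conj_ofReal]
    ext i j
    simp [Matrix.conjTranspose_apply, hz']
    ring
  refine MvPolynomial.funext fun G => ?_
  have := hr (Sum.elim (fun ij => (G ij + G ij.swap) / 4)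
    (fun ij => (G ij - G ij.swap) / (4 * Complex.I)))
  rw [hr0, map_zero] at this
  rw [map_zero, this]
  congr 2
  funext ij
  have hI := Complex.I_ne_zero
  simp only [Sum.elim_inl, Sum.elim_inr, Prod.swap_swap]
  field_simp
  ring

end unitary

/-! ### The tensor form of the first fundamental theorem for the general linear group -/

/-- The matrix of the `a`-th tensor power of a matrix. -/
def tensPow {R : Type} [CommRing R] {n : ℕ} (a : ℕ) (G : Matrix (Fin n) (Fin n) R) :
    Matrix (Fin a → Fin n) (Fin a → Fin n) R :=
  Matrix.of fun i j => ∏ k, G (i k) (j k)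

theorem prod_sum_eq {R : Type} [CommRing R] {n a : ℕ} (f : Fin a → Fin n → R) :
    ∏ k, ∑ c, f k c = ∑ c : Fin a → Fin n, ∏ k, f k (c k) := by
  rw [Finset.prod_univ_sum, Fintype.piFinset_univ]

theorem tensPow_mul {R : Type} [CommRing R] {n : ℕ} (a : ℕ) (G H : Matrix (Fin n) (Fin n) R) :
    tensPow a (G * H) = tensPow a G * tensPow a H := by
  ext i j
  simp only [tensPow, Matrix.of_apply, Matrix.mul_apply, prod_sum_eq, Finset.prod_mul_distrib]

theorem tensPow_one {R : Type} [CommRing R] {n : ℕ} (a : ℕ) :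
    tensPow a (1 : Matrix (Fin n) (Fin n) R) = 1 := by
  ext i j
  simp only [tensPow, Matrix.of_apply, Matrix.one_apply, funext_iff]
  by_cases h : ∀ k, i k = j k
  · simp [h]
  · rw [if_neg h]
    push Not at h
    obtain ⟨k, hk⟩ := h
    exact Finset.prod_eq_zero (Finset.mem_univ k) (if_neg hk)

theorem tensPow_smul_one {n : ℕ} (a : ℕ) (c : ℂ) :
    tensPow a (c • (1 : Matrix (Fin n) (Fin n) ℂ)) = c ^ a • 1 := by
  rw [← tensPow_one]
  ext i j
  simp [tensPow, Finset.prod_mul_distrib]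

/-- The exponent of the monomial `∏ₖ x_{i_k j_k}` in the entries of a generic matrix. -/
noncomputable def tensExp {n a : ℕ} (i j : Fin a → Fin n) : Fin n × Fin n →₀ ℕ :=
  ∑ k, Finsupp.single (i k, j k) 1

theorem eval_monomial_tensExp {n a : ℕ} (i j : Fin a → Fin n) (c : ℂ)
    (u : Matrix (Fin n) (Fin n) ℂ) :
    MvPolynomial.eval (fun ij => u ij.1 ij.2) (MvPolynomial.monomial (tensExp i j) c) =
      c * tensPow a u i j := by
  rw [MvPolynomial.eval_monomial, tensExp, tensPow, Matrix.of_apply]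
  congr 1
  rw [Finsupp.prod_pow]
  simp only [Finsupp.coe_finsetSum, Finset.sum_apply]
  simp_rw [← Finset.prod_pow_eq_pow_sum]
  rw [Finset.prod_comm]
  refine Finset.prod_congr rfl fun k _ => ?_
  rw [Finset.prod_eq_single (i k, j k)]
  · simp
  · intro b _ hb
    simp [hb.symm]
  · simp

theorem tensExp_eq {n d : ℕ} {i j i' j' : Fin d → Fin n} (h : tensExp i j = tensExp i' j') :
    ∃ σ : Equiv.Perm (Fin d), i' = i ∘ σ ∧ j' = j ∘ σ := by
  have key : ∀ f g : Fin d → Fin n × Fin n,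
      (∑ k, Finsupp.single (f k) 1 : Fin n × Fin n →₀ ℕ) = ∑ k, Finsupp.single (g k) 1 →
      ∃ σ : Equiv.Perm (Fin d), g = f ∘ σ := by
    intro f g hfg
    have hc : ∀ x, Fintype.card {k // g k = x} = Fintype.card {k // f k = x} := by
      intro x
      have := DFunLike.congr_fun hfg x
      simpa [Finsupp.single_apply, Fintype.card_subtype] using this.symm
    let e : ∀ x, {k // g k = x} ≃ {k // f k = x} := fun x => Fintype.equivOfCardEq (hc x)
    refine ⟨(Equiv.sigmaFiberEquiv g).symm.trans ((Equiv.sigmaCongrRight e).trans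
      (Equiv.sigmaFiberEquiv f)), ?_⟩
    funext k
    exact ((e (g k)) ⟨k, rfl⟩).2.symm
  obtain ⟨σ, hσ⟩ := key (fun k => (i k, j k)) (fun k => (i' k, j' k)) h
  exact ⟨σ, funext fun k => congrArg Prod.fst (congrFun hσ k),
    funext fun k => congrArg Prod.snd (congrFun hσ k)⟩

/-- The intertwining relation holds for the generic matrix, since unitary matrices are dense. -/
theorem sum_monomial_eq {n a b : ℕ} (N : Matrix (Fin b → Fin n) (Fin a → Fin n) ℂ)
    (hN : ∀ u ∈ Matrix.unitaryGroup (Fin n) ℂ, tensPow b u * N = N * tensPow a u)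
    (i : Fin b → Fin n) (j : Fin a → Fin n) :
    ∑ c, MvPolynomial.monomial (tensExp i c) (N c j) =
      ∑ c, MvPolynomial.monomial (tensExp c j) (N i c) := by
  rw [← sub_eq_zero]
  refine eq_zero_of_unitary _ fun u hu => ?_
  simp only [map_sub, map_sum, eval_monomial_tensExp]
  have := congrFun (congrFun (hN u hu) i) j
  simp only [Matrix.mul_apply] at this
  rw [← this, sub_eq_zero]
  exact Finset.sum_congr rfl fun c _ => mul_comm _ _

/-- There are no intertwiners between different tensor powers, as scalar matrices act on them by
different scalars. -/
theorem intertwiner_eq_zero {n a b : ℕ} (hab : a ≠ b)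
    (N : Matrix (Fin b → Fin n) (Fin a → Fin n) ℂ)
    (hN : ∀ u ∈ Matrix.unitaryGroup (Fin n) ℂ, tensPow b u * N = N * tensPow a u) : N = 0 := by
  have h2 : tensPow b ((2 : ℂ) • (1 : Matrix (Fin n) (Fin n) ℂ)) * N =
      N * tensPow a ((2 : ℂ) • (1 : Matrix (Fin n) (Fin n) ℂ)) := by
    ext i j
    have := congrArg (MvPolynomial.eval
      (fun ij => ((2 : ℂ) • (1 : Matrix (Fin n) (Fin n) ℂ)) ij.1 ij.2)) (sum_monomial_eq N hN i j)
    simp only [map_sum, eval_monomial_tensExp] at this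
    rw [Matrix.mul_apply, Matrix.mul_apply, ← this]
    exact Finset.sum_congr rfl fun c _ => mul_comm _ _
  rw [tensPow_smul_one, tensPow_smul_one, Matrix.smul_mul, Matrix.mul_smul, Matrix.one_mul,
    Matrix.mul_one, ← sub_eq_zero, ← sub_smul] at h2
  refine (smul_eq_zero.1 h2).resolve_left fun h => hab ?_
  have h' : ((2 ^ b : ℕ) : ℂ) = ((2 ^ a : ℕ) : ℂ) := by
    push_cast
    exact sub_eq_zero.1 h
  exact (Nat.pow_right_injective le_rfl (Nat.cast_injective h')).symm

/-- A matrix commuting with the tensor powers of all unitary matrices commutes with all matrices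
that are invariant under simultaneous permutation of the tensor factors. -/
theorem commute_of_symmetric {n d : ℕ} (N : Matrix (Fin d → Fin n) (Fin d → Fin n) ℂ)
    (hN : ∀ u ∈ Matrix.unitaryGroup (Fin n) ℂ, tensPow d u * N = N * tensPow d u)
    (S : Matrix (Fin d → Fin n) (Fin d → Fin n) ℂ)
    (hS : ∀ (σ : Equiv.Perm (Fin d)) i j, S (i ∘ σ) (j ∘ σ) = S i j) : S * N = N * S := by
  classical
  let M : Finset (Fin n × Fin n →₀ ℕ) :=
    Finset.univ.image fun ij : (Fin d → Fin n) × (Fin d → Fin n) => tensExp ij.1 ij.2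
  let O : (Fin n × Fin n →₀ ℕ) → Matrix (Fin d → Fin n) (Fin d → Fin n) ℂ :=
    fun m => Matrix.of fun i j => if tensExp i j = m then 1 else 0
  -- compare coefficients of the monomial `m` in the relation for the generic matrix
  have hO (m) : O m * N = N * O m := by
    ext i j
    have := congrArg (MvPolynomial.coeff m) (sum_monomial_eq N hN i j)
    simpa [O, Matrix.mul_apply, MvPolynomial.coeff_sum, MvPolynomial.coeff_monomial] using this
  let s : (Fin n × Fin n →₀ ℕ) → ℂ := fun m =>
    if h : ∃ ij : (Fin d → Fin n) × (Fin d → Fin n), tensExp ij.1 ij.2 = m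
      then S h.choose.1 h.choose.2 else 0
  have hs (i j) : s (tensExp i j) = S i j := by
    have h : ∃ ij : (Fin d → Fin n) × (Fin d → Fin n), tensExp ij.1 ij.2 = tensExp i j :=
      ⟨(i, j), rfl⟩
    obtain ⟨σ, h₁, h₂⟩ := tensExp_eq h.choose_spec
    simp only [s]
    rw [dif_pos h]
    exact (hS σ _ _).symm.trans (congrArg₂ S h₁.symm h₂.symm)
  have hsum : S = ∑ m ∈ M, s m • O m := by
    ext i j
    simp only [Matrix.sum_apply, Matrix.smul_apply, O, Matrix.of_apply, smul_eq_mul, mul_ite,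
      mul_one, mul_zero, Finset.sum_ite_eq]
    rw [if_pos (Finset.mem_image_of_mem (fun ij : (Fin d → Fin n) × (Fin d → Fin n) =>
      tensExp ij.1 ij.2) (Finset.mem_univ (i, j))), hs]
  rw [hsum, Finset.sum_mul, Finset.mul_sum]
  exact Finset.sum_congr rfl fun m _ => by rw [Matrix.smul_mul, Matrix.mul_smul, hO]

/-- The first fundamental theorem in tensor form: the commutant of the tensor powers of unitary
matrices is spanned by the permutations of the tensor factors. Given `commute_of_symmetric`, this
is the double centralizer theorem for the symmetric group; averaging a projection onto the span of
the permutations produces an equivariant map with which the given matrix commutes. -/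
theorem exists_perm_coeff {n d : ℕ} (N : Matrix (Fin d → Fin n) (Fin d → Fin n) ℂ)
    (hN : ∀ u ∈ Matrix.unitaryGroup (Fin n) ℂ, tensPow d u * N = N * tensPow d u) :
    ∃ c : Equiv.Perm (Fin d) → ℂ, ∀ i j,
      N i j = ∑ σ : Equiv.Perm (Fin d), if i ∘ σ = j then c σ else 0 := by
  classical
  let act : Equiv.Perm (Fin d) → Matrix (Fin d → Fin n) (Fin d → Fin n) ℂ →ₗ[ℂ]
      Matrix (Fin d → Fin n) (Fin d → Fin n) ℂ := fun σ =>
    { toFun := fun Z => Matrix.of fun i j => Z (i ∘ σ) j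
      map_add' := fun _ _ => rfl
      map_smul' := fun _ _ => rfl }
  have act_apply (σ Z i j) : act σ Z i j = Z (i ∘ σ) j := rfl
  have act_act (σ τ Z) : act σ (act τ Z) = act (σ * τ) Z := rfl
  have act_mul (σ Z) (A : Matrix (Fin d → Fin n) (Fin d → Fin n) ℂ) :
      act σ (Z * A) = act σ Z * A := rfl
  let B : Submodule ℂ (Matrix (Fin d → Fin n) (Fin d → Fin n) ℂ) :=
    Submodule.span ℂ (Set.range fun σ => act σ 1)
  have hB (σ) {Z} (hZ : Z ∈ B) : act σ Z ∈ B := by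
    have : B ≤ B.comap (act σ) := Submodule.span_le.2 (by
      rintro _ ⟨τ, rfl⟩
      exact Submodule.subset_span ⟨σ * τ, rfl⟩)
    exact this hZ
  obtain ⟨g, hg⟩ := B.subtype.exists_leftInverse_of_injective B.ker_subtype
  let π : Matrix (Fin d → Fin n) (Fin d → Fin n) ℂ →ₗ[ℂ]
      Matrix (Fin d → Fin n) (Fin d → Fin n) ℂ := B.subtype ∘ₗ g
  have hπB (Z) : π Z ∈ B := (g Z).2
  have hπ {Z} (hZ : Z ∈ B) : π Z = Z :=
    congrArg Subtype.val (LinearMap.congr_fun hg ⟨Z, hZ⟩)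
  let av : Matrix (Fin d → Fin n) (Fin d → Fin n) ℂ →ₗ[ℂ]
      Matrix (Fin d → Fin n) (Fin d → Fin n) ℂ := ∑ σ, act σ⁻¹ ∘ₗ π ∘ₗ act σ
  have av_apply (Z) : av Z = ∑ σ, act σ⁻¹ (π (act σ Z)) := by
    simp [av, LinearMap.sum_apply]
  have av_act (τ Z) : av (act τ Z) = act τ (av Z) := by
    rw [av_apply, av_apply, map_sum]
    refine Fintype.sum_equiv (Equiv.mulRight τ) _ _ fun σ => ?_
    simp only [Equiv.coe_mulRight, act_act, mul_inv_rev, mul_inv_cancel_left]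
  have av_one : av 1 = (Fintype.card (Equiv.Perm (Fin d)) : ℂ) • 1 := by
    rw [av_apply]
    have : ∀ σ, act σ⁻¹ (π (act σ 1)) = 1 := by
      intro σ
      rw [hπ (Submodule.subset_span ⟨σ, rfl⟩), act_act, inv_mul_cancel]
      rfl
    simp [this, Nat.cast_smul_eq_nsmul]
  have av_mem (Z) : av Z ∈ B := by
    rw [av_apply]
    exact Submodule.sum_mem _ fun σ _ => hB _ (hπB _)
  -- the component of the averaged projection from column `l` to column `k` is equivariant
  let S : (Fin d → Fin n) → (Fin d → Fin n) → Matrix (Fin d → Fin n) (Fin d → Fin n) ℂ := fun k l =>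
    Matrix.of fun i j => av (Matrix.single j l 1) i k
  have hS (k l) : S k l * N = N * S k l := by
    refine commute_of_symmetric N hN _ fun σ i j => ?_
    have : Matrix.single (j ∘ σ) l (1 : ℂ) = act σ⁻¹ (Matrix.single j l 1) := by
      ext a b
      rw [act_apply, Matrix.single_apply, Matrix.single_apply]
      refine if_congr (and_congr_left fun _ => ⟨?_, ?_⟩) rfl rfl
      · rintro rfl
        funext x; simp
      · rintro rfl
        funext x; simp
    simp only [S, Matrix.of_apply]
    rw [this, av_act, act_apply]
    exact congrArg (fun x => av (Matrix.single j l 1) x k) (funext fun x => by simp)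
  have hav (Z : Matrix (Fin d → Fin n) (Fin d → Fin n) ℂ) (i k) :
      av Z i k = ∑ l, ∑ j, S k l i j * Z j l := by
    conv_lhs => rw [Matrix.matrix_eq_sum_single Z]
    simp only [map_sum, Matrix.sum_apply]
    rw [Finset.sum_comm]
    refine Finset.sum_congr rfl fun l _ => Finset.sum_congr rfl fun j _ => ?_
    rw [show Matrix.single j l (Z j l) = Z j l • Matrix.single j l (1 : ℂ) by
      rw [Matrix.smul_single, smul_eq_mul, mul_one], map_smul, Matrix.smul_apply, smul_eq_mul,
      mul_comm]
    rfl
  have hcomm (Z : Matrix (Fin d → Fin n) (Fin d → Fin n) ℂ) : N * av Z = av (N * Z) := by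
    ext a k
    rw [hav, Matrix.mul_apply]
    simp_rw [hav, Matrix.mul_apply, Finset.mul_sum]
    rw [Finset.sum_comm]
    refine Finset.sum_congr rfl fun l _ => ?_
    have := congrArg (fun A : Matrix (Fin d → Fin n) (Fin d → Fin n) ℂ => (A * Z) a l) (hS k l)
    simp only [Matrix.mul_assoc] at this
    simp only [Matrix.mul_apply, Finset.mul_sum] at this
    exact this.symm
  have hmem : N ∈ B := by
    have h1 := hcomm 1
    rw [av_one, Matrix.mul_smul, Matrix.mul_one] at h1
    have h2 : (Fintype.card (Equiv.Perm (Fin d)) : ℂ) • N ∈ B := h1 ▸ av_mem _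
    exact (Submodule.smul_mem_iff _ (by exact_mod_cast Fintype.card_ne_zero)).1 h2
  obtain ⟨c, hc⟩ := (Submodule.mem_span_range_iff_exists_fun ℂ).1 hmem
  refine ⟨c, fun i j => ?_⟩
  rw [← hc, Matrix.sum_apply]
  refine Finset.sum_congr rfl fun σ _ => ?_
  rw [Matrix.smul_apply, act_apply, Matrix.one_apply, smul_eq_mul, mul_ite, mul_one, mul_zero]

/-! ### Averaging functions over a unitary group acting on a set -/

/-- The average of a function over the unitary group, with respect to an invariant functional `E`
on continuous functions; it is set to be zero at points whose orbit map is not continuous. -/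
noncomputable def average {Λ : Type} {n : ℕ} (E : C(Matrix.unitaryGroup (Fin n) ℂ, ℂ) →ₗ[ℂ] ℂ)
    (act : Matrix.unitaryGroup (Fin n) ℂ → Λ → Λ) (f : Λ → ℂ) : Λ → ℂ :=
  open Classical in
  fun p => if h : Continuous fun g => f (act g p) then E ⟨fun g => f (act g p), h⟩ else 0

section average

variable {Λ : Type} {n : ℕ} {P Q : Type} {E : C(Matrix.unitaryGroup (Fin n) ℂ, ℂ) →ₗ[ℂ] ℂ}
  {act : Matrix.unitaryGroup (Fin n) ℂ → Λ → Λ}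

theorem average_apply {f : Λ → ℂ} (p : Λ) (F : C(Matrix.unitaryGroup (Fin n) ℂ, ℂ))
    (h : ∀ g, f (act g p) = F g) : average E act f p = E F := by
  have hc : (fun g => f (act g p)) = F := funext h
  have hc' : Continuous fun g => f (act g p) := hc ▸ F.continuous
  rw [average, dif_pos hc']
  congr 1
  ext g
  exact h g

theorem average_of_invariant (hE : E 1 = 1) {f : Λ → ℂ} (hf : ∀ g p, f (act g p) = f p) :
    average E act f = f := by
  funext p
  rw [average_apply p (f p • 1) fun g => by simp [hf], map_smul, hE, smul_eq_mul, mul_one]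

theorem average_add {f f' : Λ → ℂ} (hf : ∀ p, Continuous fun g => f (act g p))
    (hf' : ∀ p, Continuous fun g => f' (act g p)) :
    average E act (f + f') = average E act f + average E act f' := by
  funext p
  rw [Pi.add_apply, average_apply p ⟨_, hf p⟩ fun _ => rfl,
    average_apply p ⟨_, hf' p⟩ fun _ => rfl, ← map_add]
  exact average_apply p _ fun _ => rfl

theorem average_mul {s f : Λ → ℂ} (hs : ∀ g p, s (act g p) = s p)
    (hf : ∀ p, Continuous fun g => f (act g p)) :
    average E act (s * f) = s * average E act f := by
  funext p
  rw [Pi.mul_apply, average_apply (f := f) p ⟨_, hf p⟩ fun _ => rfl,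
    average_apply (f := s * f) p (s p • ⟨_, hf p⟩) fun g => by simp [hs], map_smul, smul_eq_mul]

theorem continuous_tensPow (a : ℕ) (i j : Fin a → Fin n) :
    Continuous fun g : Matrix.unitaryGroup (Fin n) ℂ => tensPow a g.1 i j := by
  simp only [tensPow, Matrix.of_apply]
  exact continuous_finsetProd _ fun k _ =>
    (continuous_apply_apply (i k) (j k)).comp continuous_subtype_val

theorem continuous_tensPow_star (a : ℕ) (i j : Fin a → Fin n) :
    Continuous fun g : Matrix.unitaryGroup (Fin n) ℂ => tensPow a (star g.1) i j := by
  simp only [tensPow, Matrix.of_apply]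
  exact continuous_finsetProd _ fun k _ =>
    (continuous_star.comp (continuous_apply_apply (j k) (i k))).comp
      (continuous_subtype_val (p := fun A => A ∈ Matrix.unitaryGroup (Fin n) ℂ))

/-- The matrix coefficients of `g^{⊗ b} ⊗ (g⁻¹)^{⊗ a}` as continuous functions. -/
noncomputable def mixedCoeff {a b : ℕ} (i i' : Fin a → Fin n) (j j' : Fin b → Fin n) :
    C(Matrix.unitaryGroup (Fin n) ℂ, ℂ) :=
  ⟨fun g => tensPow b g.1 j' j * tensPow a (star g.1) i i',
    (continuous_tensPow b j' j).mul (continuous_tensPow_star a i i')⟩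

theorem mixedCoeff_commute {a b : ℕ}
    (hE : ∀ (h : Matrix.unitaryGroup (Fin n) ℂ) (f f' : C(Matrix.unitaryGroup (Fin n) ℂ, ℂ)),
      (∀ g, f' g = f (h * g)) → E f' = E f)
    (i : Fin a → Fin n) (j : Fin b → Fin n) (u : Matrix (Fin n) (Fin n) ℂ)
    (hu : u ∈ Matrix.unitaryGroup (Fin n) ℂ) :
    tensPow b u * (Matrix.of fun j' i' => E (mixedCoeff i i' j j')) =
      (Matrix.of fun j' i' => E (mixedCoeff i i' j j')) * tensPow a u := by
  have key : (Matrix.of fun j' i' => E (mixedCoeff i i' j j')) =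
      tensPow b u * (Matrix.of fun j' i' => E (mixedCoeff i i' j j')) * tensPow a (star u) := by
    ext j' i'
    have h := hE ⟨u, hu⟩ (mixedCoeff i i' j j') (∑ i'', ∑ j'',
      (tensPow b u j' j'' * tensPow a (star u) i'' i') • mixedCoeff i i'' j j'') (by
        intro g
        simp only [mixedCoeff, ContinuousMap.coe_sum, Finset.sum_apply, ContinuousMap.coe_smul,
          Pi.smul_apply, ContinuousMap.coe_mk, Submonoid.coe_mul, star_mul, tensPow_mul,
          Matrix.mul_apply, Finset.sum_mul_sum, smul_eq_mul]
        rw [Finset.sum_comm]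
        exact Finset.sum_congr rfl fun _ _ => Finset.sum_congr rfl fun _ _ => by ring)
    simp only [map_sum, map_smul, smul_eq_mul] at h
    simp only [Matrix.mul_apply, Matrix.of_apply, Finset.sum_mul, ← h]
    exact Finset.sum_congr rfl fun _ _ => Finset.sum_congr rfl fun _ _ => by ring
  conv_rhs => rw [key]
  rw [Matrix.mul_assoc _ (tensPow a (star u)), ← tensPow_mul, Matrix.mem_unitaryGroup_iff'.1 hu,
    tensPow_one, Matrix.mul_one]

/-- The average of a monomial in the entries of `X` and `Y`, where the group multiplies `X` from the
left and `Y` from the right by the inverse, is a polynomial in the entries of `Y X`. -/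
theorem average_monomial {X : Fin n → P → Λ → ℂ} {Y : Q → Fin n → Λ → ℂ} {a b : ℕ}
    (hE : ∀ (h : Matrix.unitaryGroup (Fin n) ℂ) (f f' : C(Matrix.unitaryGroup (Fin n) ℂ, ℂ)),
      (∀ g, f' g = f (h * g)) → E f' = E f)
    (hX : ∀ g p i α, X i α (act g p) = ∑ j, star g.1 i j * X j α p)
    (hY : ∀ g p β i, Y β i (act g p) = ∑ j, Y β j p * g.1 j i)
    {s : Λ → ℂ} (hs : ∀ g p, s (act g p) = s p) (S : Subalgebra ℂ (Λ → ℂ)) (hsS : s ∈ S)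
    (hYX : ∀ β α, ∑ i, Y β i * X i α ∈ S)
    (i : Fin a → Fin n) (α : Fin a → P) (β : Fin b → Q) (j : Fin b → Fin n) :
    (∀ p, Continuous fun g => (s * (∏ k, X (i k) (α k)) * ∏ l, Y (β l) (j l)) (act g p)) ∧
      average E act (s * (∏ k, X (i k) (α k)) * ∏ l, Y (β l) (j l)) ∈ S := by
  let F : Λ → C(Matrix.unitaryGroup (Fin n) ℂ, ℂ) := fun p => ∑ i' : Fin a → Fin n,
    ∑ j' : Fin b → Fin n, (s p * (∏ k, X (i' k) (α k) p) * ∏ l, Y (β l) (j' l) p) •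
      mixedCoeff i i' j j'
  have hF (p g) : (s * (∏ k, X (i k) (α k)) * ∏ l, Y (β l) (j l)) (act g p) = F p g := by
    simp only [Pi.mul_apply, Finset.prod_apply, hs, hX, hY, prod_sum_eq, Finset.prod_mul_distrib]
    simp only [F, mixedCoeff, ContinuousMap.coe_sum, Finset.sum_apply, ContinuousMap.coe_smul,
      Pi.smul_apply, ContinuousMap.coe_mk, smul_eq_mul, Finset.mul_sum, Finset.sum_mul]
    rw [Finset.sum_comm]
    refine Finset.sum_congr rfl fun _ _ => Finset.sum_congr rfl fun _ _ => ?_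
    simp only [tensPow, Matrix.of_apply]
    ring
  refine ⟨fun p => (funext (hF p) : (fun g => _) = _) ▸ (F p).continuous, ?_⟩
  have hav : average E act (s * (∏ k, X (i k) (α k)) * ∏ l, Y (β l) (j l)) =
      s * ∑ i' : Fin a → Fin n, ∑ j' : Fin b → Fin n, E (mixedCoeff i i' j j') •
        ((∏ k, X (i' k) (α k)) * ∏ l, Y (β l) (j' l)) := by
    funext p
    rw [average_apply p (F p) (hF p)]
    simp only [F, map_sum, map_smul, Pi.mul_apply, Finset.sum_apply, Pi.smul_apply,
      Finset.prod_apply, smul_eq_mul, Finset.mul_sum]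
    exact Finset.sum_congr rfl fun _ _ => Finset.sum_congr rfl fun _ _ => by ring
  rw [hav]
  refine mul_mem hsS ?_
  by_cases hab : a = b
  · subst hab
    obtain ⟨c, hc⟩ := exists_perm_coeff _ (mixedCoeff_commute hE i j)
    simp only [Matrix.of_apply] at hc
    have : ∑ i' : Fin a → Fin n, ∑ j' : Fin a → Fin n, E (mixedCoeff i i' j j') •
        ((∏ k, X (i' k) (α k)) * ∏ l, Y (β l) (j' l)) =
        ∑ σ : Equiv.Perm (Fin a), c σ • ∏ l, ∑ x, Y (β l) x * X x (α (σ⁻¹ l)) := by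
      simp only [hc, Finset.sum_smul, ite_smul, zero_smul]
      refine Finset.sum_comm.trans ((Finset.sum_congr rfl fun _ _ => Finset.sum_comm).trans
        (Finset.sum_comm.trans (Finset.sum_congr rfl fun σ _ => ?_)))
      simp only [Finset.sum_ite_eq, Finset.mem_univ, if_true]
      rw [← Finset.smul_sum, prod_sum_eq]
      congr 1
      refine Finset.sum_congr rfl fun j' _ => ?_
      rw [Finset.prod_mul_distrib, mul_comm]
      congr 1
      exact Fintype.prod_equiv σ _ _ fun k => by simp
    rw [this]
    exact sum_mem fun σ _ => Subalgebra.smul_mem _ (prod_mem fun l _ => hYX _ _) _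
  · have h0 := intertwiner_eq_zero hab _ (mixedCoeff_commute hE i j)
    have h0' : ∀ i' j', E (mixedCoeff i i' j j') = 0 := fun i' j' => congrFun (congrFun h0 j') i'
    simp only [h0', zero_smul, Finset.sum_const_zero]
    exact zero_mem _

/-- Elimination of a pair `X`, `Y` of matrix-valued functions: averaging sends polynomials in `X`,
`Y` and invariant functions to polynomials in `Y X` and invariant functions. -/
theorem average_mem {X : Fin n → P → Λ → ℂ} {Y : Q → Fin n → Λ → ℂ}
    (hE : ∀ (h : Matrix.unitaryGroup (Fin n) ℂ) (f f' : C(Matrix.unitaryGroup (Fin n) ℂ, ℂ)),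
      (∀ g, f' g = f (h * g)) → E f' = E f)
    (hX : ∀ g p i α, X i α (act g p) = ∑ j, star g.1 i j * X j α p)
    (hY : ∀ g p β i, Y β i (act g p) = ∑ j, Y β j p * g.1 j i)
    (S : Subalgebra ℂ (Λ → ℂ)) (hS : ∀ s ∈ S, ∀ g p, s (act g p) = s p)
    (hYX : ∀ β α, ∑ i, Y β i * X i α ∈ S) (f : Λ → ℂ)
    (hf : f ∈ Algebra.adjoin ℂ ((S : Set (Λ → ℂ)) ∪ Set.range (Function.uncurry X) ∪
      Set.range (Function.uncurry Y))) :
    (∀ p, Continuous fun g => f (act g p)) ∧ average E act f ∈ S := by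
  have hterm : ∀ f ∈ Submonoid.closure ((S : Set (Λ → ℂ)) ∪ Set.range (Function.uncurry X) ∪
      Set.range (Function.uncurry Y)), ∃ s ∈ S, ∃ (L : List (Fin n × P)) (L' : List (Q × Fin n)),
      f = s * (L.map (Function.uncurry X)).prod * (L'.map (Function.uncurry Y)).prod := by
    intro f hf
    induction hf using Submonoid.closure_induction with
    | mem f hf =>
      rcases hf with (hf | ⟨x, rfl⟩) | ⟨y, rfl⟩
      · exact ⟨f, hf, [], [], by simp⟩
      · exact ⟨1, one_mem _, [x], [], by simp⟩
      · exact ⟨1, one_mem _, [], [y], by simp⟩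
    | one => exact ⟨1, one_mem _, [], [], by simp⟩
    | mul f f' _ _ h h' =>
      obtain ⟨s, hs, L, L', rfl⟩ := h
      obtain ⟨s', hs', M, M', rfl⟩ := h'
      refine ⟨s * s', mul_mem hs hs', L ++ M, L' ++ M', ?_⟩
      simp only [List.map_append, List.prod_append]
      ring
  rw [← Subalgebra.mem_toSubmodule, Algebra.adjoin_eq_span] at hf
  induction hf using Submodule.span_induction with
  | mem f hf =>
    obtain ⟨s, hs, L, L', rfl⟩ := hterm f hf
    have h := average_monomial hE hX hY (hS s hs) S hs hYX (fun k => (L.get k).1)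
      (fun k => (L.get k).2) (fun k => (L'.get k).1) (fun k => (L'.get k).2)
    have e₁ : (L.map (Function.uncurry X)).prod = ∏ k, X (L.get k).1 (L.get k).2 := by
      rw [← List.prod_ofFn]
      congr 1
      conv_lhs => rw [← List.ofFn_get L, List.map_ofFn]
      rfl
    have e₂ : (L'.map (Function.uncurry Y)).prod = ∏ k, Y (L'.get k).1 (L'.get k).2 := by
      rw [← List.prod_ofFn]
      congr 1
      conv_lhs => rw [← List.ofFn_get L', List.map_ofFn]
      rfl
    rw [e₁, e₂]
    exact h
  | zero =>
    refine ⟨fun p => continuous_const, ?_⟩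
    have : average E act 0 = 0 := funext fun p => by
      rw [average_apply p 0 fun _ => rfl, map_zero]; rfl
    rw [this]
    exact zero_mem _
  | add f f' _ _ h h' =>
    refine ⟨fun p => (h.1 p).add (h'.1 p), ?_⟩
    rw [average_add h.1 h'.1]
    exact add_mem h.2 h'.2
  | smul c f _ h =>
    have e : c • f = (fun _ => c) * f := rfl
    refine ⟨fun p => (h.1 p).const_smul c, ?_⟩
    rw [e, average_mul (act := act) (s := fun _ => c) (f := f) (fun _ _ => rfl) h.1]
    change c • average E act f ∈ S
    exact Subalgebra.smul_mem _ h.2 c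

end average

/-! ### Polynomial functions -/

section polyFun

variable {E : Type} [AddCommGroup E] [Module ℂ E]

theorem dual_mem_polyFun (φ : Module.Dual ℂ E) : (fun x => φ x) ∈ polyFun E :=
  Algebra.subset_adjoin ⟨φ, rfl⟩

/-- Composition of functions with a fixed map, as a homomorphism of algebras. -/
def precomp {X Y : Type} (F : X → Y) : (Y → ℂ) →ₐ[ℂ] (X → ℂ) :=
  AlgHom.pi fun x => Pi.evalAlgHom ℂ (fun _ : Y => ℂ) (F x)

/-- A map along which finitely many separating linear coordinates pull back into a subalgebra pulls
back all polynomial functions into it. -/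
theorem precomp_mem_of_coords {X ι : Type} [Finite ι] (F : X → E) (c : ι → Module.Dual ℂ E)
    (hc : ∀ x, (∀ i, c i x = 0) → x = 0) (S : Subalgebra ℂ (X → ℂ))
    (hS : ∀ i, (fun x => c i (F x)) ∈ S) {f : E → ℂ} (hf : f ∈ polyFun E) :
    precomp F f ∈ S := by
  have : polyFun E ≤ S.comap (precomp F) := by
    refine Algebra.adjoin_le ?_
    rintro _ ⟨φ, rfl⟩
    have hφ : φ ∈ Submodule.span ℂ (Set.range c) := by
      refine mem_span_of_iInf_ker_le_ker fun x hx => ?_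
      simp only [Submodule.mem_iInf, LinearMap.mem_ker] at hx
      rw [hc x hx]
      exact zero_mem _
    let T : Submodule ℂ (Module.Dual ℂ E) :=
      { carrier := {φ | (fun x => φ (F x)) ∈ S}
        add_mem' := fun {a b} (h : (fun x => a (F x)) ∈ S) (h' : (fun x => b (F x)) ∈ S) =>
          S.add_mem h h'
        zero_mem' := zero_mem S
        smul_mem' := fun a _ h => Subalgebra.smul_mem S h a }
    have hT : Submodule.span ℂ (Set.range c) ≤ T := Submodule.span_le.2 (by
      rintro _ ⟨i, rfl⟩
      exact hS i)
    exact hT hφ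
  exact this hf

end polyFun

/-! ### Coordinates on the quiver variety -/

section coordinates

variable (r : ℕ → ℕ) (m : ℕ)

/-- The dimension of `U_i`. -/
abbrev dimU (r : ℕ → ℕ) (i : ℕ) : ℕ := ∑ j ∈ Finset.range i, r j

/-- The component `u_i` of a tuple, for any natural number `i`; it is zero out of range. -/
def uMap (i : ℕ) : RepSpace r m →ₗ[ℂ] U r i :=
  if h : i < m + 2 then
    (LinearMap.proj (φ := fun j : Fin (m + 2) => U r j) ⟨i, h⟩) ∘ₗ LinearMap.fst ℂ _ _
  else 0

/-- The component `A_i` of a tuple, for any natural number `i`; it is zero out of range. -/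
def aMap (i : ℕ) : RepSpace r m →ₗ[ℂ] (U r i →ₗ[ℂ] U r (i + 1)) :=
  if h : i < m + 1 then
    (LinearMap.proj (φ := fun j : Fin (m + 1) => U r j →ₗ[ℂ] U r (j + 1)) ⟨i, h⟩) ∘ₗ
      LinearMap.fst ℂ _ _ ∘ₗ LinearMap.snd ℂ _ _
  else 0

/-- The component `B_i` of a tuple, for any natural number `i`; it is zero out of range. -/
def bMap (i : ℕ) : RepSpace r m →ₗ[ℂ] (U r (i + 1) →ₗ[ℂ] U r i) :=
  if h : i < m + 1 then
    (LinearMap.proj (φ := fun j : Fin (m + 1) => U r (j + 1) →ₗ[ℂ] U r j) ⟨i, h⟩) ∘ₗ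
      LinearMap.snd ℂ _ _ ∘ₗ LinearMap.snd ℂ _ _
  else 0

variable {r m}

theorem uMap_of_lt {i : ℕ} (h : i < m + 2) (p : RepSpace r m) : uMap r m i p = p.1 ⟨i, h⟩ := by
  rw [uMap, dif_pos h]; rfl

theorem aMap_of_lt {i : ℕ} (h : i < m + 1) (p : RepSpace r m) : aMap r m i p = p.2.1 ⟨i, h⟩ := by
  rw [aMap, dif_pos h]; rfl

theorem bMap_of_lt {i : ℕ} (h : i < m + 1) (p : RepSpace r m) : bMap r m i p = p.2.2 ⟨i, h⟩ := by
  rw [bMap, dif_pos h]; rfl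

theorem aMap_of_not_lt {i : ℕ} (h : ¬ i < m + 1) (p : RepSpace r m) : aMap r m i p = 0 := by
  rw [aMap, dif_neg h]; rfl

theorem bMap_of_not_lt {i : ℕ} (h : ¬ i < m + 1) (p : RepSpace r m) : bMap r m i p = 0 := by
  rw [bMap, dif_neg h]; rfl

theorem uMap_of_not_lt {i : ℕ} (h : ¬ i < m + 2) (p : RepSpace r m) : uMap r m i p = 0 := by
  rw [uMap, dif_neg h]; rfl

theorem quiverMap_eq (p : RepSpace r m) :
    quiverMap r m p = (uMap r m (m + 1) p, aMap r m m p ∘ₗ bMap r m m p) := by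
  rw [uMap_of_lt (by omega), aMap_of_lt (by omega), bMap_of_lt (by omega)]
  rfl

theorem mem_quiverVariety_iff {I : Finset (Fin (m + 1))} {p : RepSpace r m} :
    p ∈ quiverVariety r m I ↔
      (∀ i < m, bMap r m (i + 1) p ∘ₗ aMap r m (i + 1) p = aMap r m i p ∘ₗ bMap r m i p) ∧
      (∀ i (h : i < m + 1), ⟨i, h⟩ ∈ I → bMap r m i p (uMap r m (i + 1) p) = uMap r m i p) ∧
      (∀ i (h : i < m + 1), ⟨i, h⟩ ∉ I → aMap r m i p (uMap r m i p) = uMap r m (i + 1) p) := by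
  constructor
  · rintro ⟨h₁, h₂, h₃⟩
    refine ⟨fun i hi => ?_, fun i hi hI => ?_, fun i hi hI => ?_⟩
    · rw [aMap_of_lt (by omega), bMap_of_lt (by omega), aMap_of_lt (by omega),
        bMap_of_lt (by omega)]
      exact h₁ ⟨i, hi⟩
    · rw [bMap_of_lt hi, uMap_of_lt (by omega), uMap_of_lt (by omega)]
      exact h₂ ⟨i, hi⟩ hI
    · rw [aMap_of_lt hi, uMap_of_lt (by omega), uMap_of_lt (by omega)]
      exact h₃ ⟨i, hi⟩ hI
  · rintro ⟨h₁, h₂, h₃⟩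
    refine ⟨fun i => ?_, fun i hI => ?_, fun i hI => ?_⟩
    · have h := h₁ i i.2
      rw [aMap_of_lt (by omega), bMap_of_lt (by omega), aMap_of_lt (by omega),
        bMap_of_lt (by omega)] at h
      exact h
    · have h := h₂ i i.2 hI
      rw [bMap_of_lt i.2, uMap_of_lt (by omega), uMap_of_lt (by omega)] at h
      exact h
    · have h := h₃ i i.2 hI
      rw [aMap_of_lt i.2, uMap_of_lt (by omega), uMap_of_lt (by omega)] at h
      exact h

/-- The component of an element of `H` at any natural number; it is `1` out of range. -/
def hComp (g : ∀ i : Fin (m + 1), LinearMap.GeneralLinearGroup ℂ (U r i)) (i : ℕ) :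
    LinearMap.GeneralLinearGroup ℂ (U r i) :=
  if h : i < m + 1 then g ⟨i, h⟩ else 1

variable (g : ∀ i : Fin (m + 1), LinearMap.GeneralLinearGroup ℂ (U r i)) (p : RepSpace r m)

theorem uMap_repH (i : ℕ) : uMap r m i (repH r m g p) = (hComp g i).1 (uMap r m i p) := by
  by_cases h : i < m + 2
  · rw [uMap_of_lt h, uMap_of_lt h]
    rfl
  · rw [uMap_of_not_lt h, uMap_of_not_lt h, map_zero]

theorem aMap_repH (i : ℕ) : aMap r m i (repH r m g p) =
    (hComp g (i + 1)).1 ∘ₗ aMap r m i p ∘ₗ ((hComp g i)⁻¹).1 := by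
  by_cases h : i < m + 1
  · rw [aMap_of_lt h, aMap_of_lt h]
    rfl
  · rw [aMap_of_not_lt h, aMap_of_not_lt h, LinearMap.zero_comp, LinearMap.comp_zero]

theorem bMap_repH (i : ℕ) : bMap r m i (repH r m g p) =
    (hComp g i).1 ∘ₗ bMap r m i p ∘ₗ ((hComp g (i + 1))⁻¹).1 := by
  by_cases h : i < m + 1
  · rw [bMap_of_lt h, bMap_of_lt h]
    rfl
  · rw [bMap_of_not_lt h, bMap_of_not_lt h, LinearMap.zero_comp, LinearMap.comp_zero]

theorem hComp_last : hComp g (m + 1) = 1 := dif_neg (by omega)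

theorem quiverMap_repH : quiverMap r m (repH r m g p) = quiverMap r m p := by
  rw [quiverMap_eq, quiverMap_eq, uMap_repH, aMap_repH, bMap_repH, hComp_last]
  refine Prod.ext rfl (LinearMap.ext fun w => ?_)
  have : ∀ v, ((hComp g m)⁻¹).1 ((hComp g m).1 v) = v := fun v => by
    rw [← Module.End.mul_apply, ← Units.val_mul, inv_mul_cancel]; rfl
  simp only [LinearMap.comp_apply, this]
  simp

/-- The entries of a linear map between coordinate spaces, as linear functionals. -/
def entryDual (a b : ℕ) (k : Fin a) (l : Fin b) :
    Module.Dual ℂ ((Fin b → ℂ) →ₗ[ℂ] (Fin a → ℂ)) :=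
  LinearMap.proj k ∘ₗ LinearMap.applyₗ (Pi.single l 1)

theorem entryDual_apply {a b : ℕ} (k : Fin a) (l : Fin b) (f : (Fin b → ℂ) →ₗ[ℂ] (Fin a → ℂ)) :
    entryDual a b k l f = LinearMap.toMatrix' f k l := by
  rw [LinearMap.toMatrix'_apply]
  rfl

theorem eq_zero_of_entryDual {a b : ℕ} {f : (Fin b → ℂ) →ₗ[ℂ] (Fin a → ℂ)}
    (h : ∀ k l, entryDual a b k l f = 0) : f = 0 := by
  refine LinearMap.toMatrix'.injective ?_
  rw [map_zero]
  ext k l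
  rw [← entryDual_apply, h]
  rfl

theorem entryDual_comp {a b c : ℕ} (f : (Fin b → ℂ) →ₗ[ℂ] (Fin a → ℂ))
    (g : (Fin c → ℂ) →ₗ[ℂ] (Fin b → ℂ)) (k : Fin a) (l : Fin c) :
    entryDual a c k l (f ∘ₗ g) = ∑ j, entryDual a b k j f * entryDual b c j l g := by
  simp only [entryDual_apply, LinearMap.toMatrix'_comp, Matrix.mul_apply]

theorem apply_eq_sum_entryDual {a b : ℕ} (f : (Fin b → ℂ) →ₗ[ℂ] (Fin a → ℂ)) (v : Fin b → ℂ)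
    (k : Fin a) : f v k = ∑ j, entryDual a b k j f * v j := by
  conv_lhs => rw [← LinearMap.toMatrix'_mulVec]
  simp only [entryDual_apply, Matrix.mulVec, dotProduct]

/-- The linear coordinates on the space of tuples. -/
def repCoord (r : ℕ → ℕ) (m : ℕ) :
    ((Σ i : Fin (m + 2), Fin (dimU r i)) ⊕
      (Σ i : Fin (m + 1), Fin (dimU r (i + 1)) × Fin (dimU r i)) ⊕
      (Σ i : Fin (m + 1), Fin (dimU r i) × Fin (dimU r (i + 1)))) → Module.Dual ℂ (RepSpace r m)
  | .inl ⟨i, k⟩ => LinearMap.proj k ∘ₗ uMap r m i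
  | .inr (.inl ⟨i, k, l⟩) => entryDual _ _ k l ∘ₗ aMap r m i
  | .inr (.inr ⟨i, k, l⟩) => entryDual _ _ k l ∘ₗ bMap r m i

theorem eq_zero_of_repCoord {p : RepSpace r m} (h : ∀ x, repCoord r m x p = 0) : p = 0 := by
  refine Prod.ext (funext fun i => funext fun k => ?_) (Prod.ext (funext fun i => ?_)
    (funext fun i => ?_))
  · exact (congrFun (uMap_of_lt i.2 p) k).symm.trans (h (.inl ⟨i, k⟩))
  · exact (aMap_of_lt i.2 p).symm.trans
      (eq_zero_of_entryDual fun k l => h (.inr (.inl ⟨i, k, l⟩)))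
  · exact (bMap_of_lt i.2 p).symm.trans
      (eq_zero_of_entryDual fun k l => h (.inr (.inr ⟨i, k, l⟩)))

/-- The linear coordinates on `ℂⁿ × End(ℂⁿ)`. -/
def coneCoord (n : ℕ) : Fin n ⊕ (Fin n × Fin n) →
    Module.Dual ℂ ((Fin n → ℂ) × ((Fin n → ℂ) →ₗ[ℂ] (Fin n → ℂ)))
  | .inl k => LinearMap.proj k ∘ₗ LinearMap.fst ℂ _ _
  | .inr (k, l) => entryDual _ _ k l ∘ₗ LinearMap.snd ℂ _ _

theorem eq_zero_of_coneCoord {n : ℕ} {q : (Fin n → ℂ) × ((Fin n → ℂ) →ₗ[ℂ] (Fin n → ℂ))}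
    (h : ∀ x, coneCoord n x q = 0) : q = 0 :=
  Prod.ext (funext fun k => h (.inl k)) (eq_zero_of_entryDual fun k l => h (.inr (k, l)))

theorem uCoord_mem_polyFun (i : ℕ) (k) : (fun p => uMap r m i p k) ∈ polyFun (RepSpace r m) :=
  dual_mem_polyFun (LinearMap.proj k ∘ₗ uMap r m i)

theorem aCoord_mem_polyFun (i : ℕ) (k l) :
    (fun p => entryDual _ _ k l (aMap r m i p)) ∈ polyFun (RepSpace r m) :=
  dual_mem_polyFun (entryDual _ _ k l ∘ₗ aMap r m i)

theorem bCoord_mem_polyFun (i : ℕ) (k l) :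
    (fun p => entryDual _ _ k l (bMap r m i p)) ∈ polyFun (RepSpace r m) :=
  dual_mem_polyFun (entryDual _ _ k l ∘ₗ bMap r m i)

theorem sum_mul_mem {X ι : Type} [Fintype ι] {S : Subalgebra ℂ (X → ℂ)} {f g : ι → X → ℂ}
    (hf : ∀ i, f i ∈ S) (hg : ∀ i, g i ∈ S) : (fun x => ∑ i, f i x * g i x) ∈ S := by
  have : (fun x => ∑ i, f i x * g i x) = ∑ i, f i * g i := by
    funext x; simp
  rw [this]
  exact sum_mem fun i _ => mul_mem (hf i) (hg i)

theorem precomp_quiverMap_mem {f}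
    (hf : f ∈ polyFun (U r (m + 1) × (U r (m + 1) →ₗ[ℂ] U r (m + 1)))) :
    precomp (quiverMap r m) f ∈ polyFun (RepSpace r m) := by
  refine precomp_mem_of_coords _ (coneCoord _) (fun _ => eq_zero_of_coneCoord) _ ?_ hf
  rintro (k | ⟨k, l⟩)
  · simp only [quiverMap_eq]
    exact uCoord_mem_polyFun _ k
  · simp only [quiverMap_eq, coneCoord, LinearMap.comp_apply, LinearMap.snd_apply, entryDual_comp]
    exact sum_mul_mem (fun _ => aCoord_mem_polyFun _ _ _) fun _ => bCoord_mem_polyFun _ _ _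

/-- The quiver variety is Zariski closed. -/
theorem mem_quiverVariety_of_closure {I : Finset (Fin (m + 1))}
    (h : p ∈ zariskiClosure (quiverVariety r m I)) : p ∈ quiverVariety r m I := by
  have key : ∀ f g, f ∈ polyFun (RepSpace r m) → g ∈ polyFun (RepSpace r m) →
      (∀ s ∈ quiverVariety r m I, f s = g s) → f p = g p := by
    intro f g hf hg hfg
    have := h (f - g) (sub_mem hf hg) fun s hs => by simp [hfg s hs]
    simpa [sub_eq_zero] using this
  refine mem_quiverVariety_iff.2 ⟨fun i hi => ?_, fun i hi hI => ?_, fun i hi hI => ?_⟩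
  · rw [← sub_eq_zero]
    refine eq_zero_of_entryDual fun k l => ?_
    rw [map_sub, sub_eq_zero, entryDual_comp, entryDual_comp]
    refine key _ _ (sum_mul_mem (fun _ => bCoord_mem_polyFun _ _ _)
      fun _ => aCoord_mem_polyFun _ _ _) (sum_mul_mem (fun _ => aCoord_mem_polyFun _ _ _)
      fun _ => bCoord_mem_polyFun _ _ _) fun s hs => ?_
    rw [← entryDual_comp, ← entryDual_comp, (mem_quiverVariety_iff.1 hs).1 i hi]
  · funext k
    rw [apply_eq_sum_entryDual]
    refine key _ _ (sum_mul_mem (fun _ => bCoord_mem_polyFun _ _ _)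
      fun _ => uCoord_mem_polyFun _ _) (uCoord_mem_polyFun _ _) fun s hs => ?_
    rw [← apply_eq_sum_entryDual, (mem_quiverVariety_iff.1 hs).2.1 i hi hI]
  · funext k
    rw [apply_eq_sum_entryDual]
    refine key _ _ (sum_mul_mem (fun _ => aCoord_mem_polyFun _ _ _)
      fun _ => uCoord_mem_polyFun _ _) (uCoord_mem_polyFun _ _) fun s hs => ?_
    rw [← apply_eq_sum_entryDual, (mem_quiverVariety_iff.1 hs).2.2 i hi hI]

end coordinates

/-! ### Elimination of the vertices of the quiver -/

section elimination

variable (r : ℕ → ℕ) (m : ℕ) (I : Finset (Fin (m + 1)))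

/-- The algebra of functions on the quiver variety generated by the coordinates of `u_j`, `A_j` and
`B_j` with `j ≥ i`, and of `A_j B_j` with `j + 1 ≥ i`. -/
def tailAlg (i : ℕ) : Subalgebra ℂ (quiverVariety r m I → ℂ) :=
  Algebra.adjoin ℂ
    ({f | ∃ j, i ≤ j ∧ ∃ k, f = fun p => uMap r m j p.1 k} ∪
      {f | ∃ j, i ≤ j ∧ ∃ k l, f = fun p => entryDual _ _ k l (aMap r m j p.1)} ∪
      {f | ∃ j, i ≤ j ∧ ∃ k l, f = fun p => entryDual _ _ k l (bMap r m j p.1)} ∪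
      {f | ∃ j, i ≤ j + 1 ∧ ∃ k l,
        f = fun p => entryDual _ _ k l (aMap r m j p.1 ∘ₗ bMap r m j p.1)})

variable {r m I}

theorem uCoord_mem_tailAlg {i j : ℕ} (h : i ≤ j) (k) :
    (fun p => uMap r m j p.1 k) ∈ tailAlg r m I i :=
  Algebra.subset_adjoin (Or.inl (Or.inl (Or.inl ⟨j, h, k, rfl⟩)))

theorem aCoord_mem_tailAlg {i j : ℕ} (h : i ≤ j) (k l) :
    (fun p => entryDual _ _ k l (aMap r m j p.1)) ∈ tailAlg r m I i :=
  Algebra.subset_adjoin (Or.inl (Or.inl (Or.inr ⟨j, h, k, l, rfl⟩)))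

theorem bCoord_mem_tailAlg {i j : ℕ} (h : i ≤ j) (k l) :
    (fun p => entryDual _ _ k l (bMap r m j p.1)) ∈ tailAlg r m I i :=
  Algebra.subset_adjoin (Or.inl (Or.inr ⟨j, h, k, l, rfl⟩))

theorem abCoord_mem_tailAlg {i j : ℕ} (h : i ≤ j + 1) (k l) :
    (fun p => entryDual _ _ k l (aMap r m j p.1 ∘ₗ bMap r m j p.1)) ∈ tailAlg r m I i :=
  Algebra.subset_adjoin (Or.inr ⟨j, h, k, l, rfl⟩)

theorem tailAlg_le {i : ℕ} {S : Subalgebra ℂ (quiverVariety r m I → ℂ)}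
    (hu : ∀ j, i ≤ j → ∀ k, (fun p => uMap r m j p.1 k) ∈ S)
    (ha : ∀ j, i ≤ j → ∀ k l, (fun p => entryDual _ _ k l (aMap r m j p.1)) ∈ S)
    (hb : ∀ j, i ≤ j → ∀ k l, (fun p => entryDual _ _ k l (bMap r m j p.1)) ∈ S)
    (hab : ∀ j, i ≤ j + 1 → ∀ k l,
      (fun p => entryDual _ _ k l (aMap r m j p.1 ∘ₗ bMap r m j p.1)) ∈ S) :
    tailAlg r m I i ≤ S := by
  refine Algebra.adjoin_le ?_
  rintro _ (((⟨j, h, k, rfl⟩ | ⟨j, h, k, l, rfl⟩) | ⟨j, h, k, l, rfl⟩) | ⟨j, h, k, l, rfl⟩)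
  · exact hu j h k
  · exact ha j h k l
  · exact hb j h k l
  · exact hab j h k l

theorem tailAlg_anti {i i' : ℕ} (h : i ≤ i') : tailAlg r m I i' ≤ tailAlg r m I i :=
  tailAlg_le (fun _ hj _ => uCoord_mem_tailAlg (h.trans hj) _)
    (fun _ hj _ _ => aCoord_mem_tailAlg (h.trans hj) _ _)
    (fun _ hj _ _ => bCoord_mem_tailAlg (h.trans hj) _ _)
    (fun _ hj _ _ => abCoord_mem_tailAlg (h.trans hj) _ _)

/-- The invertible linear map defined by the inverse of a unitary matrix. -/
def unitaryGL {n : ℕ} (g : Matrix.unitaryGroup (Fin n) ℂ) :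
    LinearMap.GeneralLinearGroup ℂ (Fin n → ℂ) where
  val := Matrix.toLin' (star g.1)
  inv := Matrix.toLin' g.1
  val_inv := by
    rw [Module.End.mul_eq_comp, ← Matrix.toLin'_mul, Matrix.mem_unitaryGroup_iff'.1 g.2,
      Matrix.toLin'_one]
    rfl
  inv_val := by
    rw [Module.End.mul_eq_comp, ← Matrix.toLin'_mul, Matrix.mem_unitaryGroup_iff.1 g.2,
      Matrix.toLin'_one]
    rfl

theorem repH_mem (g : ∀ i : Fin (m + 1), LinearMap.GeneralLinearGroup ℂ (U r i))
    (p : quiverVariety r m I) : repH r m g p.1 ∈ quiverVariety r m I :=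
  gaugeRep_mem r m I _ p.1 p.2

/-- The action of the inverses of unitary matrices in `GL(U_i)` on the quiver variety. -/
def vertexAct (i : Fin (m + 1)) (g : Matrix.unitaryGroup (Fin (dimU r i)) ℂ)
    (p : quiverVariety r m I) : quiverVariety r m I :=
  ⟨repH r m (Pi.mulSingle i (unitaryGL g)) p.1, repH_mem _ p⟩

theorem hComp_mulSingle_self (i : Fin (m + 1)) (x : LinearMap.GeneralLinearGroup ℂ (U r i)) :
    hComp (Pi.mulSingle i x) (i : ℕ) = x := by
  rw [hComp, dif_pos i.2]
  exact Pi.mulSingle_eq_same (M := fun j : Fin (m + 1) =>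
    LinearMap.GeneralLinearGroup ℂ (U r j)) i x

theorem hComp_mulSingle_ne (i : Fin (m + 1)) (x : LinearMap.GeneralLinearGroup ℂ (U r i)) {j : ℕ}
    (h : j ≠ i) : hComp (Pi.mulSingle i x) j = 1 := by
  rw [hComp]
  split_ifs with hj
  · exact Pi.mulSingle_eq_of_ne (M := fun j : Fin (m + 1) =>
      LinearMap.GeneralLinearGroup ℂ (U r j)) (fun e => h (congrArg Fin.val e)) x
  · rfl

theorem entryDual_toLin' {a b : ℕ} (M : Matrix (Fin a) (Fin b) ℂ) (k l) :
    entryDual a b k l (Matrix.toLin' M) = M k l := by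
  rw [entryDual_apply, LinearMap.toMatrix'_toLin']

theorem vertexAct_invariant (i : Fin (m + 1)) {s} (hs : s ∈ tailAlg r m I (i + 1)) (g)
    (p : quiverVariety r m I) : s (vertexAct i g p) = s p := by
  have h1 {j : ℕ} (hj : (i : ℕ) + 1 ≤ j) :
      hComp (Pi.mulSingle i (unitaryGL g)) j = (1 : LinearMap.GeneralLinearGroup ℂ (U r j)) :=
    hComp_mulSingle_ne i _ (by omega)
  have hone {n : ℕ} (v : Fin n → ℂ) : (1 : LinearMap.GeneralLinearGroup ℂ (Fin n → ℂ)).1 v = v :=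
    rfl
  let T : Subalgebra ℂ (quiverVariety r m I → ℂ) :=
    { carrier := {s | s (vertexAct i g p) = s p}
      mul_mem' := fun {a b} (h : a _ = a p) (h' : b _ = b p) => congrArg₂ (· * ·) h h'
      add_mem' := fun {a b} (h : a _ = a p) (h' : b _ = b p) => congrArg₂ (· + ·) h h'
      algebraMap_mem' := fun _ => rfl }
  refine (tailAlg_le (S := T) (fun j hj k => ?_) (fun j hj k l => ?_) (fun j hj k l => ?_)
    (fun j hj k l => ?_)) hs
  · change uMap r m j (repH r m _ p.1) k = _
    rw [uMap_repH, h1 hj]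
    rfl
  · change entryDual _ _ k l (aMap r m j (repH r m _ p.1)) = _
    rw [aMap_repH, h1 hj, h1 (by omega)]
    rfl
  · change entryDual _ _ k l (bMap r m j (repH r m _ p.1)) = _
    rw [bMap_repH, h1 hj, h1 (by omega)]
    rfl
  · change entryDual _ _ k l (aMap r m j (repH r m _ p.1) ∘ₗ bMap r m j (repH r m _ p.1)) = _
    rw [aMap_repH, bMap_repH, h1 hj]
    congr 1
    refine LinearMap.ext fun w => ?_
    have : ∀ x : LinearMap.GeneralLinearGroup ℂ (U r j), ∀ v, (x⁻¹).1 (x.1 v) = v := fun x v => by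
      rw [← Module.End.mul_apply, ← Units.val_mul, inv_mul_cancel]; rfl
    simp only [LinearMap.comp_apply, this]
    simp

/-- Averaging over the unitary subgroup of `GL(U_i)` eliminates the coordinates at the vertex `i`:
by the relations, `A_i B_i` and `A_i u_i` are expressed by what is left. -/
theorem average_mem_tailAlg (i : Fin (m + 1))
    {E : C(Matrix.unitaryGroup (Fin (dimU r i)) ℂ, ℂ) →ₗ[ℂ] ℂ}
    (hE : ∀ (h : Matrix.unitaryGroup (Fin (dimU r i)) ℂ)
      (f f' : C(Matrix.unitaryGroup (Fin (dimU r i)) ℂ, ℂ)),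
      (∀ g, f' g = f (h * g)) → E f' = E f) {f} (hf : f ∈ tailAlg r m I i) :
    (∀ p, Continuous fun g => f (vertexAct i g p)) ∧
      average E (vertexAct i) f ∈ tailAlg r m I (i + 1) := by
  let X : Fin (dimU r i) → Option (Fin (dimU r (i + 1))) → quiverVariety r m I → ℂ := fun k α =>
    α.elim (fun p => uMap r m i p.1 k) fun l => fun p => entryDual _ _ k l (bMap r m i p.1)
  let Y : Fin (dimU r (i + 1)) → Fin (dimU r i) → quiverVariety r m I → ℂ := fun k l p =>
    entryDual _ _ k l (aMap r m i p.1)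
  have hself (g) : hComp (Pi.mulSingle i (unitaryGL g)) (i : ℕ) =
    (unitaryGL g : LinearMap.GeneralLinearGroup ℂ (U r i)) := hComp_mulSingle_self i _
  have hnext (g) : hComp (Pi.mulSingle i (unitaryGL g)) ((i : ℕ) + 1) =
    (1 : LinearMap.GeneralLinearGroup ℂ (U r (i + 1))) := hComp_mulSingle_ne i _ (by omega)
  refine average_mem (X := X) (Y := Y) hE ?_ ?_ _ (fun s hs => vertexAct_invariant i hs) ?_ f ?_
  · rintro g p k (_ | l)
    · change uMap r m i (repH r m _ p.1) k = _
      rw [uMap_repH, hself]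
      rfl
    · change entryDual _ _ k l (bMap r m i (repH r m _ p.1)) = _
      rw [bMap_repH, hself, hnext]
      have e : (1 : LinearMap.GeneralLinearGroup ℂ (U r (i + 1)))⁻¹.1 = LinearMap.id := by
        rw [inv_one]; rfl
      rw [e, LinearMap.comp_id, entryDual_comp]
      exact Finset.sum_congr rfl fun j _ => congrArg (· * _) (entryDual_toLin' _ _ _)
  · intro g p k l
    change entryDual _ _ k l (aMap r m i (repH r m _ p.1)) = _
    rw [aMap_repH, hself, hnext]
    have e : (1 : LinearMap.GeneralLinearGroup ℂ (U r (i + 1))).1 = LinearMap.id := rfl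
    rw [e, LinearMap.id_comp, entryDual_comp]
    exact Finset.sum_congr rfl fun j _ => congrArg (_ * ·) (entryDual_toLin' _ _ _)
  · rintro k (_ | l)
    · have e : ∑ j, Y k j * X j none =
          fun p => aMap r m i p.1 (uMap r m i p.1) k := by
        funext p
        rw [apply_eq_sum_entryDual]
        simp [X, Y]
      rw [e]
      by_cases hI : i ∈ I
      · have e' : (fun p : quiverVariety r m I => aMap r m i p.1 (uMap r m i p.1) k) =
            fun p => ∑ l, entryDual _ _ k l (aMap r m i p.1 ∘ₗ bMap r m i p.1) *
              uMap r m (i + 1) p.1 l := by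
          funext p
          rw [← apply_eq_sum_entryDual, LinearMap.comp_apply,
            (mem_quiverVariety_iff.1 p.2).2.1 i i.2 hI]
        rw [e']
        exact sum_mul_mem (fun _ => abCoord_mem_tailAlg le_rfl _ _)
          fun _ => uCoord_mem_tailAlg le_rfl _
      · have e' : (fun p : quiverVariety r m I => aMap r m i p.1 (uMap r m i p.1) k) =
            fun p => uMap r m (i + 1) p.1 k := by
          funext p
          rw [(mem_quiverVariety_iff.1 p.2).2.2 i i.2 hI]
        rw [e']
        exact uCoord_mem_tailAlg le_rfl _
    · have e : ∑ j, Y k j * X j (some l) =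
          fun p => entryDual _ _ k l (aMap r m i p.1 ∘ₗ bMap r m i p.1) := by
        funext p
        rw [entryDual_comp]
        simp [X, Y]
      rw [e]
      exact abCoord_mem_tailAlg le_rfl _ _
  · have hT {s} (hs : s ∈ tailAlg r m I (i + 1)) :
        s ∈ Algebra.adjoin ℂ ((tailAlg r m I (i + 1) : Set _) ∪ Set.range (Function.uncurry X) ∪
          Set.range (Function.uncurry Y)) := Algebra.subset_adjoin (Or.inl (Or.inl hs))
    have hX (k α) : X k α ∈ Algebra.adjoin ℂ ((tailAlg r m I (i + 1) : Set _) ∪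
        Set.range (Function.uncurry X) ∪ Set.range (Function.uncurry Y)) :=
      Algebra.subset_adjoin (Or.inl (Or.inr ⟨(k, α), rfl⟩))
    have hY (k l) : Y k l ∈ Algebra.adjoin ℂ ((tailAlg r m I (i + 1) : Set _) ∪
        Set.range (Function.uncurry X) ∪ Set.range (Function.uncurry Y)) :=
      Algebra.subset_adjoin (Or.inr ⟨(k, l), rfl⟩)
    refine tailAlg_le (fun j hj k => ?_) (fun j hj k l => ?_) (fun j hj k l => ?_)
      (fun j hj k l => ?_) hf
    · rcases hj.eq_or_lt with rfl | hj
      · exact hX k none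
      · exact hT (uCoord_mem_tailAlg hj k)
    · rcases hj.eq_or_lt with rfl | hj
      · exact hY k l
      · exact hT (aCoord_mem_tailAlg hj k l)
    · rcases hj.eq_or_lt with rfl | hj
      · exact hX k (some l)
      · exact hT (bCoord_mem_tailAlg hj k l)
    · rcases Nat.lt_or_ge j i with hji | hj
      · obtain ⟨i, hi⟩ := i
        obtain rfl : i = j + 1 := by simp only at hj hji; omega
        -- `A_j B_j = B_{j+1} A_{j+1}` factors through the vertex that follows
        have e : (fun p : quiverVariety r m I =>
            entryDual _ _ k l (aMap r m j p.1 ∘ₗ bMap r m j p.1)) =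
            fun p => ∑ x, X k (some x) p * Y x l p := by
          funext p
          rw [← (mem_quiverVariety_iff.1 p.2).1 j (by omega), entryDual_comp]
          rfl
        rw [e]
        exact sum_mul_mem (fun x => hX k (some x)) fun x => hY x l
      · exact hT (abCoord_mem_tailAlg (by omega) k l)

/-- A Reynolds operator for the action of `H` on the quiver variety, with values in the functions
that come from `(u_t, A_{t-1} B_{t-1})`. -/
theorem exists_reynolds (r : ℕ → ℕ) (m : ℕ) (I : Finset (Fin (m + 1))) :
    ∃ R : (quiverVariety r m I → ℂ) → (quiverVariety r m I → ℂ),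
      (∀ f ∈ tailAlg r m I 0, R f ∈ tailAlg r m I (m + 1)) ∧
      (∀ f ∈ tailAlg r m I 0, ∀ f' ∈ tailAlg r m I 0, R (f + f') = R f + R f') ∧
      (∀ f ∈ tailAlg r m I 0, (∀ g p, f ⟨repH r m g p.1, repH_mem g p⟩ = f p) → R f = f) ∧
      (∀ s ∈ tailAlg r m I (m + 1), ∀ f ∈ tailAlg r m I 0, R (s * f) = s * R f) := by
  suffices ∀ i ≤ m + 1, ∃ R : (quiverVariety r m I → ℂ) → (quiverVariety r m I → ℂ),
      (∀ f ∈ tailAlg r m I 0, R f ∈ tailAlg r m I i) ∧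
      (∀ f ∈ tailAlg r m I 0, ∀ f' ∈ tailAlg r m I 0, R (f + f') = R f + R f') ∧
      (∀ f ∈ tailAlg r m I 0, (∀ g p, f ⟨repH r m g p.1, repH_mem g p⟩ = f p) → R f = f) ∧
      (∀ s ∈ tailAlg r m I (m + 1), ∀ f ∈ tailAlg r m I 0, R (s * f) = s * R f) from
    this _ le_rfl
  intro i hi
  induction i with
  | zero => exact ⟨id, fun _ h => h, fun _ _ _ _ => rfl, fun _ _ _ => rfl, fun _ _ _ _ => rfl⟩
  | succ i ih =>
    obtain ⟨R, h₁, h₂, h₃, h₄⟩ := ih (by omega)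
    let v : Fin (m + 1) := ⟨i, by omega⟩
    obtain ⟨E, hE1, hE⟩ := exists_haarFunctional (dimU r i)
    have hav {f} (hf : f ∈ tailAlg r m I i) := average_mem_tailAlg v (E := E) hE hf
    refine ⟨fun f => average E (vertexAct v) (R f), fun f hf => (hav (h₁ f hf)).2,
      fun f hf f' hf' => ?_, fun f hf hinv => ?_, fun s hs f hf => ?_⟩
    · simp only [h₂ f hf f' hf']
      exact average_add (hav (h₁ f hf)).1 (hav (h₁ f' hf')).1
    · simp only [h₃ f hf hinv]
      exact average_of_invariant hE1 fun g p => hinv _ p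
    · simp only [h₄ s hs f hf]
      exact average_mul (fun g p => vertexAct_invariant v (tailAlg_anti hi hs) g p)
        (hav (h₁ f hf)).1

theorem coordRing_le_tailAlg : coordRing (quiverVariety r m I) ≤ tailAlg r m I 0 := by
  rintro _ ⟨f, hf, rfl⟩
  refine precomp_mem_of_coords (fun p : quiverVariety r m I => p.1) (repCoord r m)
    (fun _ => eq_zero_of_repCoord) _ ?_ hf
  rintro (⟨i, k⟩ | ⟨i, k, l⟩ | ⟨i, k, l⟩)
  · exact uCoord_mem_tailAlg (Nat.zero_le _) k
  · exact aCoord_mem_tailAlg (Nat.zero_le _) k l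
  · exact bCoord_mem_tailAlg (Nat.zero_le _) k l

theorem tailAlg_last_le : tailAlg r m I (m + 1) ≤
    (polyFun (U r (m + 1) × (U r (m + 1) →ₗ[ℂ] U r (m + 1)))).map
      (precomp fun p : quiverVariety r m I => quiverMap r m p.1) := by
  have h0 : (0 : quiverVariety r m I → ℂ) ∈
      (polyFun (U r (m + 1) × (U r (m + 1) →ₗ[ℂ] U r (m + 1)))).map
      (precomp fun p : quiverVariety r m I => quiverMap r m p.1) := zero_mem _
  refine tailAlg_le (fun j hj k => ?_) (fun j hj k l => ?_) (fun j hj k l => ?_)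
    (fun j hj k l => ?_)
  · rcases hj.eq_or_lt with rfl | hj
    · refine ⟨_, dual_mem_polyFun (coneCoord _ (.inl k)), ?_⟩
      funext p
      change (quiverMap r m p.1).1 k = _
      rw [quiverMap_eq]
    · convert h0 using 1
      funext p
      rw [uMap_of_not_lt (by omega)]
      rfl
  · convert h0 using 1
    funext p
    rw [aMap_of_not_lt (by omega), map_zero]
    rfl
  · convert h0 using 1
    funext p
    rw [bMap_of_not_lt (by omega), map_zero]
    rfl
  · rcases (Nat.le_of_succ_le_succ hj).eq_or_lt with rfl | hj
    · refine ⟨_, dual_mem_polyFun (coneCoord _ (.inr (k, l))), ?_⟩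
      funext p
      change entryDual _ _ k l (quiverMap r m p.1).2 = _
      rw [quiverMap_eq]
    · convert h0 using 1
      funext p
      rw [aMap_of_not_lt (by omega), LinearMap.zero_comp, map_zero]
      rfl

/-- The first fundamental theorem for the quiver variety: invariant regular functions are polynomial
functions of `(u_t, A_{t-1} B_{t-1})`. -/
theorem exists_polyFun_of_invariant {f : quiverVariety r m I → ℂ}
    (hf : f ∈ invariantRing (repH r m) (quiverVariety r m I)) :
    ∃ F ∈ polyFun (U r (m + 1) × (U r (m + 1) →ₗ[ℂ] U r (m + 1))),
      ∀ p, f p = F (quiverMap r m p.1) := by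
  obtain ⟨R, h₁, -, h₃, -⟩ := exists_reynolds r m I
  have hf0 := coordRing_le_tailAlg hf.1
  have h := h₁ f hf0
  rw [h₃ f hf0 fun g p => hf.2 g p _ rfl] at h
  obtain ⟨F, hF, e⟩ := tailAlg_last_le h
  exact ⟨F, hF, fun p => (congrFun e p).symm⟩

end elimination

/-! ### The image of the quiver variety is closed -/

section points

variable {E : Type} [AddCommGroup E] [Module ℂ E]

theorem polyFun_fg [Module.Finite ℂ E] : (polyFun E).FG := by
  classical
  let b := Module.finBasis ℂ E
  refine ⟨Finset.univ.image fun i => (fun x => b.coord i x), le_antisymm ?_ ?_⟩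
  · rw [Algebra.adjoin_le_iff]
    intro f hf
    simp only [Finset.coe_image, Finset.coe_univ, Set.image_univ, Set.mem_range] at hf
    obtain ⟨i, rfl⟩ := hf
    exact dual_mem_polyFun _
  · intro f hf
    refine precomp_mem_of_coords (fun x : E => x) b.coord (fun x hx => ?_) _ (fun i => ?_) hf
    · exact b.ext_elem fun i => by simpa using hx i
    · exact Algebra.subset_adjoin (by simp)

/-- The weak Nullstellensatz: a proper ideal of the coordinate ring of a closed set has a zero. -/
theorem exists_zero_of_ne_top [Module.Finite ℂ E] {X : Set E} (hX : zariskiClosure X ⊆ X)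
    {J : Ideal (coordRing X)} (hJ : J ≠ ⊤) : ∃ e : X, ∀ f ∈ J, f.1 e = 0 := by
  obtain ⟨M, hM, hJM⟩ := J.exists_le_maximal hJ
  have hft : Algebra.FiniteType ℂ (coordRing X) :=
    (Subalgebra.fg_iff_finiteType _).1 (polyFun_fg.map _)
  let _ := Ideal.Quotient.field M
  have : Module.Finite ℂ (coordRing X ⧸ M) := finite_of_finite_type_of_isJacobsonRing _ _
  have : Algebra.IsIntegral ℂ (coordRing X ⧸ M) := Algebra.IsIntegral.of_finite _ _
  let ε : ℂ ≃ₐ[ℂ] (coordRing X ⧸ M) := AlgEquiv.ofBijective (Algebra.ofId ℂ _)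
    IsAlgClosed.algebraMap_bijective_of_isIntegral
  let χ : coordRing X →ₐ[ℂ] ℂ := ε.symm.toAlgHom.comp (Ideal.Quotient.mkₐ ℂ M)
  have hχ : ∀ f ∈ M, χ f = 0 := by
    intro f hf
    change ε.symm (Ideal.Quotient.mk M f) = 0
    rw [Ideal.Quotient.eq_zero_iff_mem.2 hf, map_zero]
  have hres {f} (hf : f ∈ polyFun E) : restrictFun X f ∈ coordRing X := ⟨f, hf, rfl⟩
  let ℓ : Module.Dual ℂ (Module.Dual ℂ E) :=
    { toFun := fun φ => χ ⟨_, hres (dual_mem_polyFun φ)⟩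
      map_add' := fun φ φ' => by rw [← map_add]; rfl
      map_smul' := fun c φ => by rw [RingHom.id_apply, ← map_smul]; rfl }
  let e : E := (Module.evalEquiv ℂ E).symm ℓ
  have he (φ : Module.Dual ℂ E) : χ ⟨_, hres (dual_mem_polyFun φ)⟩ = φ e := by
    have : Module.evalEquiv ℂ E e = ℓ := LinearEquiv.apply_symm_apply _ _
    exact (LinearMap.congr_fun this φ).symm
  have hev : ∀ f (hf : f ∈ polyFun E), χ ⟨_, hres hf⟩ = f e := by
    intro f hf
    unfold polyFun at hf
    induction hf using Algebra.adjoin_induction with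
    | mem f hf =>
      obtain ⟨φ, rfl⟩ := hf
      exact he φ
    | algebraMap c => exact χ.commutes c
    | add f f' hf hf' h h' =>
      rw [Pi.add_apply, ← h, ← h', ← map_add]
      rfl
    | mul f f' hf hf' h h' =>
      rw [Pi.mul_apply, ← h, ← h', ← map_mul]
      rfl
  have heX : e ∈ X := hX fun f hf hf0 => by
    rw [← hev f hf]
    convert map_zero χ
    funext x
    exact hf0 x.1 x.2
  refine ⟨⟨e, heX⟩, fun f hf => ?_⟩
  obtain ⟨f, g, hg, rfl⟩ := f
  have := hev g hg
  exact this.symm.trans (hχ _ (hJM hf))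

end points

section image

variable {r : ℕ → ℕ} {m : ℕ} {I : Finset (Fin (m + 1))}

theorem precomp_quiverMap_mem_coordRing {f}
    (hf : f ∈ polyFun (U r (m + 1) × (U r (m + 1) →ₗ[ℂ] U r (m + 1)))) :
    (fun p : quiverVariety r m I => f (quiverMap r m p.1)) ∈ coordRing (quiverVariety r m I) :=
  ⟨_, precomp_quiverMap_mem hf, rfl⟩

theorem coneCoord_mem_tailAlg (x) :
    (fun p : quiverVariety r m I => coneCoord _ x (quiverMap r m p.1)) ∈
      tailAlg r m I (m + 1) := by
  rcases x with k | ⟨k, l⟩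
  · simp only [quiverMap_eq]
    exact uCoord_mem_tailAlg le_rfl k
  · simp only [quiverMap_eq]
    exact abCoord_mem_tailAlg le_rfl k l

/-- The image of the quiver variety is Zariski closed. If no point lies over `q`, the functions
vanishing at `q` generate the unit ideal of the coordinate ring of the quiver variety; applying the
Reynolds operator shows that `q` is not in the closure of the image. -/
theorem zariskiClosure_image_subset :
    zariskiClosure (quiverMap r m '' quiverVariety r m I) ⊆
      quiverMap r m '' quiverVariety r m I := by
  intro q hq
  let v : Fin (dimU r (m + 1)) ⊕ (Fin (dimU r (m + 1)) × Fin (dimU r (m + 1))) →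
      coordRing (quiverVariety r m I) := fun x =>
    ⟨fun p => coneCoord _ x (quiverMap r m p.1), precomp_quiverMap_mem_coordRing
      (dual_mem_polyFun _)⟩ - algebraMap ℂ _ (coneCoord _ x q)
  have hv (x p) : (v x).1 p = coneCoord _ x (quiverMap r m p.1) - coneCoord _ x q := rfl
  by_cases hJ : Ideal.span (Set.range v) = ⊤
  · exfalso
    obtain ⟨c, hc⟩ := (Ideal.mem_span_range_iff_exists_fun).1
      ((Ideal.eq_top_iff_one _).1 hJ)
    obtain ⟨R, h₁, h₂, h₃, h₄⟩ := exists_reynolds r m I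
    have hR0 : R 0 = 0 := by
      have := h₂ 0 (zero_mem _) 0 (zero_mem _)
      rw [add_zero] at this
      exact left_eq_add.1 this
    have hRsum (s : Finset (Fin (dimU r (m + 1)) ⊕ (Fin (dimU r (m + 1)) × Fin (dimU r (m + 1)))))
        (f : _ → quiverVariety r m I → ℂ) (hf : ∀ x, f x ∈ tailAlg r m I 0) :
        R (∑ x ∈ s, f x) = ∑ x ∈ s, R (f x) := by
      classical
      induction s using Finset.induction_on with
      | empty => simpa using hR0
      | insert a s ha ih =>
        rw [Finset.sum_insert ha, Finset.sum_insert ha, h₂ _ (hf a) _ (sum_mem fun x _ => hf x), ih]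
    have hvT (x) : (v x).1 ∈ tailAlg r m I (m + 1) :=
      sub_mem (coneCoord_mem_tailAlg x) (algebraMap_mem _ _)
    have hcT (x) : (c x).1 ∈ tailAlg r m I 0 := coordRing_le_tailAlg (c x).2
    have h1 : (1 : quiverVariety r m I → ℂ) = ∑ x, (v x).1 * R (c x).1 := by
      have hc' : (1 : quiverVariety r m I → ℂ) = ∑ x, (v x).1 * (c x).1 := by
        have := congrArg Subtype.val hc
        rw [AddSubmonoidClass.coe_finsetSum] at this
        rw [show (1 : quiverVariety r m I → ℂ) = (1 : coordRing (quiverVariety r m I)).1 from rfl,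
          ← this]
        exact Finset.sum_congr rfl fun x _ => mul_comm _ _
      rw [← h₃ 1 (one_mem _) fun _ _ => rfl, hc', hRsum _ _ fun x =>
        mul_mem (tailAlg_anti (Nat.zero_le _) (hvT x)) (hcT x)]
      exact Finset.sum_congr rfl fun x _ => h₄ _ (hvT x) _ (hcT x)
    choose F hF hFR using fun x => tailAlg_last_le (h₁ _ (hcT x))
    have hG := hq ((∑ x, ((fun y => coneCoord _ x y) - algebraMap ℂ _ (coneCoord _ x q)) * F x) - 1)
      (sub_mem (sum_mem fun x _ => mul_mem (sub_mem (dual_mem_polyFun _) (algebraMap_mem _ _))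
        (hF x)) (one_mem _)) (by
      rintro _ ⟨p, hp, rfl⟩
      have := congrFun h1 ⟨p, hp⟩
      simp only [Finset.sum_apply, Pi.mul_apply, Pi.one_apply, hv, ← hFR] at this
      simp only [Pi.sub_apply, Finset.sum_apply, Pi.mul_apply, Pi.one_apply, sub_eq_zero]
      exact this.symm)
    simp only [Pi.sub_apply, Finset.sum_apply, Pi.mul_apply, Pi.algebraMap_apply,
      Algebra.algebraMap_self, RingHom.id_apply, sub_self, zero_mul, Finset.sum_const_zero,
      Pi.one_apply, zero_sub] at hG
    norm_num at hG
  · obtain ⟨e, he⟩ := exists_zero_of_ne_top (fun p => mem_quiverVariety_of_closure p) hJ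
    refine ⟨e.1, e.2, sub_eq_zero.1 (eq_zero_of_coneCoord fun x => ?_)⟩
    rw [map_sub, ← hv]
    exact he _ (Ideal.subset_span ⟨x, rfl⟩)

end image

/-! ### Chains of subspaces with prescribed dimensions -/

open Module

section chains

variable {F V V' : Type} [Field F] [AddCommGroup V] [Module F V] [AddCommGroup V'] [Module F V']

/-- There are subspaces of every possible dimension between two nested subspaces. -/
theorem exists_between [FiniteDimensional F V] {L M : Submodule F V} (hLM : L ≤ M)
    {k : ℕ} (hL : finrank F L ≤ k)
    (hM : k ≤ finrank F M) : ∃ W, L ≤ W ∧ W ≤ M ∧ finrank F W = k := by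
  induction k, hL using Nat.le_induction with
  | base => exact ⟨L, le_rfl, hLM, rfl⟩
  | succ k hk ih =>
    obtain ⟨W, h₁, h₂, h₃⟩ := ih (by omega)
    have hlt : W < M := lt_of_le_of_ne h₂ fun h => by rw [← h] at hM; omega
    obtain ⟨x, hxM, hxW⟩ := SetLike.exists_of_lt hlt
    have hx : x ≠ 0 := fun h => hxW (h ▸ zero_mem W)
    refine ⟨W ⊔ Submodule.span F {x}, h₁.trans le_sup_left,
      sup_le h₂ ((Submodule.span_singleton_le_iff_mem _ _).2 hxM), ?_⟩
    have h := Submodule.finrank_sup_add_finrank_inf_eq W (Submodule.span F {x})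
    rw [finrank_span_singleton hx, h₃] at h
    have hbot : W ⊓ Submodule.span F {x} = ⊥ := by
      rw [Submodule.eq_bot_iff]
      rintro y ⟨hyW, hy⟩
      obtain ⟨c, rfl⟩ := Submodule.mem_span_singleton.1 hy
      by_contra hc
      have hc0 : c ≠ 0 := fun h => hc (by rw [h, zero_smul])
      exact hxW ((Submodule.smul_mem_iff W hc0).1 hyW)
    rw [hbot, finrank_bot] at h
    omega

theorem finrank_sup_add_le [FiniteDimensional F V] {L L' W : Submodule F V}
    (hL : L ≤ L') (hW : L ≤ W) :
    finrank F ↥(W ⊔ L') + finrank F L ≤ finrank F W + finrank F L' := by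
  have h := Submodule.finrank_sup_add_finrank_inf_eq W L'
  have := Submodule.finrank_mono (le_inf hW hL)
  omega

theorem finrank_map_add [FiniteDimensional F V'] (A : V' →ₗ[F] V) (T : Submodule F V') :
    finrank F (T.map A) + finrank F ↥(LinearMap.ker A ⊓ T) = finrank F T := by
  have h := LinearMap.finrank_range_add_finrank_ker (A.domRestrict T)
  rw [LinearMap.range_domRestrict] at h
  have e : finrank F ↥(LinearMap.ker (A.domRestrict T)) = finrank F ↥(LinearMap.ker A ⊓ T) := by
    have : LinearMap.ker A ⊓ T = (LinearMap.ker (A.domRestrict T)).map T.subtype := by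
      ext x
      simp [LinearMap.mem_ker, and_comm]
    rw [this]
    exact (LinearEquiv.finrank_eq (Submodule.equivMapOfInjective _ T.injective_subtype _))
  omega

theorem finrank_map_add_le [FiniteDimensional F V'] (A : V' →ₗ[F] V)
    {S T : Submodule F V'} (h : S ≤ T) :
    finrank F (T.map A) + finrank F S ≤ finrank F T + finrank F (S.map A) := by
  have h₁ := finrank_map_add A S
  have h₂ := finrank_map_add A T
  have h₃ := Submodule.finrank_mono (inf_le_inf_left (LinearMap.ker A) h)
  omega

theorem finrank_comap_eq [FiniteDimensional F V] (B : V →ₗ[F] V') (S : Submodule F V') :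
    finrank F (S.comap B) = finrank F (LinearMap.ker B) + finrank F ↥(LinearMap.range B ⊓ S) := by
  have h := finrank_map_add B (S.comap B)
  rw [Submodule.map_comap_eq, inf_eq_left.2 (LinearMap.ker_le_comap B)] at h
  omega

theorem finrank_comap_add_le [FiniteDimensional F V] [FiniteDimensional F V']
    (B : V →ₗ[F] V') {S T : Submodule F V'} (h : S ≤ T) :
    finrank F (T.comap B) + finrank F S ≤ finrank F (S.comap B) + finrank F T := by
  rw [finrank_comap_eq, finrank_comap_eq]
  have h₁ := Submodule.finrank_sup_add_finrank_inf_eq S (LinearMap.range B ⊓ T)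
  have h₂ := Submodule.finrank_mono (sup_le h (inf_le_right : LinearMap.range B ⊓ T ≤ T))
  have h₃ : S ⊓ (LinearMap.range B ⊓ T) = LinearMap.range B ⊓ S := by
    rw [inf_left_comm, inf_eq_left.2 h]
  rw [h₃] at h₁
  omega

/-- An increasing chain of subspaces of given dimensions between two increasing chains, the lower
of which has jumps no larger than the prescribed ones. -/
theorem exists_chain_up [FiniteDimensional F V] {L M : ℕ → Submodule F V} (hL : Monotone L)
    (hM : Monotone M)
    (hLM : ∀ c, L c ≤ M c) {w : ℕ → ℕ} (h0 : finrank F (L 0) ≤ w 0) (K : ℕ)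
    (hw : ∀ c ≤ K, w c ≤ finrank F (M c))
    (hinc : ∀ c < K, finrank F (L (c + 1)) + w c ≤ w (c + 1) + finrank F (L c)) :
    ∃ W : ℕ → Submodule F V, (∀ c ≤ K, L c ≤ W c ∧ W c ≤ M c ∧ finrank F (W c) = w c) ∧
      ∀ c < K, W c ≤ W (c + 1) := by
  induction K with
  | zero =>
    obtain ⟨W, h⟩ := exists_between (hLM 0) h0 (hw 0 le_rfl)
    exact ⟨fun _ => W, fun c hc => by rwa [Nat.le_zero.1 hc], by simp⟩
  | succ K ih =>
    obtain ⟨W, h₁, h₂⟩ := ih (fun c hc => hw c (by omega)) fun c hc => hinc c (by omega)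
    obtain ⟨hLW, hWM, hWK⟩ := h₁ K le_rfl
    have hd := finrank_sup_add_le (hL (Nat.le_succ K)) hLW
    have hi := hinc K (by omega)
    obtain ⟨Y, hY₁, hY₂, hY₃⟩ := exists_between (L := W K ⊔ L (K + 1)) (M := M (K + 1))
      (sup_le (hWM.trans (hM (Nat.le_succ K))) (hLM _)) (k := w (K + 1))
      (by simp only [Nat.succ_eq_add_one] at hd; omega) (hw _ le_rfl)
    refine ⟨Function.update W (K + 1) Y, fun c hc => ?_, fun c hc => ?_⟩
    · rcases hc.eq_or_lt with rfl | hc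
      · rw [Function.update_self]
        exact ⟨le_sup_right.trans hY₁, hY₂, hY₃⟩
      · rw [Function.update_of_ne (by omega)]
        exact h₁ c (by omega)
    · rw [Function.update_of_ne (by omega)]
      rcases (Nat.lt_succ_iff.1 hc).eq_or_lt with rfl | hc
      · rw [Function.update_self]
        exact le_sup_left.trans hY₁
      · rw [Function.update_of_ne (by omega)]
        exact h₂ c hc

/-- A decreasing chain of subspaces of given dimensions between two decreasing chains, the upper
of which has jumps no larger than the prescribed ones. -/
theorem exists_chain_down [FiniteDimensional F V] {L M : ℕ → Submodule F V} (hL : Antitone L)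
    (hM : Antitone M)
    (hLM : ∀ c, L c ≤ M c) {w : ℕ → ℕ} (h0 : w 0 ≤ finrank F (M 0)) (K : ℕ)
    (hw : ∀ c ≤ K, finrank F (L c) ≤ w c)
    (hinc : ∀ c < K, w (c + 1) + finrank F (M c) ≤ w c + finrank F (M (c + 1))) :
    ∃ W : ℕ → Submodule F V, (∀ c ≤ K, L c ≤ W c ∧ W c ≤ M c ∧ finrank F (W c) = w c) ∧
      ∀ c < K, W (c + 1) ≤ W c := by
  induction K with
  | zero =>
    obtain ⟨W, h⟩ := exists_between (hLM 0) (hw 0 le_rfl) h0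
    exact ⟨fun _ => W, fun c hc => by rwa [Nat.le_zero.1 hc], by simp⟩
  | succ K ih =>
    obtain ⟨W, h₁, h₂⟩ := ih (fun c hc => hw c (by omega)) fun c hc => hinc c (by omega)
    obtain ⟨hLW, hWM, hWK⟩ := h₁ K le_rfl
    have hd := Submodule.finrank_sup_add_finrank_inf_eq (W K) (M (K + 1))
    have hs := Submodule.finrank_mono (sup_le hWM (hM (Nat.le_succ K)))
    have hi := hinc K (by omega)
    obtain ⟨Y, hY₁, hY₂, hY₃⟩ := exists_between (L := L (K + 1)) (M := W K ⊓ M (K + 1))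
      (le_inf ((hL (Nat.le_succ K)).trans hLW) (hLM _)) (k := w (K + 1))
      (hw _ le_rfl) (by simp only [Nat.succ_eq_add_one] at hs; omega)
    refine ⟨Function.update W (K + 1) Y, fun c hc => ?_, fun c hc => ?_⟩
    · rcases hc.eq_or_lt with rfl | hc
      · rw [Function.update_self]
        exact ⟨hY₁, hY₂.trans inf_le_right, hY₃⟩
      · rw [Function.update_of_ne (by omega)]
        exact h₁ c (by omega)
    · rw [Function.update_of_ne (a := c) (by omega)]
      rcases (Nat.lt_succ_iff.1 hc).eq_or_lt with rfl | hc
      · rw [Function.update_self]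
        exact hY₂.trans inf_le_left
      · rw [Function.update_of_ne (by omega)]
        exact h₂ c hc

/-- A chain `0 = W_0 ⊆ W_1 ⊆ ⋯ ⊆ W_N = V` that the endomorphism `x` shifts down. -/
structure IsShiftedFlag (x : V →ₗ[F] V) (W : ℕ → Submodule F V) (N : ℕ) : Prop where
  mono : Monotone W
  zero : W 0 = ⊥
  top : ∀ c, N ≤ c → W c = ⊤
  map_le : ∀ c, (W (c + 1)).map x ≤ W c

/-- Insertion of a column in a flag. Given `A : V' → V`, `B : V → V'` and a flag `W'` in `V'`
shifted by `B A`, the subspaces `A W'_c ⊆ B⁻¹ W'_{c-1}` need not have the right dimensions if `A`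
is not injective or `B` not surjective, but a flag of the right dimensions fits in between. A
subspace `T` of `B⁻¹ W'_K` can be prescribed in its member `W_{K+1}` if there is room for it. -/
theorem exists_flag_insert [FiniteDimensional F V] [FiniteDimensional F V']
    {A : V' →ₗ[F] V} {B : V →ₗ[F] V'} {W' : ℕ → Submodule F V'} {N K r : ℕ}
    (hW : IsShiftedFlag (B ∘ₗ A) W' N) (hK : K ≤ N) (hr : finrank F V = r + finrank F V')
    (hinc : ∀ c, finrank F (W' (c + 1)) ≤ finrank F (W' c) + r) {T : Submodule F V}
    (hT : T ≤ (W' K).comap B)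
    (hTinc : ∀ c, K ≤ c → finrank F (W' (c + 1)) + finrank F T ≤ finrank F (W' c) + r) :
    ∃ W : ℕ → Submodule F V, IsShiftedFlag (A ∘ₗ B) W (N + 1) ∧
      (∀ c ≤ K, finrank F (W c) = finrank F (W' c)) ∧
      (∀ c, K ≤ c → finrank F (W (c + 1)) = r + finrank F (W' c)) ∧
      (W' K).map A ≤ W K ∧ T ≤ W (K + 1) := by
  have hAB : ∀ c, (W' c).map A ≤ (W' (c - 1)).comap B := by
    intro c
    rw [← Submodule.map_le_iff_le_comap, ← Submodule.map_comp]
    cases c with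
    | zero => simp [hW.zero]
    | succ c => exact hW.map_le c
  have hcomap : ∀ c, r + finrank F (W' c) ≤ finrank F ((W' c).comap B) := by
    intro c
    have := finrank_comap_add_le B (le_top : W' c ≤ ⊤)
    rw [Submodule.comap_top, finrank_top, finrank_top] at this
    omega
  have hN : finrank F (W' N) = finrank F V' := by rw [hW.top N le_rfl, finrank_top]
  obtain ⟨Wu, hu₁, hu₂⟩ := exists_chain_up (L := fun c => (W' c).map A)
    (M := fun c => (W' (c - 1)).comap B) (fun _ _ h => Submodule.map_mono (hW.mono h))
    (fun _ _ h => Submodule.comap_mono (hW.mono (Nat.sub_le_sub_right h 1))) hAB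
    (w := fun c => finrank F (W' c))
    (by have := finrank_map_add A (W' 0); omega) K (fun c _ => by
      have h₁ := hcomap (c - 1)
      cases c with
      | zero => rw [hW.zero, finrank_bot]; exact Nat.zero_le _
      | succ c => exact (Nat.add_comm r _ ▸ hinc c).trans h₁)
    (fun c _ => finrank_map_add_le A (hW.mono (Nat.le_succ c)))
  obtain ⟨huL, huM, huK⟩ := hu₁ K le_rfl
  have hKM : ∀ c, K ≤ c → Wu K ≤ (W' c).comap B := fun c hc =>
    huM.trans (Submodule.comap_mono (hW.mono (by omega)))
  -- the upper part of the flag is constructed from the top, the index `j` standing for `N + 1 - j`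
  obtain ⟨Wd, hd₁, hd₂⟩ := exists_chain_down
    (L := fun j => Wu K ⊔ (W' (max K (N - j) + 1)).map A ⊔ T)
    (M := fun j => (W' (max K (N - j))).comap B)
    (fun i j h => sup_le_sup_right (sup_le_sup_left (Submodule.map_mono (hW.mono (by omega))) _) _)
    (fun i j h => Submodule.comap_mono (hW.mono (by omega)))
    (fun j => sup_le (sup_le (hKM _ (le_max_left _ _)) (hAB (max K (N - j) + 1)))
      (hT.trans (Submodule.comap_mono (hW.mono (le_max_left _ _)))))
    (w := fun j => r + finrank F (W' (max K (N - j)))) (hcomap _) (N - K) (fun j _ => by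
      have hc : K ≤ max K (N - j) := le_max_left _ _
      have h₁ := Submodule.finrank_add_le_finrank_add_finrank
        (Wu K ⊔ (W' (max K (N - j) + 1)).map A) T
      have h₂ := finrank_sup_add_le (Submodule.map_mono (f := A)
        (hW.mono (by omega : K ≤ max K (N - j) + 1))) huL
      have h₃ := finrank_map_add_le A (hW.mono (by omega : K ≤ max K (N - j) + 1))
      have h₄ := hTinc _ hc
      omega)
    (fun j hj => by
      have h := finrank_comap_add_le B
        (hW.mono (by omega : max K (N - (j + 1)) ≤ max K (N - j)))
      omega)
  let W : ℕ → Submodule F V := fun c => if c ≤ K then Wu c else Wd (N + 1 - c)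
  have hWu {c} (hc : c ≤ K) : W c = Wu c := if_pos hc
  have hWd {c} (hc : K < c) : W c = Wd (N + 1 - c) := if_neg (by omega)
  have hWd1 {c} (hc : K ≤ c) : W (c + 1) = Wd (N - c) := by
    rw [hWd (by omega)]
    congr 1
    omega
  have hWtop : ∀ c, N + 1 ≤ c → W c = ⊤ := by
    intro c hc
    rw [hWd (by omega), show N + 1 - c = 0 by omega]
    refine Submodule.eq_top_of_finrank_eq ?_
    rw [(hd₁ 0 (Nat.zero_le _)).2.2, hr, Nat.sub_zero, max_eq_right hK, hN]
  have hcmax {c} (hc : K ≤ c) (hcN : c ≤ N) : max K (N - (N - c)) = c := by omega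
  have hle : ∀ c, W (c + 1) ≤ (W' c).comap B := by
    intro c
    by_cases hc : c + 1 ≤ K
    · rw [hWu hc]
      exact (hu₁ _ hc).2.1
    · by_cases hcN : c ≤ N
      · rw [hWd1 (by omega)]
        have := (hd₁ (N - c) (by omega)).2.1
        simpa only [hcmax (c := c) (by omega) hcN] using this
      · rw [hW.top c (by omega), Submodule.comap_top]
        exact le_top
  have hge : ∀ c, (W' c).map A ≤ W c := by
    intro c
    by_cases hc : c ≤ K
    · rw [hWu hc]
      exact (hu₁ _ hc).1
    · by_cases hcN : c ≤ N + 1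
      · obtain ⟨c, rfl⟩ : ∃ d, c = d + 1 := ⟨c - 1, by omega⟩
        rw [hWd1 (by omega)]
        have := (hd₁ (N - c) (by omega)).1
        simp only [hcmax (c := c) (by omega) (by omega)] at this
        exact (le_sup_right.trans le_sup_left).trans this
      · rw [hWtop c (by omega)]
        exact le_top
  refine ⟨W, ⟨monotone_nat_of_le_succ fun c => ?_, ?_, hWtop, fun c => ?_⟩, fun c hc => ?_,
    fun c hc => ?_, ?_, ?_⟩
  · by_cases hc : c + 1 ≤ K
    · rw [hWu hc, hWu (by omega)]
      exact hu₂ c (by omega)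
    · by_cases hcN : N ≤ c
      · rw [hWtop (c + 1) (by omega)]
        exact le_top
      · rw [hWd1 (by omega)]
        by_cases hc' : c = K
        · subst hc'
          rw [hWu le_rfl]
          exact (le_sup_left.trans le_sup_left).trans (hd₁ (N - c) (by omega)).1
        · rw [hWd (by omega), show N + 1 - c = N - c + 1 by omega]
          exact hd₂ _ (by omega)
  · rw [hWu (Nat.zero_le _), ← Submodule.finrank_eq_zero (R := F), (hu₁ 0 (Nat.zero_le _)).2.2,
      hW.zero, finrank_bot]
  · rw [Submodule.map_comp]
    exact (Submodule.map_mono (Submodule.map_le_iff_le_comap.2 (hle c))).trans (hge c)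
  · rw [hWu hc]
    exact (hu₁ c hc).2.2
  · by_cases hcN : c ≤ N
    · rw [hWd1 hc, (hd₁ (N - c) (by omega)).2.2, hcmax hc hcN]
    · rw [hWtop (c + 1) (by omega), finrank_top, hW.top c (by omega), finrank_top, hr]
  · exact hge K
  · rw [hWd1 le_rfl]
    exact le_sup_right.trans (hd₁ (N - K) le_rfl).1

end chains

/-! ### Dimensions of the flags -/

section counting

variable (r : ℕ → ℕ) (P : ℕ → Prop) [DecidablePred P]

/-- The number of columns left of the wall among the columns `0, …, i - 1`, where `P j` means that
the column `j` is left of the wall. -/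
def leftCols (i : ℕ) : ℕ := ((Finset.range i).filter P).card

/-- The number of boxes left of the wall in row `a` of the diagram with columns `0, …, i - 1`. -/
def leftRow (i a : ℕ) : ℕ := ((Finset.range i).filter fun j => P j ∧ a < r j).card

/-- The number of boxes right of the wall in row `a` of the diagram with columns `0, …, i - 1`. -/
def rightRow (i a : ℕ) : ℕ := ((Finset.range i).filter fun j => ¬ P j ∧ a < r j).card

/-- The number of boxes of row `a` in the `c` leftmost columns of the diagram with columns
`0, …, i - 1`, where all rows are aligned at the wall. -/
def rowCount (i a c : ℕ) : ℕ :=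
  min (leftRow r P i a + rightRow r P i a) (c + leftRow r P i a - leftCols P i)

/-- The number of boxes in the `c` leftmost columns of the diagram with columns `0, …, i - 1`,
where all rows, of which there are at most `N`, are aligned at the wall. -/
def flagDim (N i c : ℕ) : ℕ := ∑ a ∈ Finset.range N, rowCount r P i a c

variable {r P}

theorem leftCols_succ (i : ℕ) : leftCols P (i + 1) = leftCols P i + if P i then 1 else 0 := by
  simp only [leftCols, Finset.card_filter, Finset.sum_range_succ]

theorem leftRow_succ (i a : ℕ) :
    leftRow r P (i + 1) a = leftRow r P i a + if P i ∧ a < r i then 1 else 0 := by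
  simp only [leftRow, Finset.card_filter, Finset.sum_range_succ]

theorem rightRow_succ (i a : ℕ) :
    rightRow r P (i + 1) a = rightRow r P i a + if ¬ P i ∧ a < r i then 1 else 0 := by
  simp only [rightRow, Finset.card_filter, Finset.sum_range_succ]

theorem leftRow_le (i a : ℕ) : leftRow r P i a ≤ leftCols P i :=
  Finset.card_le_card fun j hj => by
    simp only [Finset.mem_filter] at hj ⊢
    exact ⟨hj.1, hj.2.1⟩

theorem leftRow_eq_zero {i a : ℕ} (h : ∀ j < i, r j ≤ a) : leftRow r P i a = 0 := by
  rw [leftRow, Finset.card_eq_zero, Finset.filter_eq_empty_iff]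
  intro j hj hj'
  have := h j (Finset.mem_range.1 hj)
  omega

theorem rightRow_eq_zero {i a : ℕ} (h : ∀ j < i, ¬ P j → r j ≤ a) : rightRow r P i a = 0 := by
  rw [rightRow, Finset.card_eq_zero, Finset.filter_eq_empty_iff]
  intro j hj hj'
  have := h j (Finset.mem_range.1 hj) hj'.1
  omega

theorem leftCols_le (i : ℕ) : leftCols P i ≤ i :=
  (Finset.card_filter_le _ _).trans (Finset.card_range i).le

theorem rowCount_eq_zero {i a : ℕ} (h : ∀ j < i, r j ≤ a) (c : ℕ) : rowCount r P i a c = 0 := by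
  rw [rowCount, leftRow_eq_zero h, rightRow_eq_zero fun j hj _ => h j hj]
  simp

theorem rowCount_succ_of_le {i a c : ℕ} (hr : ∀ j < i, r j ≤ r i) (hc : c ≤ leftCols P i) :
    rowCount r P (i + 1) a c = rowCount r P i a c := by
  by_cases ha : a < r i
  · have h := leftRow_le (r := r) (P := P) i a
    rw [rowCount, rowCount, leftRow_succ, rightRow_succ, leftCols_succ]
    by_cases hP : P i <;> simp only [hP, ha, and_self, not_true, not_false_iff, false_and, if_true,
      if_false] <;> omega
  · have h0 : ∀ j < i + 1, r j ≤ a := fun j hj => by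
      rcases Nat.lt_succ_iff_lt_or_eq.1 hj with h | rfl
      · exact (hr j h).trans (by omega)
      · omega
    rw [rowCount_eq_zero h0, rowCount_eq_zero fun j hj => h0 j (by omega)]

theorem rowCount_succ_succ {i a c : ℕ} (hr : ∀ j < i, r j ≤ r i) (hc : leftCols P i ≤ c) :
    rowCount r P (i + 1) a (c + 1) = (if a < r i then 1 else 0) + rowCount r P i a c := by
  by_cases ha : a < r i
  · have h := leftRow_le (r := r) (P := P) i a
    rw [rowCount, rowCount, leftRow_succ, rightRow_succ, leftCols_succ]
    by_cases hP : P i <;> simp only [hP, ha, and_self, not_true, not_false_iff, false_and, if_true,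
      if_false] <;> omega
  · have h0 : ∀ j < i + 1, r j ≤ a := fun j hj => by
      rcases Nat.lt_succ_iff_lt_or_eq.1 hj with h | rfl
      · exact (hr j h).trans (by omega)
      · omega
    rw [rowCount_eq_zero h0, rowCount_eq_zero fun j hj => h0 j (by omega), if_neg ha]

theorem sum_indicator {N k : ℕ} (h : k ≤ N) :
    ∑ a ∈ Finset.range N, (if a < k then 1 else 0) = k := by
  rw [← Finset.card_filter]
  have : (Finset.range N).filter (· < k) = Finset.range k := by
    ext a
    simp only [Finset.mem_filter, Finset.mem_range]
    omega
  rw [this, Finset.card_range]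

theorem flagDim_zero (N c : ℕ) : flagDim r P N 0 c = 0 :=
  Finset.sum_eq_zero fun _ _ => rowCount_eq_zero (by simp) c

theorem flagDim_succ_of_le {N i c : ℕ} (hr : ∀ j < i, r j ≤ r i) (hc : c ≤ leftCols P i) :
    flagDim r P N (i + 1) c = flagDim r P N i c :=
  Finset.sum_congr rfl fun _ _ => rowCount_succ_of_le hr hc

theorem flagDim_succ_succ {N i c : ℕ} (hr : ∀ j < i, r j ≤ r i) (hN : r i ≤ N)
    (hc : leftCols P i ≤ c) : flagDim r P N (i + 1) (c + 1) = r i + flagDim r P N i c := by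
  rw [flagDim, Finset.sum_congr rfl fun a _ => rowCount_succ_succ hr hc, Finset.sum_add_distrib,
    sum_indicator hN, flagDim]

theorem flagDim_step_le {N i c : ℕ} (hr : ∀ j < i, r j ≤ r i) (hN : r i ≤ N) :
    flagDim r P N i (c + 1) ≤ flagDim r P N i c + r i := by
  conv_rhs => rw [← sum_indicator hN]
  rw [flagDim, flagDim, ← Finset.sum_add_distrib]
  refine Finset.sum_le_sum fun a _ => ?_
  split_ifs with ha
  · simp only [rowCount]
    omega
  · rw [rowCount_eq_zero fun j hj => (hr j hj).trans (by omega)]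
    exact Nat.zero_le _

/-- If all earlier columns right of the wall are shorter than `r_i`, then so are the columns of the
aligned diagram right of the wall. -/
theorem flagDim_step_lt {N i c : ℕ} (hN : r i ≤ N) (hpos : 0 < r i)
    (hlt : ∀ j < i, ¬ P j → r j < r i) (hc : leftCols P i ≤ c) :
    flagDim r P N i (c + 1) + 1 ≤ flagDim r P N i c + r i := by
  have h1 : r i = (r i - 1) + 1 := by omega
  suffices flagDim r P N i (c + 1) ≤ flagDim r P N i c + (r i - 1) by omega
  conv_rhs => rw [← sum_indicator (N := N) (k := r i - 1) (by omega)]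
  rw [flagDim, flagDim, ← Finset.sum_add_distrib]
  refine Finset.sum_le_sum fun a _ => ?_
  split_ifs with ha
  · simp only [rowCount]
    omega
  · have h0 : rightRow r P i a = 0 := rightRow_eq_zero fun j hj hPj => by
      have := hlt j hj hPj
      omega
    simp only [rowCount, h0]
    omega

end counting

/-! ### Flags attached to a point of the quiver variety -/

section flags

variable {r : ℕ → ℕ} {m : ℕ} {I : Finset (Fin (m + 1))}

/-- Membership of a natural number in `I ⊆ {0, …, m}`. -/
def inSet (I : Finset (Fin (m + 1))) (j : ℕ) : Prop := ∃ h : j < m + 1, ⟨j, h⟩ ∈ I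

open Classical in
/-- Passage from the vertex `i` to the vertex `i + 1`. If `i ∈ I`, the vector `u_{i+1}` is only
known to lie over `u_i`, and the tie rule gives the room to prescribe it; otherwise it is
`A_i u_i`. -/
theorem exists_flag_succ {p : RepSpace r m} (hp : p ∈ quiverVariety r m I)
    (hr : ∀ i ≤ m, ∀ j < i, r j ≤ r i) (hpos : ∀ i ≤ m, 0 < r i) {N : ℕ} (hN : ∀ i ≤ m, r i ≤ N)
    (htie : ∀ i ≤ m, inSet I i → ∀ j < i, ¬ inSet I j → r j < r i) {i : ℕ} (hi : i ≤ m)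
    {W' : ℕ → Submodule ℂ (U r i)} (hW' : IsShiftedFlag (bMap r m i p ∘ₗ aMap r m i p) W' i)
    (hdim : ∀ c, finrank ℂ (W' c) = flagDim r (inSet I) N i c)
    (hu : uMap r m i p ∈ W' (leftCols (inSet I) i)) :
    ∃ W : ℕ → Submodule ℂ (U r (i + 1)),
      IsShiftedFlag (aMap r m i p ∘ₗ bMap r m i p) W (i + 1) ∧
      (∀ c, finrank ℂ (W c) = flagDim r (inSet I) N (i + 1) c) ∧
      uMap r m (i + 1) p ∈ W (leftCols (inSet I) (i + 1)) := by
  obtain ⟨-, h₂, h₃⟩ := mem_quiverVariety_iff.1 hp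
  have hfin : finrank ℂ (U r (i + 1)) = r i + finrank ℂ (U r i) := by
    rw [finrank_fin_fun, finrank_fin_fun, Finset.sum_range_succ, add_comm]
  have hinc : ∀ c, finrank ℂ (W' (c + 1)) ≤ finrank ℂ (W' c) + r i := fun c => by
    rw [hdim, hdim]
    exact flagDim_step_le (hr i hi) (hN i hi)
  have hdims {W : ℕ → Submodule ℂ (U r (i + 1))}
      (hW₁ : ∀ c ≤ leftCols (inSet I) i, finrank ℂ (W c) = finrank ℂ (W' c))
      (hW₂ : ∀ c, leftCols (inSet I) i ≤ c → finrank ℂ (W (c + 1)) = r i + finrank ℂ (W' c)) (c) :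
      finrank ℂ (W c) = flagDim r (inSet I) N (i + 1) c := by
    by_cases hc : c ≤ leftCols (inSet I) i
    · rw [hW₁ c hc, hdim, flagDim_succ_of_le (hr i hi) hc]
    · obtain ⟨c, rfl⟩ : ∃ d, c = d + 1 := ⟨c - 1, by omega⟩
      rw [hW₂ c (by omega), hdim, flagDim_succ_succ (hr i hi) (hN i hi) (by omega)]
  by_cases hI : inSet I i
  · obtain ⟨him, hI'⟩ := id hI
    have hB := h₂ i him hI'
    obtain ⟨W, hW, hW₁, hW₂, -, hT⟩ :=
      exists_flag_insert hW' (leftCols_le (P := inSet I) i) hfin hinc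
      (T := Submodule.span ℂ {uMap r m (i + 1) p})
      (by
        rw [Submodule.span_singleton_le_iff_mem, Submodule.mem_comap, hB]
        exact hu)
      (fun c hc => by
        have h₁ : finrank ℂ (Submodule.span ℂ {uMap r m (i + 1) p}) ≤ 1 := by
          simpa using finrank_span_le_card (R := ℂ) ({uMap r m (i + 1) p} : Set (U r (i + 1)))
        have h₂ := flagDim_step_lt (hN i hi) (hpos i hi) (htie i hi hI) hc
        rw [hdim, hdim]
        omega)
    refine ⟨W, hW, hdims hW₁ hW₂, ?_⟩
    rw [leftCols_succ, if_pos hI]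
    exact (Submodule.span_singleton_le_iff_mem _ _).1 hT
  · have hA := h₃ i (by omega) fun h => hI ⟨by omega, h⟩
    obtain ⟨W, hW, hW₁, hW₂, hmap, -⟩ :=
      exists_flag_insert hW' (leftCols_le (P := inSet I) i) hfin hinc
      (T := ⊥) bot_le (fun c _ => by rw [finrank_bot]; exact hinc c)
    refine ⟨W, hW, hdims hW₁ hW₂, ?_⟩
    rw [leftCols_succ, if_neg hI, ← hA]
    exact hmap (Submodule.mem_map_of_mem hu)

open Classical in
/-- The image of a point of the quiver variety has a flag with the dimensions of the columns of the
aligned diagram, which is shifted down by the endomorphism and whose member at the wall contains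
the vector. -/
theorem exists_flag_quiverMap {p : RepSpace r m} (hp : p ∈ quiverVariety r m I)
    (hr : ∀ i ≤ m, ∀ j < i, r j ≤ r i) (hpos : ∀ i ≤ m, 0 < r i) {N : ℕ} (hN : ∀ i ≤ m, r i ≤ N)
    (htie : ∀ i ≤ m, inSet I i → ∀ j < i, ¬ inSet I j → r j < r i) :
    ∃ W : ℕ → Submodule ℂ (U r (m + 1)), IsShiftedFlag (quiverMap r m p).2 W (m + 1) ∧
      (∀ c, finrank ℂ (W c) = flagDim r (inSet I) N (m + 1) c) ∧
      (quiverMap r m p).1 ∈ W (leftCols (inSet I) (m + 1)) := by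
  have key : ∀ i ≤ m, ∃ W : ℕ → Submodule ℂ (U r i),
      IsShiftedFlag (bMap r m i p ∘ₗ aMap r m i p) W i ∧
      (∀ c, finrank ℂ (W c) = flagDim r (inSet I) N i c) ∧
      uMap r m i p ∈ W (leftCols (inSet I) i) := by
    intro i hi
    induction i with
    | zero =>
      have hs : Subsingleton (U r 0) := by
        rw [U, Finset.sum_range_zero]
        infer_instance
      refine ⟨fun _ => ⊥, ⟨fun _ _ _ => le_rfl, rfl, fun _ _ => Subsingleton.elim _ _, fun _ => ?_⟩,
        fun c => ?_, ?_⟩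
      · rw [Submodule.map_bot]
      · rw [finrank_bot, flagDim_zero]
      · rw [Submodule.mem_bot]
        exact Subsingleton.elim _ _
    | succ i ih =>
      obtain ⟨W', h₁, h₂, h₃⟩ := ih (by omega)
      obtain ⟨W, hW, h₂', h₃'⟩ := exists_flag_succ hp hr hpos hN htie (by omega) h₁ h₂ h₃
      refine ⟨W, ?_, h₂', h₃'⟩
      rwa [(mem_quiverVariety_iff.1 hp).1 i (by omega)]
  obtain ⟨W', h₁, h₂, h₃⟩ := key m le_rfl
  rw [quiverMap_eq]
  exact exists_flag_succ hp hr hpos hN htie le_rfl h₁ h₂ h₃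

theorem IsShiftedFlag.isNilpotent {F V : Type} [Field F] [AddCommGroup V] [Module F V]
    {x : V →ₗ[F] V} {W : ℕ → Submodule F V} {N : ℕ} (h : IsShiftedFlag x W N) : IsNilpotent x := by
  have key : ∀ k c, (W (c + k)).map (x ^ k) ≤ W c := by
    intro k
    induction k with
    | zero => exact fun c => (Submodule.map_id (W c)).le
    | succ k ih =>
      intro c
      rw [pow_succ, Module.End.mul_eq_comp, Submodule.map_comp]
      exact (Submodule.map_mono (h.map_le (c + k))).trans (ih c)
  refine ⟨N, LinearMap.ext fun v => ?_⟩
  have hv : v ∈ W (0 + N) := by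
    rw [h.top _ (by omega)]
    exact Submodule.mem_top
  have := key N 0 (Submodule.mem_map_of_mem hv)
  rw [h.zero, Submodule.mem_bot] at this
  exact this

end flags

/-! ### The column set of a bipartition -/

section columnSet

variable {μ ν : YoungDiagram} {m : ℕ} {I : Finset (Fin (m + 1))}

theorem colSeq_mono {i j : ℕ} (h : i ≤ j) : colSeq μ ν m i ≤ colSeq μ ν m j :=
  (partSum μ ν).colLen_anti _ _ (by omega)

theorem colSeq_le (i : ℕ) : colSeq μ ν m i ≤ (partSum μ ν).colLen 0 :=
  (partSum μ ν).colLen_anti _ _ (Nat.zero_le _)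

theorem lt_colSeq_iff {i a : ℕ} : a < colSeq μ ν m i ↔ m - i < μ.rowLen a + ν.rowLen a := by
  rw [colSeq, ← YoungDiagram.mem_iff_lt_colLen, mem_partSum]

theorem colSeq_pos (hm : (partSum μ ν).rowLen 0 = m + 1) (i : ℕ) : 0 < colSeq μ ν m i := by
  rw [lt_colSeq_iff, ← rowLen_partSum, hm]
  omega

/-- Among columns of equal length, those in `I` come first. -/
theorem IsColumnSet.lt_of_notMem (hI : IsColumnSet μ ν m I) {i : ℕ} (hi : inSet I i) {j : ℕ}
    (hj : j < i) (hj' : ¬ inSet I j) : colSeq μ ν m j < colSeq μ ν m i := by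
  by_contra hcon
  obtain ⟨him, hiI⟩ := id hi
  have key : ∀ k, j ≤ i - k → inSet I (i - k) := by
    intro k
    induction k with
    | zero => exact fun _ => hi
    | succ k ih =>
      intro hk
      by_cases h0 : i - k = 0
      · rw [show i - (k + 1) = i - k by omega]
        exact ih (by omega)
      · obtain ⟨h₁, h₂⟩ := ih (by omega)
        have e : i - k = i - (k + 1) + 1 := by omega
        refine ⟨by omega, hI.ties ⟨i - (k + 1), by omega⟩ ?_ ?_⟩
        · refine le_antisymm (colSeq_mono (Nat.le_succ _)) ?_
          have h₃ : colSeq μ ν m (i - (k + 1) + 1) ≤ colSeq μ ν m i := colSeq_mono (by omega)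
          have h₄ : colSeq μ ν m j ≤ colSeq μ ν m (i - (k + 1)) := colSeq_mono hk
          exact h₃.trans ((not_lt.1 hcon).trans h₄)
        · convert h₂ using 1
          exact Fin.ext e.symm
  exact hj' (by simpa [show i - (i - j) = j by omega] using key (i - j) (by omega))

open Classical in
theorem card_filter_inSet (Q : ℕ → Prop) :
    ((Finset.range (m + 1)).filter fun j => inSet I j ∧ Q j).card =
      (I.filter fun i : Fin (m + 1) => Q i).card := by
  symm
  refine Finset.card_bij (fun i _ => (i : ℕ)) ?_ (fun _ _ _ _ h => Fin.ext h) ?_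
  · intro i hi
    rw [Finset.mem_filter] at hi ⊢
    exact ⟨Finset.mem_range.2 i.2, ⟨i.2, hi.1⟩, hi.2⟩
  · intro j hj
    obtain ⟨-, ⟨h, hI⟩, hQ⟩ := Finset.mem_filter.1 hj
    exact ⟨⟨j, h⟩, Finset.mem_filter.2 ⟨hI, hQ⟩, rfl⟩

open Classical in
theorem IsColumnSet.leftCols_eq (hI : IsColumnSet μ ν m I) :
    leftCols (inSet I) (m + 1) = μ.rowLen 0 := by
  have h := congrArg Multiset.card hI.colLens
  rw [Multiset.card_map, Multiset.coe_card, YoungDiagram.length_rowLens,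
    YoungDiagram.colLen_transpose] at h
  have e := card_filter_inSet (I := I) fun _ => True
  simp only [and_true, Finset.filter_true] at e
  rw [leftCols, e, ← h]
  rfl

open Classical in
theorem IsColumnSet.leftRow_eq (hI : IsColumnSet μ ν m I) (a : ℕ) :
    leftRow (colSeq μ ν m) (inSet I) (m + 1) a = μ.rowLen a := by
  have h := congrArg (Multiset.countP fun x => a < x) hI.colLens
  rw [Multiset.countP_map] at h
  refine (Eq.trans ?_ (card_filter_inSet (I := I) fun j => a < colSeq μ ν m j)).trans
    (Eq.trans ?_ (h.trans ?_))
  · rw [leftRow]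
    congr!
  · rw [Finset.card, Finset.filter_val]
    congr!
  · rw [YoungDiagram.rowLens, YoungDiagram.colLen_transpose, Multiset.coe_countP, List.countP_map,
      List.countP_eq_length_filter]
    have e : (fun x => decide (a < x)) ∘ μ.transpose.rowLen = fun j => decide (j < μ.rowLen a) := by
      funext j
      simp only [Function.comp_apply, YoungDiagram.rowLen_transpose,
        ← YoungDiagram.mem_iff_lt_colLen, ← YoungDiagram.mem_iff_lt_rowLen]
    rw [e]
    have h' := μ.rowLen_anti 0 a (Nat.zero_le a)
    have e' : ((Finset.range (μ.rowLen 0)).filter fun j => j < μ.rowLen a) =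
        Finset.range (μ.rowLen a) := by
      ext j
      simp only [Finset.mem_filter, Finset.mem_range]
      omega
    have := congrArg Finset.card e'
    rw [Finset.card_range] at this
    exact this

open Classical in
theorem leftRow_add_rightRow (hm : (partSum μ ν).rowLen 0 = m + 1) (a : ℕ) :
    leftRow (colSeq μ ν m) (inSet I) (m + 1) a + rightRow (colSeq μ ν m) (inSet I) (m + 1) a =
      μ.rowLen a + ν.rowLen a := by
  have h := (partSum μ ν).rowLen_anti 0 a (Nat.zero_le a)
  rw [hm, rowLen_partSum] at h
  have e : leftRow (colSeq μ ν m) (inSet I) (m + 1) a +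
      rightRow (colSeq μ ν m) (inSet I) (m + 1) a =
      ((Finset.range (m + 1)).filter fun j => a < colSeq μ ν m j).card := by
    rw [leftRow, rightRow, ← Finset.card_filter_add_card_filter_not
      (s := (Finset.range (m + 1)).filter fun j => a < colSeq μ ν m j) (inSet I),
      Finset.filter_filter, Finset.filter_filter]
    simp only [and_comm]
  rw [e]
  simp only [lt_colSeq_iff]
  have e' : ((Finset.range (m + 1)).filter fun j => m - j < μ.rowLen a + ν.rowLen a) =
      Finset.Ico (m + 1 - (μ.rowLen a + ν.rowLen a)) (m + 1) := by
    ext j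
    simp only [Finset.mem_filter, Finset.mem_range, Finset.mem_Ico]
    omega
  rw [e', Nat.card_Ico]
  omega

open Classical in
theorem IsColumnSet.rightRow_eq (hI : IsColumnSet μ ν m I) (hm : (partSum μ ν).rowLen 0 = m + 1)
    (a : ℕ) : rightRow (colSeq μ ν m) (inSet I) (m + 1) a = ν.rowLen a := by
  have h := leftRow_add_rightRow (I := I) hm a
  rw [hI.leftRow_eq] at h
  omega

/-- The index of the column of a box in the diagram of `(μ;ν)` with rows aligned at the wall. -/
def boxPos (μ : YoungDiagram) (c : ℕ × ℕ) : ℕ := c.2 + (μ.rowLen 0 - μ.rowLen c.1)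

open Classical in
theorem IsColumnSet.flagDim_eq (hI : IsColumnSet μ ν m I) (hm : (partSum μ ν).rowLen 0 = m + 1)
    (c : ℕ) : flagDim (colSeq μ ν m) (inSet I) ((partSum μ ν).colLen 0) (m + 1) c =
      ((partSum μ ν).cells.filter fun x => boxPos μ x < c).card := by
  rw [Finset.card_eq_sum_card_fiberwise (f := Prod.fst)
    (t := Finset.range ((partSum μ ν).colLen 0))]
  · refine Finset.sum_congr rfl fun a _ => ?_
    have h := μ.rowLen_anti 0 a (Nat.zero_le a)
    rw [rowCount, leftRow_add_rightRow hm, hI.leftRow_eq, hI.leftCols_eq]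
    have e : ((partSum μ ν).cells.filter fun x => boxPos μ x < c).filter (fun x => x.1 = a) =
        (Finset.range (min (μ.rowLen a + ν.rowLen a) (c + μ.rowLen a - μ.rowLen 0))).map
          ⟨fun j => (a, j), fun _ _ h => congrArg Prod.snd h⟩ := by
      ext ⟨i, j⟩
      rw [Finset.mem_filter, Finset.mem_filter]
      simp only [YoungDiagram.mem_cells, mem_partSum, boxPos, Finset.mem_map, Finset.mem_range]
      change _ ↔ ∃ k, _ ∧ (a, k) = (i, j)
      simp only [Prod.mk.injEq]
      constructor
      · rintro ⟨⟨h₁, h₂⟩, rfl⟩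
        exact ⟨j, by omega, rfl, rfl⟩
      · rintro ⟨k, hk, rfl, rfl⟩
        exact ⟨⟨by omega, by omega⟩, rfl⟩
    rw [e, Finset.card_map, Finset.card_range]
  · rintro ⟨i, j⟩ hx
    simp only [Finset.coe_filter, Set.mem_ofPred_eq, YoungDiagram.mem_cells] at hx
    simp only [Finset.coe_range, Set.mem_Iio]
    exact YoungDiagram.mem_iff_lt_colLen.1 ((partSum μ ν).up_left_mem le_rfl (Nat.zero_le _) hx.1)

end columnSet

/-! ### Bases adapted to a flag -/

/-- A chain of subspaces with the dimensions of a coordinate flag has a basis adapted to it. -/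
theorem exists_adapted_basis {F V ι : Type} [Field F] [AddCommGroup V] [Module F V]
    [FiniteDimensional F V] [Fintype ι] (pos : ι → ℕ) {W : ℕ → Submodule F V} (hW : Monotone W)
    (hdim : ∀ c, finrank F (W c) = (Finset.univ.filter fun i => pos i < c).card) {N : ℕ}
    (hN : W N = ⊤) (hpos : ∀ i, pos i < N) :
    ∃ b : Basis ι F V, ∀ i, b i ∈ W (pos i + 1) := by
  classical
  have key : ∀ c, ∃ f : ι → V, (∀ i, pos i < c → f i ∈ W (pos i + 1)) ∧
      LinearIndepOn F f {i | pos i < c} := by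
    intro c
    induction c with
    | zero => exact ⟨0, by simp, by simp⟩
    | succ c ih =>
      obtain ⟨f, hf, hli⟩ := ih
      obtain ⟨D, hD⟩ := exists_isCompl (W c)
      have hinf : W c ⊓ (D ⊓ W (c + 1)) = ⊥ := by
        rw [← inf_assoc, hD.inf_eq_bot, bot_inf_eq]
      have hsup : W c ⊔ D ⊓ W (c + 1) = W (c + 1) := by
        rw [← sup_inf_assoc_of_le _ (hW (Nat.le_succ c)), hD.sup_eq_top, top_inf_eq]
      have hcard : finrank F ↥(D ⊓ W (c + 1)) = Fintype.card {i // pos i = c} := by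
        have h := Submodule.finrank_sup_add_finrank_inf_eq (W c) (D ⊓ W (c + 1))
        rw [hinf, hsup, finrank_bot, hdim, hdim] at h
        have e : (Finset.univ.filter fun i => pos i < c + 1).card =
            (Finset.univ.filter fun i => pos i < c).card +
              (Finset.univ.filter fun i => pos i = c).card := by
          rw [← Finset.card_union_of_disjoint]
          · congr 1
            ext i
            simp only [Finset.mem_filter, Finset.mem_univ, true_and, Finset.mem_union]
            omega
          · rw [Finset.disjoint_filter]
            intro i _ h₁ h₂
            omega
        rw [Fintype.card_subtype]
        omega
      let b := (finBasisOfFinrankEq F _ hcard).reindex (Fintype.equivFin _).symm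
      let f' : ι → V := fun i => if h : pos i = c then (b ⟨i, h⟩ : V) else f i
      have hf'b (i) (h : pos i = c) : f' i = b ⟨i, h⟩ := dif_pos h
      have hf'f (i) (h : pos i < c) : f' i = f i := dif_neg (by omega)
      refine ⟨f', fun i hi => ?_, ?_⟩
      · by_cases h : pos i = c
        · rw [hf'b i h, h]
          exact (b ⟨i, h⟩).2.2
        · rw [hf'f i (by omega)]
          exact hf i (by omega)
      · have hset : {i | pos i < c + 1} = {i | pos i < c} ∪ {i | pos i = c} := by
          ext i
          simp only [Set.mem_ofPred_eq, Set.mem_union]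
          omega
        rw [hset]
        refine LinearIndepOn.union ?_ ?_ ?_
        · exact (linearIndepOn_congr fun i hi => hf'f i hi).2 hli
        · have h := b.linearIndependent.map' (Submodule.subtype _) (Submodule.ker_subtype _)
          have e : (fun i : {i | pos i = c} => f' i) = fun i => (b i : V) :=
            funext fun i => hf'b i i.2
          change LinearIndependent F fun i : {i | pos i = c} => f' i
          rw [e]
          exact h
        · refine Disjoint.mono (Submodule.span_le.2 ?_) (Submodule.span_le.2 ?_)
            (disjoint_iff.2 hinf)
          · rintro _ ⟨i, hi, rfl⟩
            rw [hf'f i hi]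
            exact hW (Nat.succ_le_of_lt hi) (hf i hi)
          · rintro _ ⟨i, hi, rfl⟩
            rw [hf'b i hi]
            exact (b ⟨i, hi⟩).2
  obtain ⟨f, hf, hli⟩ := key N
  have huniv : {i | pos i < N} = Set.univ := Set.eq_univ_of_forall hpos
  rw [huniv, linearIndepOn_univ_iff] at hli
  have hcard : Fintype.card ι = finrank F V := by
    rw [← finrank_top F V, ← hN, hdim, Finset.filter_true_of_mem fun i _ => hpos i]
    rfl
  refine ⟨basisOfLinearIndependentOfCardEqFinrank' f hli hcard, fun i => ?_⟩
  rw [coe_basisOfLinearIndependentOfCardEqFinrank']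
  exact hf i (hpos i)

/-! ### The tangent space of an orbit inside a space of flag-preserving pairs -/

section boxes

variable {μ ν : YoungDiagram} {V : Type} [AddCommGroup V] [Module ℂ V]
  (b : Basis (partSum μ ν).cells ℂ V)

/-- The basis vector of a box, and zero outside of the diagram. -/
noncomputable def boxVec (i j : ℕ) : V :=
  if h : (i, j) ∈ (partSum μ ν).cells then b ⟨(i, j), h⟩ else 0

/-- The linear map with prescribed values on the boxes. -/
noncomputable def boxMap (f : ℕ → ℕ → V) : V →ₗ[ℂ] V := b.constr ℂ fun c => f c.1.1 c.1.2

/-- The nilpotent map sending a box to its left neighbour. -/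
noncomputable def boxShift : V →ₗ[ℂ] V :=
  boxMap b fun i j => if j = 0 then 0 else boxVec b i (j - 1)

/-- The sum of the boxes immediately left of the wall. -/
noncomputable def boxSum : V :=
  ∑ c : (partSum μ ν).cells, if c.1.2 + 1 = μ.rowLen c.1.1 then b c else 0

/-- The span of the boxes in the `c` leftmost columns, where rows are aligned at the wall. -/
def boxFlag (c : ℕ) : Submodule ℂ V := Submodule.span ℂ (b '' {x | boxPos μ x.1 < c})

theorem mem_cells_iff {i j : ℕ} :
    (i, j) ∈ (partSum μ ν).cells ↔ j < μ.rowLen i + ν.rowLen i := by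
  rw [YoungDiagram.mem_cells, mem_partSum]

variable {b}

theorem basis_eq_boxVec (c : (partSum μ ν).cells) : b c = boxVec b c.1.1 c.1.2 := by
  rw [boxVec, dif_pos c.2]

theorem boxVec_eq_zero {i j : ℕ} (h : μ.rowLen i + ν.rowLen i ≤ j) : boxVec b i j = 0 :=
  dif_neg fun h' => by rw [mem_cells_iff] at h'; omega

theorem boxMap_basis (f : ℕ → ℕ → V) (c : (partSum μ ν).cells) :
    boxMap b f (b c) = f c.1.1 c.1.2 := b.constr_basis ℂ _ c

theorem boxMap_boxVec (f : ℕ → ℕ → V) {i j : ℕ} (h : j < μ.rowLen i + ν.rowLen i) :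
    boxMap b f (boxVec b i j) = f i j := by
  rw [← mem_cells_iff] at h
  exact (congrArg _ (basis_eq_boxVec (b := b) ⟨(i, j), h⟩).symm).trans
    (boxMap_basis f ⟨(i, j), h⟩)

theorem boxShift_zero (i : ℕ) : boxShift b (boxVec b i 0) = 0 := by
  by_cases h : 0 < μ.rowLen i + ν.rowLen i
  · rw [boxShift, boxMap_boxVec _ h, if_pos rfl]
  · rw [boxVec_eq_zero (by omega), map_zero]

theorem boxShift_succ {i j : ℕ} (h : j + 1 < μ.rowLen i + ν.rowLen i) :
    boxShift b (boxVec b i (j + 1)) = boxVec b i j := by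
  rw [boxShift, boxMap_boxVec _ h, if_neg (Nat.succ_ne_zero j)]
  rfl

theorem mem_enhancedOrbit (b : Basis (partSum μ ν).cells ℂ V) :
    (boxSum b, boxShift b) ∈ enhancedOrbit μ ν V := by
  refine ⟨b, fun i h => ?_, fun i j h h' => ?_, rfl⟩
  · rw [basis_eq_boxVec]
    exact boxShift_zero i
  · rw [basis_eq_boxVec, basis_eq_boxVec]
    exact boxShift_succ (mem_cells_iff.1 h)

theorem boxFlag_mono {c c' : ℕ} (h : c ≤ c') : boxFlag b c ≤ boxFlag b c' :=
  Submodule.span_mono (Set.image_mono fun _ (hx : _ < c) => lt_of_lt_of_le hx h)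

theorem basis_mem_boxFlag {c : ℕ} (x : (partSum μ ν).cells) (h : boxPos μ x.1 < c) :
    b x ∈ boxFlag b c := Submodule.subset_span ⟨x, h, rfl⟩

theorem boxVec_mem_boxFlag {i j c : ℕ} (h : boxPos μ (i, j) < c) : boxVec b i j ∈ boxFlag b c := by
  by_cases hc : (i, j) ∈ (partSum μ ν).cells
  · rw [boxVec, dif_pos hc]
    exact basis_mem_boxFlag _ h
  · rw [boxVec, dif_neg hc]
    exact zero_mem _

theorem map_mem_boxFlag {X : V →ₗ[ℂ] V} {k : ℕ}
    (hX : ∀ x, X (b x) ∈ boxFlag b (boxPos μ x.1 + 1 - k)) {c : ℕ} {v : V}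
    (hv : v ∈ boxFlag b c) : X v ∈ boxFlag b (c - k) := by
  have : boxFlag b c ≤ (boxFlag b (c - k)).comap X := Submodule.span_le.2 (by
    rintro _ ⟨x, hx, rfl⟩
    have hx' : boxPos μ x.1 < c := hx
    exact boxFlag_mono (by omega) (hX x))
  exact this hv

theorem boxShift_basis_mem (x : (partSum μ ν).cells) :
    boxShift b (b x) ∈ boxFlag b (boxPos μ x.1) := by
  rw [boxShift, boxMap_basis]
  split_ifs with h
  · exact zero_mem _
  · refine boxVec_mem_boxFlag ?_
    simp only [boxPos]
    omega

theorem boxSum_mem : boxSum b ∈ boxFlag b (μ.rowLen 0) := by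
  refine sum_mem fun x _ => ?_
  split_ifs with h
  · refine basis_mem_boxFlag x ?_
    have := μ.rowLen_anti 0 x.1.1 (Nat.zero_le _)
    simp only [boxPos]
    omega
  · exact zero_mem _

/-- Each elementary matrix lowering the position of a box is a commutator with the shift. The
commutator is built along the row of the source, to the left of it if this does not lead out of the
diagram, and otherwise to the right of it. -/
theorem exists_commutator (c c' : (partSum μ ν).cells) (h : boxPos μ c'.1 < boxPos μ c.1) :
    ∃ X : V →ₗ[ℂ] V, (∀ a, X (b a) ∈ boxFlag b (boxPos μ a.1 + 1)) ∧
      ∀ a, X (boxShift b (b a)) - boxShift b (X (b a)) = if a = c then b c' else 0 := by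
  obtain ⟨⟨i, j⟩, hc⟩ := c
  obtain ⟨⟨i', j'⟩, hc'⟩ := c'
  have hb' : b ⟨(i', j'), hc'⟩ = boxVec b i' j' := basis_eq_boxVec _
  rw [hb']
  have hj := mem_cells_iff.1 hc
  have hj' := mem_cells_iff.1 hc'
  simp only [boxPos] at h
  have hμ := μ.rowLen_anti 0 i (Nat.zero_le _)
  have hμ' := μ.rowLen_anti 0 i' (Nat.zero_le _)
  have hac (a l) (ha : (a, l) ∈ (partSum μ ν).cells) :
      ((⟨(a, l), ha⟩ : (partSum μ ν).cells) = ⟨(i, j), hc⟩) ↔ a = i ∧ l = j := by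
    simp
  by_cases hlt : j' < j
  · refine ⟨boxMap b fun a l =>
      if a = i ∧ l < j ∧ j ≤ j' + l + 1 then boxVec b i' (j' + l + 1 - j) else 0, fun a => ?_, ?_⟩
    · rw [boxMap_basis]
      split_ifs with ha
      · refine boxVec_mem_boxFlag ?_
        simp only [boxPos, ha.1]
        omega
      · exact zero_mem _
    · rintro ⟨⟨a, l⟩, ha⟩
      have hl := mem_cells_iff.1 ha
      simp only [hac]
      rw [basis_eq_boxVec, boxMap_boxVec _ hl]
      rcases l with _ | l
      · rw [boxShift_zero, map_zero, zero_sub, if_neg (c := a = i ∧ 0 = j) (by omega)]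
        split_ifs with h0
        · rw [show j' + 0 + 1 - j = 0 by omega, boxShift_zero, neg_zero]
        · rw [map_zero, neg_zero]
      · rw [boxShift_succ hl, boxMap_boxVec _ (by omega)]
        by_cases hai : a = i
        · subst hai
          rcases lt_trichotomy (l + 1) j with h1 | h1 | h1
          · rw [if_neg (c := a = a ∧ l + 1 = j) (by omega)]
            by_cases h2 : j ≤ j' + l + 1
            · rw [if_pos ⟨rfl, by omega, h2⟩, if_pos ⟨rfl, by omega, by omega⟩,
                show j' + (l + 1) + 1 - j = j' + l + 1 - j + 1 by omega,
                boxShift_succ (by omega), sub_self]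
            · rw [if_neg (by omega)]
              split_ifs with h3
              · rw [show j' + (l + 1) + 1 - j = 0 by omega, boxShift_zero, sub_zero]
              · rw [map_zero, sub_zero]
          · rw [if_pos (c := a = a ∧ l + 1 = j) (by omega),
              if_pos (c := a = a ∧ l < j ∧ j ≤ j' + l + 1) (by omega), if_neg (by omega), map_zero,
              sub_zero]
            congr 1
            omega
          · rw [if_neg (c := a = a ∧ l + 1 = j) (by omega), if_neg (by omega), if_neg (by omega),
              map_zero, sub_zero]
        · rw [if_neg (c := a = i ∧ l + 1 = j) (by omega), if_neg (by omega), if_neg (by omega),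
              map_zero, sub_zero]
  · have hν : ν.rowLen i ≤ ν.rowLen i' := by
      refine ν.rowLen_anti i' i ?_
      by_contra hcon
      have := μ.rowLen_anti i i' (by omega)
      omega
    refine ⟨boxMap b fun a l =>
      if a = i ∧ j ≤ l then - boxVec b i' (j' + l + 1 - j) else 0, fun a => ?_, ?_⟩
    · rw [boxMap_basis]
      split_ifs with ha
      · refine neg_mem (boxVec_mem_boxFlag ?_)
        simp only [boxPos, ha.1]
        omega
      · exact zero_mem _
    · rintro ⟨⟨a, l⟩, ha⟩
      have hl := mem_cells_iff.1 ha
      simp only [hac]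
      rw [basis_eq_boxVec, boxMap_boxVec _ hl]
      by_cases hai : a = i
      · subst hai
        have hlast (h1 : l = j) :
            boxShift b (-boxVec b i' (j' + l + 1 - j)) = - boxVec b i' j' := by
          rw [map_neg, h1, show j' + j + 1 - j = j' + 1 by omega, boxShift_succ (by omega)]
        rcases l with _ | l
        · rw [boxShift_zero, map_zero, zero_sub]
          by_cases h1 : 0 = j
          · rw [if_pos (by omega), if_pos ⟨rfl, h1⟩, hlast h1, neg_neg]
          · rw [if_neg (by omega), if_neg (by omega), map_zero, neg_zero]
        · rw [boxShift_succ hl, boxMap_boxVec _ (by omega)]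
          rcases lt_trichotomy (l + 1) j with h1 | h1 | h1
          · rw [if_neg (by omega), if_neg (by omega), if_neg (by omega), map_zero, sub_zero]
          · rw [if_neg (c := a = a ∧ j ≤ l) (by omega), if_pos (by omega), if_pos ⟨rfl, h1⟩,
              hlast h1, zero_sub, neg_neg]
          · rw [if_pos (c := a = a ∧ j ≤ l) (by omega), if_pos (by omega), if_neg (by omega),
              map_neg, show j' + (l + 1) + 1 - j = j' + l + 1 - j + 1 by omega,
              boxShift_succ (by omega), sub_self]
      · rw [if_neg (c := a = i ∧ j ≤ l) (by omega), if_neg (c := a = i ∧ l = j) (by omega),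
          map_zero, sub_zero]
        rcases l with _ | l
        · rw [boxShift_zero, map_zero]
        · rw [boxShift_succ hl, boxMap_boxVec _ (by omega), if_neg (by omega)]

/-- The boxes left of the wall are images of the normal vector under maps commuting with the
shift. -/
theorem exists_commuting (c : (partSum μ ν).cells) (h : boxPos μ c.1 < μ.rowLen 0) :
    ∃ X : V →ₗ[ℂ] V, (∀ a, X (b a) ∈ boxFlag b (boxPos μ a.1 + 1)) ∧ X (boxSum b) = b c ∧
      ∀ a, X (boxShift b (b a)) - boxShift b (X (b a)) = 0 := by
  obtain ⟨⟨i, j⟩, hc⟩ := c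
  have hj := mem_cells_iff.1 hc
  simp only [boxPos] at h
  have hμ := μ.rowLen_anti 0 i (Nat.zero_le _)
  obtain ⟨k, hk⟩ : ∃ k, μ.rowLen i = j + 1 + k := ⟨μ.rowLen i - j - 1, by omega⟩
  refine ⟨boxMap b fun a l => if a = i ∧ k ≤ l then boxVec b i (l - k) else 0, fun a => ?_, ?_,
    ?_⟩
  · rw [boxMap_basis]
    split_ifs with ha
    · refine boxVec_mem_boxFlag ?_
      simp only [boxPos, ha.1]
      omega
    · exact zero_mem _
  · have hm : (i, j + k) ∈ (partSum μ ν).cells := mem_cells_iff.2 (by omega)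
    rw [boxSum, map_sum, Finset.sum_eq_single ⟨(i, j + k), hm⟩]
    · rw [if_pos (by simp only; omega), boxMap_basis, if_pos ⟨rfl, by simp⟩, basis_eq_boxVec]
      simp
    · rintro ⟨⟨a, l⟩, ha⟩ - hne
      split_ifs with h1
      · rw [boxMap_basis, if_neg]
        rintro ⟨hai, -⟩
        have hai : a = i := hai
        subst hai
        have h2 : l + 1 = μ.rowLen a := h1
        exact hne (Subtype.ext (Prod.ext rfl (by simp only; omega)))
      · rw [map_zero]
    · simp
  · rintro ⟨⟨a, l⟩, ha⟩
    have hl := mem_cells_iff.1 ha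
    rw [basis_eq_boxVec, boxMap_boxVec _ hl, sub_eq_zero]
    rcases l with _ | l
    · rw [boxShift_zero, map_zero]
      split_ifs with h1
      · rw [Nat.zero_sub, boxShift_zero]
      · rw [map_zero]
    · rw [boxShift_succ hl, boxMap_boxVec _ (by omega)]
      by_cases h1 : a = i ∧ k ≤ l
      · obtain ⟨rfl, h1⟩ := h1
        rw [if_pos ⟨rfl, h1⟩, if_pos ⟨rfl, by omega⟩, show l + 1 - k = l - k + 1 by omega,
          boxShift_succ (by omega)]
      · rw [if_neg h1]
        split_ifs with h2
        · rw [show l + 1 - k = 0 by omega, boxShift_zero]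
        · rw [map_zero]

/-- The orbit of the normal form under flag-preserving automorphisms has the full tangent space. -/
theorem exists_tangent {w : V} {y : V →ₗ[ℂ] V} (hw : w ∈ boxFlag b (μ.rowLen 0))
    (hy : ∀ a, y (b a) ∈ boxFlag b (boxPos μ a.1)) :
    ∃ X : V →ₗ[ℂ] V, (∀ a, X (b a) ∈ boxFlag b (boxPos μ a.1 + 1)) ∧ X (boxSum b) = w ∧
      X ∘ₗ boxShift b - boxShift b ∘ₗ X = y := by
  classical
  have h₁ : ∃ X : V →ₗ[ℂ] V, (∀ a, X (b a) ∈ boxFlag b (boxPos μ a.1 + 1)) ∧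
      ∀ a, X (boxShift b (b a)) - boxShift b (X (b a)) = y (b a) := by
    choose X hX hX' using fun p : (partSum μ ν).cells × (partSum μ ν).cells =>
      fun h : boxPos μ p.2.1 < boxPos μ p.1.1 => exists_commutator (b := b) p.1 p.2 h
    let X' : (partSum μ ν).cells × (partSum μ ν).cells → V →ₗ[ℂ] V := fun p =>
      if h : boxPos μ p.2.1 < boxPos μ p.1.1 then b.repr (y (b p.1)) p.2 • X p h else 0
    refine ⟨∑ p, X' p, fun a => ?_, fun a => ?_⟩
    · rw [LinearMap.sum_apply]
      refine sum_mem fun p _ => ?_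
      by_cases h : boxPos μ p.2.1 < boxPos μ p.1.1
      · simp only [X', dif_pos h, LinearMap.smul_apply]
        exact Submodule.smul_mem _ _ (hX p h a)
      · simp only [X', dif_neg h, LinearMap.zero_apply]
        exact zero_mem _
    · have hterm (p) : X' p (boxShift b (b a)) - boxShift b (X' p (b a)) =
          if a = p.1 then b.repr (y (b a)) p.2 • b p.2 else 0 := by
        by_cases h : boxPos μ p.2.1 < boxPos μ p.1.1
        · simp only [X', dif_pos h, LinearMap.smul_apply, map_smul, ← smul_sub, hX' p h]
          split_ifs with ha
          · rw [ha]
          · rw [smul_zero]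
        · simp only [X', dif_neg h, LinearMap.zero_apply, map_zero, sub_zero]
          split_ifs with ha
          · have hs := b.mem_span_image.1 (hy a)
            have : b.repr (y (b a)) p.2 = 0 := by
              by_contra hne
              have := hs (Finsupp.mem_support_iff.2 hne)
              exact h (ha ▸ this)
            rw [this, zero_smul]
          · rfl
      rw [LinearMap.sum_apply, LinearMap.sum_apply, map_sum, ← Finset.sum_sub_distrib,
        Finset.sum_congr rfl fun p _ => hterm p, Fintype.sum_prod_type,
        Finset.sum_eq_single a (fun x _ hx => by simp [hx.symm]) (by simp)]
      simp only [if_true]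
      exact b.sum_repr _
  obtain ⟨X, hX, hXy⟩ := h₁
  let T : Submodule ℂ V :=
    { carrier := {w | ∃ X : V →ₗ[ℂ] V, (∀ a, X (b a) ∈ boxFlag b (boxPos μ a.1 + 1)) ∧
        X (boxSum b) = w ∧ ∀ a, X (boxShift b (b a)) - boxShift b (X (b a)) = 0}
      zero_mem' := ⟨0, fun a => zero_mem _, rfl, fun a => by simp⟩
      add_mem' := by
        rintro _ _ ⟨X, h, rfl, h'⟩ ⟨Y, k, rfl, k'⟩
        refine ⟨X + Y, fun a => add_mem (h a) (k a), rfl, fun a => ?_⟩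
        rw [LinearMap.add_apply, LinearMap.add_apply, map_add, add_sub_add_comm, h', k', add_zero]
      smul_mem' := by
        rintro s _ ⟨X, h, rfl, h'⟩
        refine ⟨s • X, fun a => Submodule.smul_mem _ _ (h a), rfl, fun a => ?_⟩
        rw [LinearMap.smul_apply, LinearMap.smul_apply, map_smul, ← smul_sub, h', smul_zero] }
  have hT : boxFlag b (μ.rowLen 0) ≤ T := Submodule.span_le.2 (by
    rintro _ ⟨c, hc, rfl⟩
    exact exists_commuting c hc)
  have hXw : X (boxSum b) ∈ boxFlag b (μ.rowLen 0) := by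
    simpa using map_mem_boxFlag (k := 0) (by simpa using hX) boxSum_mem
  obtain ⟨Y, hY, hYw, hY0⟩ := hT (sub_mem hw hXw)
  refine ⟨X + Y, fun a => add_mem (hX a) (hY a), ?_, b.ext fun a => ?_⟩
  · rw [LinearMap.add_apply, hYw, add_sub_cancel]
  · rw [LinearMap.sub_apply, LinearMap.comp_apply, LinearMap.comp_apply, LinearMap.add_apply,
      LinearMap.add_apply, map_add, add_sub_add_comm, hXy, hY0, add_zero]

end boxes

/-! ### Density of the orbit -/

/-- A surjective linear system stays solvable under small perturbations, with invertible
solutions near the identity: Cramer's rule gives a solution depending continuously on the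
parameter. -/
theorem eventually_exists_isUnit {V P : Type} [AddCommGroup V] [Module ℂ V] [FiniteDimensional ℂ V]
    [AddCommGroup P] [Module ℂ P] [FiniteDimensional ℂ P] (q : Submodule ℂ (V →ₗ[ℂ] V))
    (e : q) (he : e.1 = 1) (S T : q →ₗ[ℂ] P) (hS : Function.Surjective S) (d : P) :
    ∀ᶠ s in nhds (0 : ℂ), ∃ X : q, IsUnit X.1 ∧ S X + s • T X = S e + s • T e + s • d := by
  obtain ⟨R, hR⟩ := S.exists_rightInverse_of_surjective (LinearMap.range_eq_top.2 hS)
  let p := finBasis ℂ P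
  let v := finBasis ℂ V
  let M := LinearMap.toMatrix p p (T ∘ₗ R)
  -- `Z s` is `D s` times the solution
  let D : ℂ → ℂ := fun s => (1 + s • M).det
  let y : ℂ → Fin (finrank ℂ P) → ℂ := fun s => (1 + s • M).adjugate.mulVec (p.repr d)
  let Z : ℂ → q := fun s => D s • e + s • ∑ j, y s j • R (p j)
  have hM : Continuous fun s : ℂ => 1 + s • M := by fun_prop
  have hD : Continuous D := hM.matrix_det
  have hy : Continuous y := hM.matrix_adjugate.matrix_mulVec continuous_const
  have hZ : Continuous fun s => LinearMap.toMatrix v v (Z s).1 := by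
    simp only [Z, Submodule.coe_add, Submodule.coe_smul, Submodule.coe_sum, map_add, map_smul,
      map_sum]
    fun_prop
  have hD0 : D 0 = 1 := by simp [D]
  have hZ0 : (LinearMap.toMatrix v v (Z 0).1).det = 1 := by
    simp [Z, hD0, he]
  have h₁ : ∀ᶠ s in nhds (0 : ℂ), D s ≠ 0 :=
    hD.continuousAt.eventually_ne (by rw [hD0]; exact one_ne_zero)
  have h₂ : ∀ᶠ s in nhds (0 : ℂ), (LinearMap.toMatrix v v (Z s).1).det ≠ 0 :=
    hZ.matrix_det.continuousAt.eventually_ne (by rw [hZ0]; exact one_ne_zero)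
  filter_upwards [h₁, h₂] with s hs₁ hs₂
  have hsum : (∑ j, y s j • p j) + s • T (R (∑ j, y s j • p j)) = D s • d := by
    apply p.repr.injective
    apply DFunLike.coe_injective
    have e₁ : ⇑(p.repr (∑ j, y s j • p j)) = y s := p.repr_sum_self (y s)
    have e₂ : ⇑(p.repr (T (R (∑ j, y s j • p j)))) = M.mulVec (y s) := by
      exact (LinearMap.toMatrix_mulVec_repr p p (T ∘ₗ R) _).symm.trans (by rw [e₁])
    rw [map_add, map_smul, map_smul, Finsupp.coe_add, Finsupp.coe_smul, Finsupp.coe_smul, e₁, e₂]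
    have : (1 + s • M).mulVec (y s) = D s • ⇑(p.repr d) := by
      simp only [y, D]
      rw [Matrix.mulVec_mulVec, Matrix.mul_adjugate, Matrix.smul_mulVec, Matrix.one_mulVec]
    rw [← this, Matrix.add_mulVec, Matrix.one_mulVec, Matrix.smul_mulVec]
  have hSR (z : P) : S (R z) = z := LinearMap.congr_fun hR z
  refine ⟨(D s)⁻¹ • Z s, ?_, ?_⟩
  · rw [Submodule.coe_smul]
    refine IsUnit.smul (Units.mk0 _ (inv_ne_zero hs₁)) ?_
    rw [LinearMap.isUnit_iff_isUnit_det, ← LinearMap.det_toMatrix v]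
    exact hs₂.isUnit
  · have hZs : Z s = D s • e + s • R (∑ j, y s j • p j) := by
      simp only [Z, map_sum, map_smul]
    generalize (∑ j, y s j • p j) = z at hsum hZs
    have hd : d = (D s)⁻¹ • (z + s • T (R z)) := by
      rw [hsum, smul_smul, inv_mul_cancel₀ hs₁, one_smul]
    rw [hZs, hd]
    simp only [map_add, map_smul, hSR, smul_add, smul_smul, inv_mul_cancel₀ hs₁, one_smul]
    rw [mul_comm s (D s)⁻¹]
    abel

theorem polyFun_line {E : Type} [AddCommGroup E] [Module ℂ E] {f : E → ℂ} (hf : f ∈ polyFun E)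
    (x d : E) : ∃ p : Polynomial ℂ, ∀ s : ℂ, f (x + s • d) = p.eval s := by
  induction hf using Algebra.adjoin_induction with
  | mem f hf =>
    obtain ⟨φ, rfl⟩ := hf
    exact ⟨Polynomial.C (φ x) + Polynomial.C (φ d) * Polynomial.X, fun s => by simp [mul_comm s]⟩
  | algebraMap c => exact ⟨Polynomial.C c, fun s => by simp⟩
  | add f g _ _ hf hg =>
    obtain ⟨p, hp⟩ := hf
    obtain ⟨q, hq⟩ := hg
    exact ⟨p + q, fun s => by simp [hp, hq]⟩
  | mul f g _ _ hf hg =>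
    obtain ⟨p, hp⟩ := hf
    obtain ⟨q, hq⟩ := hg
    exact ⟨p * q, fun s => by simp [hp, hq]⟩

/-- The Zariski closure of a set contains every line that stays in the set near one point. -/
theorem add_mem_zariskiClosure {E : Type} [AddCommGroup E] [Module ℂ E] {S : Set E} {x d : E}
    (h : ∀ᶠ s in nhds (0 : ℂ), x + s • d ∈ S) : x + d ∈ zariskiClosure S := by
  intro f hf hS
  obtain ⟨p, hp⟩ := polyFun_line hf x d
  have h0 : p = 0 := by
    refine Polynomial.eq_zero_of_infinite_isRoot p ((infinite_of_mem_nhds 0 h).mono fun s hs => ?_)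
    exact (hp s).symm.trans (hS _ hs)
  have := hp 1
  rwa [h0, Polynomial.eval_zero, one_smul] at this

section orbit

variable {μ ν : YoungDiagram} {V : Type} [AddCommGroup V] [Module ℂ V]

theorem mem_enhancedOrbit_of_isUnit {p q : V × (V →ₗ[ℂ] V)} (hp : p ∈ enhancedOrbit μ ν V)
    {X : V →ₗ[ℂ] V} (hX : IsUnit X) (h₁ : X p.1 = q.1) (h₂ : X ∘ₗ p.2 = q.2 ∘ₗ X) :
    q ∈ enhancedOrbit μ ν V := by
  obtain ⟨b, hb₀, hb, hv⟩ := hp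
  have hX' := (Module.End.isUnit_iff X).1 hX
  have h (v : V) : q.2 (X v) = X (p.2 v) := (LinearMap.congr_fun h₂ v).symm
  refine ⟨b.map (LinearEquiv.ofBijective X hX'), fun i hi => ?_, fun i j hi hj => ?_, ?_⟩
  · exact (h _).trans ((congrArg X (hb₀ i hi)).trans (map_zero X))
  · exact (h _).trans (congrArg X (hb i j hi hj))
  · rw [← h₁, hv, map_sum]
    refine Finset.sum_congr rfl fun c _ => ?_
    split_ifs
    · rfl
    · exact map_zero X

/-- The orbit is dense in the space of pairs that lower the flag of the normal form: by
`exists_tangent` and `eventually_exists_isUnit`, each line in that space through the normal form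
stays in the orbit near the normal form. -/
theorem mem_enhancedOrbitClosure_of_boxFlag (b : Basis (partSum μ ν).cells ℂ V) {w : V}
    {y : V →ₗ[ℂ] V} (hw : w ∈ boxFlag b (μ.rowLen 0))
    (hy : ∀ a, y (b a) ∈ boxFlag b (boxPos μ a.1)) : (w, y) ∈ enhancedOrbitClosure μ ν V := by
  have : FiniteDimensional ℂ V := b.finiteDimensional_of_finite
  let q : Submodule ℂ (V →ₗ[ℂ] V) :=
    ⨅ a, (boxFlag b (boxPos μ a.1 + 1)).comap (LinearMap.applyₗ (b a))
  let P : Submodule ℂ (V × (V →ₗ[ℂ] V)) := (boxFlag b (μ.rowLen 0)).prod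
    (⨅ a, (boxFlag b (boxPos μ a.1)).comap (LinearMap.applyₗ (b a)))
  have hq {X : V →ₗ[ℂ] V} : X ∈ q ↔ ∀ a, X (b a) ∈ boxFlag b (boxPos μ a.1 + 1) := by
    simp [q, Submodule.mem_iInf]
  have hP {u : V} {z : V →ₗ[ℂ] V} : (u, z) ∈ P ↔
      u ∈ boxFlag b (μ.rowLen 0) ∧ ∀ a, z (b a) ∈ boxFlag b (boxPos μ a.1) := by
    simp [P, Submodule.mem_iInf]
  have hqm {X : V →ₗ[ℂ] V} (hX : X ∈ q) {c : ℕ} {u : V} (hu : u ∈ boxFlag b c) :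
      X u ∈ boxFlag b c := by
    simpa using map_mem_boxFlag (k := 0) (by simpa using hq.1 hX) hu
  have hlow {z : V →ₗ[ℂ] V} (hz : ∀ a, z (b a) ∈ boxFlag b (boxPos μ a.1)) {c : ℕ} {u : V}
      (hu : u ∈ boxFlag b (c + 1)) : z u ∈ boxFlag b c := by
    simpa using map_mem_boxFlag (k := 1) (by simpa using hz) hu
  have hyx (a) : (y - boxShift b) (b a) ∈ boxFlag b (boxPos μ a.1) :=
    sub_mem (hy a) (boxShift_basis_mem a)
  let S : q →ₗ[ℂ] P := (LinearMap.prod (LinearMap.applyₗ (boxSum b))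
    (LinearMap.mulRight ℂ (boxShift b) - LinearMap.mulLeft ℂ (boxShift b))).restrict fun X hX =>
      hP.2 ⟨hqm hX boxSum_mem, fun a => sub_mem (hqm hX (boxShift_basis_mem a))
        (hlow boxShift_basis_mem (hq.1 hX a))⟩
  let T : q →ₗ[ℂ] P := (LinearMap.prod (0 : _ →ₗ[ℂ] V)
    (-LinearMap.mulLeft ℂ (y - boxShift b))).restrict fun X hX =>
      hP.2 ⟨zero_mem _, fun a => neg_mem (hlow hyx (hq.1 hX a))⟩
  let e : q := ⟨1, hq.2 fun a => basis_mem_boxFlag a (Nat.lt_succ_self _)⟩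
  let d : P := ⟨(w - boxSum b, y - boxShift b), hP.2 ⟨sub_mem hw boxSum_mem, hyx⟩⟩
  have hS : Function.Surjective S := by
    rintro ⟨⟨u, z⟩, hz⟩
    obtain ⟨X, hX, h₁, h₂⟩ := exists_tangent (hP.1 hz).1 (hP.1 hz).2
    exact ⟨⟨X, hq.2 hX⟩, Subtype.ext (Prod.ext h₁ h₂)⟩
  have hmem : ∀ᶠ s in nhds (0 : ℂ), (boxSum b, boxShift b) +
      s • (w - boxSum b, y - boxShift b) ∈ enhancedOrbit μ ν V := by
    filter_upwards [eventually_exists_isUnit q e rfl S T hS d] with s hs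
    obtain ⟨X, hX, h⟩ := hs
    refine mem_enhancedOrbit_of_isUnit (mem_enhancedOrbit b) hX ?_ ?_
    · have h₁ : X.1 (boxSum b) + s • 0 = boxSum b + s • 0 + s • (w - boxSum b) :=
        congrArg (fun z : P => z.1.1) h
      rw [smul_zero, add_zero, add_zero] at h₁
      exact h₁
    · have h₂ : X.1 * boxShift b - boxShift b * X.1 + s • -((y - boxShift b) * X.1) =
          1 * boxShift b - boxShift b * 1 + s • -((y - boxShift b) * 1) + s • (y - boxShift b) :=
        congrArg (fun z : P => z.1.2) h
      change X.1 * boxShift b = (boxShift b + s • (y - boxShift b)) * X.1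
      rw [one_mul, mul_one, mul_one, sub_self, zero_add, smul_neg, smul_neg, neg_add_cancel,
        ← sub_eq_add_neg, sub_sub, sub_eq_zero] at h₂
      rw [h₂, add_mul, smul_mul_assoc]
  have := add_mem_zariskiClosure hmem
  rwa [Prod.mk_add_mk, add_sub_cancel, add_sub_cancel] at this

/-- Pairs that lower a flag of the right dimensions belong to the closure of the orbit. -/
theorem mem_enhancedOrbitClosure_of_flag [FiniteDimensional ℂ V] {w : V} {y : V →ₗ[ℂ] V} {N : ℕ}
    {W : ℕ → Submodule ℂ V} (hW : IsShiftedFlag y W N)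
    (hdim : ∀ c, finrank ℂ (W c) = ((partSum μ ν).cells.filter fun x => boxPos μ x < c).card)
    (hw : w ∈ W (μ.rowLen 0)) : (w, y) ∈ enhancedOrbitClosure μ ν V := by
  obtain ⟨N', hN', hpos⟩ : ∃ N', N ≤ N' ∧ ∀ x : (partSum μ ν).cells, boxPos μ x.1 < N' := by
    obtain ⟨K, hK⟩ := ((Set.finite_range fun x : (partSum μ ν).cells => boxPos μ x.1)).bddAbove
    exact ⟨max N (K + 1), le_max_left _ _, fun x =>
      lt_max_of_lt_right (Nat.lt_succ_of_le (hK ⟨x, rfl⟩))⟩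
  have hdim' (c) : finrank ℂ (W c) =
      (Finset.univ.filter fun x : (partSum μ ν).cells => boxPos μ x.1 < c).card := by
    rw [hdim, ← Finset.card_map (Function.Embedding.subtype _)]
    congr 1
    ext x
    simp [and_comm]
  obtain ⟨b, hb⟩ := exists_adapted_basis (fun x : (partSum μ ν).cells => boxPos μ x.1) hW.mono hdim'
    (hW.top _ hN') hpos
  have hWb (c) : W c = boxFlag b c := by
    refine (Submodule.eq_of_le_of_finrank_eq (Submodule.span_le.2 ?_) ?_).symm
    · rintro _ ⟨x, hx, rfl⟩
      exact hW.mono (Nat.succ_le_of_lt hx) (hb x)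
    · rw [hdim']
      have := finrank_span_eq_card (R := ℂ)
        (b.linearIndependent.comp (Subtype.val : {x | boxPos μ x.1 < c} → _)
          Subtype.val_injective)
      rw [Set.range_comp, Subtype.range_coe] at this
      exact this.trans (Fintype.card_subtype _)
  refine mem_enhancedOrbitClosure_of_boxFlag b (hWb _ ▸ hw) fun a => ?_
  rw [← hWb]
  exact hW.map_le _ (Submodule.mem_map_of_mem (hb a))

end orbit

/-! ### Quiver representations over the orbit -/

section boxShift

variable {μ ν : YoungDiagram} {V : Type} [AddCommGroup V] [Module ℂ V]
  {b : Basis (partSum μ ν).cells ℂ V}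

theorem boxShift_pow (k : ℕ) {i j : ℕ} (h : j + k < μ.rowLen i + ν.rowLen i) :
    (boxShift b ^ k) (boxVec b i (j + k)) = boxVec b i j := by
  induction k with
  | zero => rfl
  | succ k ih =>
    rw [pow_succ, Module.End.mul_apply, ← add_assoc, boxShift_succ (by omega), ih (by omega)]

theorem boxShift_pow_eq_zero {k i j : ℕ} (h : j < k) : (boxShift b ^ k) (boxVec b i j) = 0 := by
  by_cases hj : j < μ.rowLen i + ν.rowLen i
  · obtain ⟨l, rfl⟩ := Nat.exists_eq_add_of_lt h
    rw [show j + l + 1 = l + 1 + j by omega, pow_add, pow_succ, Module.End.mul_apply,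
      Module.End.mul_apply]
    have := boxShift_pow (b := b) j (i := i) (j := 0) (by omega)
    rw [zero_add] at this
    rw [this, boxShift_zero, map_zero]
  · rw [boxVec_eq_zero (by omega), map_zero]

theorem eq_boxSum_boxShift {p : V × (V →ₗ[ℂ] V)} (hp : p ∈ enhancedOrbit μ ν V) :
    ∃ b : Basis (partSum μ ν).cells ℂ V, p = (boxSum b, boxShift b) := by
  obtain ⟨b, h₀, h₁, h₂⟩ := hp
  refine ⟨b, Prod.ext h₂ (b.ext ?_)⟩
  rintro ⟨⟨i, j⟩, h⟩
  rw [basis_eq_boxVec]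
  rcases j with _ | j
  · rw [boxShift_zero, ← h₀ i h, basis_eq_boxVec]
  · have hj := mem_cells_iff.1 h
    rw [boxShift_succ hj, ← basis_eq_boxVec ⟨(i, j + 1), h⟩,
      h₁ i j h (mem_cells_iff.2 (by omega)), basis_eq_boxVec]

theorem range_boxShift_pow (k : ℕ) : LinearMap.range (boxShift b ^ k) =
    Submodule.span ℂ (b '' {c | c.1.2 + k < μ.rowLen c.1.1 + ν.rowLen c.1.1}) := by
  apply le_antisymm
  · rw [LinearMap.range_eq_map, ← b.span_eq, Submodule.map_span, Submodule.span_le]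
    rintro _ ⟨_, ⟨⟨⟨i, j⟩, h⟩, rfl⟩, rfl⟩
    have hj := mem_cells_iff.1 h
    rw [basis_eq_boxVec]
    rcases lt_or_ge j k with hk | hk
    · rw [SetLike.mem_coe, boxShift_pow_eq_zero hk]
      exact zero_mem _
    · obtain ⟨l, rfl⟩ := Nat.exists_eq_add_of_le' hk
      rw [SetLike.mem_coe, boxShift_pow k hj]
      have hl : (i, l) ∈ (partSum μ ν).cells := mem_cells_iff.2 (by omega)
      refine Submodule.subset_span ⟨⟨(i, l), hl⟩, hj, basis_eq_boxVec _⟩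
  · rw [Submodule.span_le]
    rintro _ ⟨⟨⟨i, j⟩, h⟩, hj, rfl⟩
    refine ⟨boxVec b i (j + k), ?_⟩
    rw [boxShift_pow k hj, basis_eq_boxVec]

theorem card_cells_filter (k : ℕ) :
    ((partSum μ ν).cells.filter fun c => c.2 + k < μ.rowLen c.1 + ν.rowLen c.1).card =
      ∑ a ∈ Finset.range ((partSum μ ν).colLen 0), (μ.rowLen a + ν.rowLen a - k) := by
  rw [Finset.card_eq_sum_card_fiberwise (f := Prod.fst)
    (t := Finset.range ((partSum μ ν).colLen 0))]
  · refine Finset.sum_congr rfl fun a _ => ?_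
    have e : ((partSum μ ν).cells.filter fun c => c.2 + k < μ.rowLen c.1 + ν.rowLen c.1).filter
        (fun x => x.1 = a) = (Finset.range (μ.rowLen a + ν.rowLen a - k)).map
          ⟨fun j => (a, j), fun _ _ h => congrArg Prod.snd h⟩ := by
      ext ⟨i, j⟩
      rw [Finset.mem_filter, Finset.mem_filter]
      simp only [YoungDiagram.mem_cells, mem_partSum, Finset.mem_map, Finset.mem_range]
      change _ ↔ ∃ k, _ ∧ (a, k) = (i, j)
      simp only [Prod.mk.injEq]
      constructor
      · rintro ⟨⟨h₁, h₂⟩, rfl⟩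
        exact ⟨j, by omega, rfl, rfl⟩
      · rintro ⟨k, hk, rfl, rfl⟩
        exact ⟨⟨by omega, by omega⟩, rfl⟩
    rw [e, Finset.card_map, Finset.card_range]
  · rintro ⟨i, j⟩ hx
    simp only [Finset.coe_filter, Set.mem_ofPred_eq, YoungDiagram.mem_cells] at hx
    simp only [Finset.coe_range, Set.mem_Iio]
    exact YoungDiagram.mem_iff_lt_colLen.1 ((partSum μ ν).up_left_mem le_rfl (Nat.zero_le _) hx.1)

theorem finrank_range_boxShift_pow {m : ℕ} (hm : (partSum μ ν).rowLen 0 = m + 1) {i : ℕ}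
    (hi : i ≤ m + 1) : finrank ℂ (LinearMap.range (boxShift b ^ (m + 1 - i))) =
      ∑ j ∈ Finset.range i, colSeq μ ν m j := by
  have e : finrank ℂ (LinearMap.range (boxShift b ^ (m + 1 - i))) =
      ∑ a ∈ Finset.range ((partSum μ ν).colLen 0),
        (μ.rowLen a + ν.rowLen a - (m + 1 - i)) := by
    rw [range_boxShift_pow, ← card_cells_filter]
    have := finrank_span_eq_card (R := ℂ) (b.linearIndependent.comp
      (Subtype.val : {c : (partSum μ ν).cells |
        c.1.2 + (m + 1 - i) < μ.rowLen c.1.1 + ν.rowLen c.1.1} → _) Subtype.val_injective)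
    rw [Set.range_comp, Subtype.range_coe] at this
    refine (this.trans (Fintype.card_subtype _)).trans ?_
    rw [← Finset.card_map (Function.Embedding.subtype _)]
    congr 1
    ext x
    simp [and_comm]
  rw [e]
  clear e
  induction i with
  | zero =>
    rw [Finset.sum_range_zero]
    refine Finset.sum_eq_zero fun a _ => ?_
    have h := (partSum μ ν).rowLen_anti 0 a (Nat.zero_le a)
    rw [hm, rowLen_partSum] at h
    omega
  | succ i ih =>
    rw [Finset.sum_range_succ, ← ih (by omega), ← sum_indicator (colSeq_le (μ := μ) (ν := ν)
      (m := m) i), ← Finset.sum_add_distrib]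
    refine Finset.sum_congr rfl fun a _ => ?_
    simp only [lt_colSeq_iff]
    split_ifs <;> omega

end boxShift

section lift

variable {μ ν : YoungDiagram} {m : ℕ} {I : Finset (Fin (m + 1))}

open Classical in
/-- The number of elements of `I` from `i` on. -/
noncomputable def tailCount (I : Finset (Fin (m + 1))) (i : ℕ) : ℕ :=
  ((Finset.range (m + 1)).filter fun j => i ≤ j ∧ inSet I j).card

theorem tailCount_last : tailCount I (m + 1) = 0 := by
  classical
  rw [tailCount, Finset.card_eq_zero, Finset.filter_eq_empty_iff]
  intro j hj h
  have := Finset.mem_range.1 hj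
  omega

theorem tailCount_of_mem {i : ℕ} (h : inSet I i) : tailCount I i = tailCount I (i + 1) + 1 := by
  classical
  rw [tailCount, tailCount, ← Finset.card_insert_of_notMem (a := i) (by simp)]
  congr 1
  ext j
  obtain ⟨hi, -⟩ := id h
  simp only [Finset.mem_filter, Finset.mem_insert, Finset.mem_range]
  constructor
  · rintro ⟨h₁, h₂, h₃⟩
    rcases h₂.eq_or_lt with h₄ | h₄
    · exact Or.inl h₄.symm
    · exact Or.inr ⟨h₁, h₄, h₃⟩
  · rintro (rfl | ⟨h₁, h₂, h₃⟩)
    · exact ⟨hi, le_rfl, h⟩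
    · exact ⟨h₁, by omega, h₃⟩

theorem tailCount_of_notMem {i : ℕ} (h : ¬ inSet I i) : tailCount I i = tailCount I (i + 1) := by
  classical
  rw [tailCount, tailCount]
  congr 1
  ext j
  simp only [Finset.mem_filter]
  refine and_congr_right fun _ => and_congr_left fun h₂ => ?_
  have : i ≠ j := by
    rintro rfl
    exact h h₂
  omega

/-- A row which is longer to the left of the wall than the number of remaining columns there
meets all remaining columns to the right of the wall. -/
theorem IsColumnSet.le_rowLen (hI : IsColumnSet μ ν m I) (hm : (partSum μ ν).rowLen 0 = m + 1)
    {i a : ℕ} (ha : tailCount I i < μ.rowLen a) : m + 1 - i ≤ tailCount I i + ν.rowLen a := by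
  classical
  obtain ⟨j, hj, hja⟩ : ∃ j < i, a < colSeq μ ν m j := by
    by_contra! hcon
    refine absurd ha (not_lt.2 ?_)
    rw [← hI.leftRow_eq a, leftRow, tailCount]
    refine Finset.card_le_card fun j hj => ?_
    simp only [Finset.mem_filter] at hj ⊢
    refine ⟨hj.1, ?_, hj.2.1⟩
    by_contra hlt
    have := hcon j (by omega)
    omega
  rw [← hI.rightRow_eq hm a, rightRow, tailCount]
  refine le_trans ?_ (Finset.card_union_le _ _)
  rw [← Nat.card_Ico]
  refine Finset.card_le_card fun k hk => ?_
  rw [Finset.mem_Ico] at hk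
  simp only [Finset.mem_union, Finset.mem_filter, Finset.mem_range]
  have := colSeq_mono (μ := μ) (ν := ν) (m := m) (i := j) (j := k) (by omega)
  by_cases h : inSet I k
  · exact Or.inl ⟨hk.2, hk.1, h⟩
  · exact Or.inr ⟨hk.2, h, by omega⟩

theorem IsColumnSet.pow_boxSum_mem (hI : IsColumnSet μ ν m I)
    (hm : (partSum μ ν).rowLen 0 = m + 1) {V : Type} [AddCommGroup V] [Module ℂ V]
    (b : Basis (partSum μ ν).cells ℂ V) (i : ℕ) : (boxShift b ^ tailCount I i) (boxSum b) ∈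
      LinearMap.range (boxShift b ^ (m + 1 - i)) := by
  rw [boxSum, map_sum]
  refine sum_mem ?_
  rintro ⟨⟨a, j⟩, hc⟩ -
  split_ifs with h
  · have h : j + 1 = μ.rowLen a := h
    rw [basis_eq_boxVec]
    rcases lt_or_ge j (tailCount I i) with hj | hj
    · rw [boxShift_pow_eq_zero hj]
      exact zero_mem _
    · have hν := hI.le_rowLen hm (i := i) (a := a) (by omega)
      by_cases hle : m + 1 - i ≤ tailCount I i
      · obtain ⟨l, hl⟩ := Nat.exists_eq_add_of_le hle
        exact ⟨(boxShift b ^ l) (boxVec b a j), by rw [hl, pow_add, Module.End.mul_apply]⟩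
      · obtain ⟨l, hl⟩ := Nat.exists_eq_add_of_le (not_le.1 hle).le
        refine ⟨boxVec b a (j + l), ?_⟩
        rw [hl, pow_add, Module.End.mul_apply, boxShift_pow l (by omega)]
  · rw [map_zero]
    exact zero_mem _

theorem exists_comp_eq {F E E' V : Type} [Field F] [AddCommGroup E] [Module F E] [AddCommGroup E']
    [Module F E'] [AddCommGroup V] [Module F V] {f : E →ₗ[F] V} (hf : Function.Injective f)
    {g : E' →ₗ[F] V} (h : ∀ w, g w ∈ LinearMap.range f) : ∃ k : E' →ₗ[F] E, ∀ w, f (k w) = g w :=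
  ⟨(LinearEquiv.ofInjective f hf).symm.toLinearMap ∘ₗ g.codRestrict _ h, fun w =>
    congrArg Subtype.val ((LinearEquiv.ofInjective f hf).apply_symm_apply ⟨g w, h w⟩)⟩

/-- The point over a pair `(v, x)` in the orbit consists of the images of the powers of `x`, their
inclusions, the restrictions of `x`, and the vectors `x ^ k v` with `k = tailCount I i`. The images
are identified with the spaces `U_i` by arbitrary isomorphisms `ι i`, except for the identity at
the last vertex. -/
theorem enhancedOrbit_subset_image (hI : IsColumnSet μ ν m I)
    (hm : (partSum μ ν).rowLen 0 = m + 1) :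
    enhancedOrbit μ ν (U (colSeq μ ν m) (m + 1)) ⊆
      quiverMap (colSeq μ ν m) m '' quiverVariety (colSeq μ ν m) m I := by
  intro p hp
  obtain ⟨b, rfl⟩ := eq_boxSum_boxShift hp
  let r := colSeq μ ν m
  let x := boxShift b
  have hx : x = boxShift b := rfl
  have hι : ∃ ι : ∀ i, U r i →ₗ[ℂ] U r (m + 1), (∀ i ≤ m + 1, Function.Injective (ι i) ∧
      LinearMap.range (ι i) = LinearMap.range (x ^ (m + 1 - i))) ∧ ι (m + 1) = LinearMap.id := by
    have (i : ℕ) : ∃ ι : U r i →ₗ[ℂ] U r (m + 1), i ≤ m + 1 → Function.Injective ι ∧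
        LinearMap.range ι = LinearMap.range (x ^ (m + 1 - i)) := by
      by_cases hi : i ≤ m + 1
      · let e : U r i ≃ₗ[ℂ] LinearMap.range (x ^ (m + 1 - i)) :=
          LinearEquiv.ofFinrankEq _ _ (by
            rw [hx, finrank_range_boxShift_pow hm hi, Module.finrank_fin_fun])
        refine ⟨Submodule.subtype _ ∘ₗ e.toLinearMap, fun _ =>
          ⟨Subtype.val_injective.comp e.injective, ?_⟩⟩
        rw [LinearMap.range_comp, LinearEquiv.range, Submodule.map_top, Submodule.range_subtype]
      · exact ⟨0, fun h => absurd h hi⟩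
    choose ι hι using this
    refine ⟨Function.update ι (m + 1) LinearMap.id, fun i hi => ?_, Function.update_self ..⟩
    rcases hi.eq_or_lt with rfl | hi
    · rw [Function.update_self, Nat.sub_self, pow_zero]
      exact ⟨Function.injective_id, rfl⟩
    · rw [Function.update_of_ne hi.ne]
      exact hι i hi.le
  obtain ⟨ι, hι, hlast⟩ := hι
  have hA (i : ℕ) : ∃ A : U r i →ₗ[ℂ] U r (i + 1), i ≤ m → ∀ w, ι (i + 1) (A w) = ι i w := by
    by_cases hi : i ≤ m
    · obtain ⟨A, h⟩ := exists_comp_eq (hι (i + 1) (by omega)).1 (g := ι i) fun w => by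
        have hw : ι i w ∈ LinearMap.range (ι i) := ⟨w, rfl⟩
        rw [(hι i (by omega)).2] at hw
        obtain ⟨z, hz⟩ := hw
        rw [(hι (i + 1) (by omega)).2, ← hz]
        refine ⟨x z, ?_⟩
        rw [← Module.End.mul_apply, ← pow_succ]
        congr 2
        omega
      exact ⟨A, fun _ => h⟩
    · exact ⟨0, fun h => absurd h hi⟩
  have hB (i : ℕ) : ∃ B : U r (i + 1) →ₗ[ℂ] U r i, i ≤ m → ∀ w, ι i (B w) = x (ι (i + 1) w) := by
    by_cases hi : i ≤ m
    · obtain ⟨B, h⟩ := exists_comp_eq (hι i (by omega)).1 (g := x ∘ₗ ι (i + 1)) fun w => by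
        have hw : ι (i + 1) w ∈ LinearMap.range (ι (i + 1)) := ⟨w, rfl⟩
        rw [(hι (i + 1) (by omega)).2] at hw
        obtain ⟨z, hz⟩ := hw
        rw [(hι i (by omega)).2, LinearMap.comp_apply, ← hz]
        refine ⟨z, ?_⟩
        rw [← Module.End.mul_apply, ← pow_succ']
        congr 2
        omega
      exact ⟨B, fun _ => h⟩
    · exact ⟨0, fun h => absurd h hi⟩
  have hu (i : ℕ) : ∃ u : U r i, i ≤ m + 1 → ι i u = (x ^ tailCount I i) (boxSum b) := by
    by_cases hi : i ≤ m + 1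
    · have h := hI.pow_boxSum_mem hm b i
      rw [show LinearMap.range (boxShift b ^ (m + 1 - i)) = _ from (hι i hi).2.symm] at h
      obtain ⟨u, h⟩ := h
      exact ⟨u, fun _ => h⟩
    · exact ⟨0, fun h => absurd h hi⟩
  choose A hA using hA
  choose B hB using hB
  choose u hu using hu
  refine ⟨(fun i => u i, fun i => A i, fun i => B i), ⟨fun i => LinearMap.ext fun w => ?_,
    fun i hi => ?_, fun i hi => ?_⟩, Prod.ext ?_ ?_⟩
  · obtain ⟨i, h⟩ := i
    change B (i + 1) (A (i + 1) w) = A i (B i w)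
    apply (hι (i + 1) (by omega)).1
    rw [hB _ (by omega), hA _ (by omega), hA _ (by omega), hB _ (by omega)]
  · obtain ⟨i, h⟩ := i
    change B i (u (i + 1)) = u i
    apply (hι i (by omega)).1
    rw [hB _ (by omega), hu _ (by omega), hu _ (by omega), tailCount_of_mem ⟨h, hi⟩, pow_succ',
      Module.End.mul_apply]
  · obtain ⟨i, h⟩ := i
    change A i (u i) = u (i + 1)
    apply (hι (i + 1) (by omega)).1
    rw [hA _ (by omega), hu _ (by omega), hu _ (by omega),
      tailCount_of_notMem fun ⟨_, hi'⟩ => hi hi']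
  · change u (m + 1) = boxSum b
    have := hu (m + 1) le_rfl
    rwa [hlast, tailCount_last, pow_zero] at this
  · refine LinearMap.ext fun w => ?_
    change A m (B m w) = x w
    have := hA m le_rfl (B m w)
    rwa [hB m le_rfl, hlast] at this

end lift

/-! ### The quotient morphism -/

section quotient

theorem zariskiClosure_mono {E : Type} [AddCommGroup E] [Module ℂ E] {S T : Set E} (h : S ⊆ T) :
    zariskiClosure S ⊆ zariskiClosure T := fun _ hx f hf hT => hx f hf fun s hs => hT s (h hs)

variable {μ ν : YoungDiagram} {m : ℕ} {I : Finset (Fin (m + 1))}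

theorem IsColumnSet.exists_flag (hI : IsColumnSet μ ν m I)
    (hm : (partSum μ ν).rowLen 0 = m + 1) {p : RepSpace (colSeq μ ν m) m}
    (hp : p ∈ quiverVariety (colSeq μ ν m) m I) :
    ∃ W : ℕ → Submodule ℂ (U (colSeq μ ν m) (m + 1)),
      IsShiftedFlag (quiverMap (colSeq μ ν m) m p).2 W (m + 1) ∧
      (∀ c, finrank ℂ (W c) = ((partSum μ ν).cells.filter fun x => boxPos μ x < c).card) ∧
      (quiverMap (colSeq μ ν m) m p).1 ∈ W (μ.rowLen 0) := by
  classical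
  obtain ⟨W, hW, hdim, hw⟩ := exists_flag_quiverMap hp (fun i _ j hj => colSeq_mono hj.le)
    (fun i _ => colSeq_pos hm i) (fun i _ => colSeq_le i)
    fun i _ hi j hj hj' => hI.lt_of_notMem hi hj hj'
  refine ⟨W, hW, fun c => ?_, ?_⟩
  · rw [hdim, ← hI.flagDim_eq hm]
  · rwa [hI.leftCols_eq] at hw

theorem IsColumnSet.image_eq (hI : IsColumnSet μ ν m I)
    (hm : (partSum μ ν).rowLen 0 = m + 1) :
    quiverMap (colSeq μ ν m) m '' quiverVariety (colSeq μ ν m) m I =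
      enhancedOrbitClosure μ ν (U (colSeq μ ν m) (m + 1)) := by
  apply Set.Subset.antisymm
  · rintro _ ⟨p, hp, rfl⟩
    obtain ⟨W, hW, hdim, hw⟩ := hI.exists_flag hm hp
    exact mem_enhancedOrbitClosure_of_flag hW hdim hw
  · exact (zariskiClosure_mono (enhancedOrbit_subset_image hI hm)).trans
      zariskiClosure_image_subset

/-- Functions on the image of the quiver variety pull back to invariant functions. -/
noncomputable def pullback {r : ℕ → ℕ} {Y : Set (U r (m + 1) × (U r (m + 1) →ₗ[ℂ] U r (m + 1)))}
    (h : Set.MapsTo (quiverMap r m) (quiverVariety r m I) Y) :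
    coordRing Y →ₐ[ℂ] invariantRing (repH r m) (quiverVariety r m I) where
  toFun f := ⟨fun p => f.1 ⟨quiverMap r m p.1, h p.2⟩, by
    obtain ⟨_, F, hF, rfl⟩ := f
    refine ⟨precomp_quiverMap_mem_coordRing hF, fun g x y hxy => ?_⟩
    have : quiverMap r m y.1 = quiverMap r m x.1 := by rw [← hxy, quiverMap_repH]
    exact congrArg F this⟩
  map_one' := rfl
  map_mul' _ _ := rfl
  map_zero' := rfl
  map_add' _ _ := rfl
  commutes' _ := rfl

theorem pullback_bijective {r : ℕ → ℕ}
    {Y : Set (U r (m + 1) × (U r (m + 1) →ₗ[ℂ] U r (m + 1)))}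
    (h : quiverMap r m '' quiverVariety r m I = Y) :
    Function.Bijective (pullback (I := I) (Set.mapsTo_iff_image_subset.2 h.subset)) := by
  constructor
  · intro f g hfg
    apply Subtype.ext
    funext y
    obtain ⟨y, hy⟩ := y
    obtain ⟨p, hp, rfl⟩ := h.superset hy
    exact congrFun (congrArg Subtype.val hfg) ⟨p, hp⟩
  · intro f
    obtain ⟨F, hF, hfF⟩ := exists_polyFun_of_invariant f.2
    exact ⟨⟨restrictFun Y F, F, hF, rfl⟩, Subtype.ext (funext fun p => (hfF p).symm)⟩

theorem isIso_quotientMap {E F : Type} [AddCommGroup E] [Module ℂ E] [AddCommGroup F]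
    [Module ℂ F] {G : Type} [Group G] {ρ : Representation ℂ G E} {X : Set E} {Y : Set F}
    {ψ : coordRing Y →ₐ[ℂ] invariantRing ρ X} (hψ : Function.Bijective ψ) :
    CategoryTheory.IsIso (quotientMap ψ) := by
  have : CategoryTheory.IsIso
      (CommRingCat.ofHom (ψ : coordRing Y →+* invariantRing ρ X)) :=
    (CategoryTheory.ConcreteCategory.isIso_iff_bijective _).2 hψ
  exact inferInstanceAs (CategoryTheory.IsIso (AlgebraicGeometry.Spec.map _))

end quotient

end EnhancedQuiver

open EnhancedQuiver in
theorem theorem4p5 (μ ν : YoungDiagram) (m : ℕ)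
    (hm : (partSum μ ν).rowLen 0 = m + 1)
    (I : Finset (Fin (m + 1))) (hI : IsColumnSet μ ν m I) :
    -- the map takes values in the enhanced nilpotent cone
    Set.MapsTo (quiverMap (colSeq μ ν m) m) (quiverVariety (colSeq μ ν m) m I)
      (enhancedNilpotentCone (U (colSeq μ ν m) (m + 1))) ∧
    -- its image is the orbit closure
    ∃ himage : quiverMap (colSeq μ ν m) m '' quiverVariety (colSeq μ ν m) m I =
        enhancedOrbitClosure μ ν (U (colSeq μ ν m) (m + 1)),
      -- pulling back regular functions along it defines an isomorphism from the quotient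
      ∃ ψ : coordRing (enhancedOrbitClosure μ ν (U (colSeq μ ν m) (m + 1))) →ₐ[ℂ]
          invariantRing (repH (colSeq μ ν m) m) (quiverVariety (colSeq μ ν m) m I),
        (∀ (f : coordRing (enhancedOrbitClosure μ ν (U (colSeq μ ν m) (m + 1))))
          (p : RepSpace (colSeq μ ν m) m) (hp : p ∈ quiverVariety (colSeq μ ν m) m I),
          (ψ f).1 ⟨p, hp⟩ =
            f.1 ⟨quiverMap (colSeq μ ν m) m p, himage ▸ Set.mem_image_of_mem _ hp⟩) ∧
        CategoryTheory.IsIso (quotientMap ψ) := by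
  refine ⟨fun p hp => ?_, hI.image_eq hm, pullback _, fun f p hp => rfl,
    isIso_quotientMap (pullback_bijective (hI.image_eq hm))⟩
  obtain ⟨W, hW, -, -⟩ := hI.exists_flag hm hp
  exact hW.isNilpotent
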